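/- Let $(X,g)$ be a closed Riemannian $n$-manifold with volume $dv_g$, let $E,F\to X$ be smooth real vector bundles with smooth fibre metrics and smooth connections $\nabla$, let $\sigma_D:T^*X\to\mathrm{Hom}(E,F)$ and $A:E\to F$ be smooth bundle maps, and let $D=\sigma_D\circ\nabla$, i.e. $D\xi=\sum_i\sigma_D(e^i)\nabla_{e_i}\xi$. A pair $(\sigma,A)$ is *concentrating* if $A^*\sigma(u)=\sigma(u)^*A$ for every covector $u$. The singular set of $A$ is $Z_A=\{x:\ker A_x\ne0\}$. For a family $P_s:\Gamma(E')\to\Gamma(F')$ ($s\in\mathbb R$) of operators between the smooth sections of subbundles $E'\subseteq E$, $F'\subseteq F$, we say that *low eigensections of $P_s$ concentrate along $Z\subseteq X$* if for all $\delta>0$ and $C\ge0$ there is a constant $C'>0$ such that, for all $s\neq0$ and all $\xi\in\Gamma(E')$ with $\|\xi\|_{L^2}=1$ which satisfy $\|P_s\xi\|_{L^2}^2\le C|s|$ or $P_s^*P_s\xi=\lambda\xi$ with $|\lambda|\le C|s|$, $$\int_{X\setminus Z(\delta)}|\xi|^2\,dv_g<\frac{C'}{|s|},$$ where $Z(\delta)$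 is the $\delta$-neighbourhood of $Z$ and $P_s^*$ is the formal $L^2$ adjoint. **(1) Restriction by an involution.** Let $T=\mathrm{diag}(\tau,\hat\tau)$ be a smooth, metric-preserving bundle involution of $E\oplus F$ with $\nabla T=0$ and $\sigma_D(v)\tau=\varepsilon\hat\tau\sigma_D(v)$ for all covectors $v$, where $\varepsilon\in\{1,-1\}$ is fixed. Let $E^\pm$, $F^\pm$ be the $\pm1$ eigenbundles of $\tau$, $\hat\tau$, let $p^+=\frac12(1+\tau)$ and $\hat p^\varepsilon=\frac12(1+\varepsilon\hat\tau)$, and put $D^+=\sigma_D\circ p^+\nabla|_{E^+}$ and $A^+=\hat p^\varepsilon A|_{E^+}$. Suppose that $(\sigma_D,A)$ is a concentrating pair. Then $D^+$ is a first order operator $\Gamma(E^+)\to\Gamma(F^\varepsilon)$ with symbol $\sigma_{D^+}(u)=\sigma_D(u)|_{E^+}:E^+\to F^\varepsilon$, it is the restriction of $D$, and $\sigma_{D^+}(u)$ is bijective whenever $\sigma_D(u)$ is. The pair $(\sigma_{D^+},A^+)$ is concentrating, and low eigensections of $D^+_s=D^++sA^+:\Gamma(E^+)\to\Gamma(F^\varepsilon)$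 concentrate along $Z_{A^+}$. **Spinor-form pairs.** In (2) and (3), suppose that there are a field of finite-dimensional Hermitian Clifford modules $W_x$ over $T^*_xX$ (so that $c(u)c(v)+c(v)c(u)=-2\langle u,v\rangle$ and $c(v)^*=-c(v)$) and a field of spinors $\psi_x\in W_x$, and that both $E$ and $F$ are fibrewise isometrically identified with $W\oplus\Lambda^*_{\mathbb C}T^*X$ in such a way that $\sigma_D(v)=c(v)\oplus(v\wedge\cdot-\iota_v)$ and $A(\varphi,\alpha)=(P_\psi\alpha,-P_\psi^*\varphi)$. Here $P_\psi\alpha=c(\alpha)\psi$, where $c(e^{j_1}\wedge\cdots\wedge e^{j_p})=c(e^{j_1})\cdots c(e^{j_p})$ for $j_1<\dots<j_p$ in an oriented orthonormal frame; the orientation of each tangent space is part of the data. No continuity in $x$ of these identifications is required beyond the smoothness of $\sigma_D$, $A$ and of the involutions below, which are assumed to be smooth bundle maps. **(2) Parity.** If $n=2m$ and $i^mc(d\mathrm{vol})\psi=\psi$, let $\tau=\hat\tau=i^mc(d\mathrm{vol})\oplus(-1)^{p+1}$, with $(-1)^{p+1}$ acting on $p$-forms. Then $\tau$ and $\hat\tau$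 are metric-preserving involutions, $\sigma_D(v)\tau=-\hat\tau\sigma_D(v)$, $A$ maps $E^+=W^+\oplus\Lambda^{odd}_{\mathbb C}$ to $F^-=W^-\oplus\Lambda^{ev}_{\mathbb C}$, and for $D^+$, $A^+$ defined as in (1) with $\varepsilon=-1$, $D^+:\Gamma(E^+)\to\Gamma(F^-)$ is a first order operator with symbol $\sigma_{D^+}=\sigma_D|_{E^+}$, $(\sigma_{D^+},A^+)$ is a concentrating pair, and low eigensections of $D^++sA^+$ concentrate along $Z_{A^+}$. **(3) Self-duality.** If $n=4m$ and $i^{2m}c(d\mathrm{vol})\psi=\psi$, let $\tau,\hat\tau$ be the parity involutions as in (2) (with $2m$ in place of $m$). Let $T(\varphi,\alpha)=(\varphi,T\alpha)$ on $W\oplus\Lambda^*_{\mathbb C}T^*X$, where $T$ is the identity on $p$-forms with $p<2m$, the Hodge star on $2m$-forms, and minus the identity on $p$-forms with $p>2m$; write $T_E$, $T_F$ for the corresponding endomorphisms of $E$ and $F$. Then $T_E,T_F$ are metric-preserving involutions. Let $E^{++}=E^+\cap\ker(T_E-1)=W^+\oplus\bigoplus_{p=1}^m\Lambda^{2p-1}_{\mathbb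 C}$ and $F^{-+}=F^-\cap\ker(T_F-1)=W^-\oplus\Lambda^{2m,+}_{\mathbb C}\oplus\bigoplus_{p=0}^{m-1}\Lambda^{2p}_{\mathbb C}$, and set $p_T=\frac12(1+T_E)$, $\hat p_T=\frac12(1+T_F)$, $D^{++}=\hat p_T\sigma_D\circ p_Tp^+\nabla|_{E^{++}}$, $A^{++}=\hat p_T\hat p^-A|_{E^{++}}$. Then $D^{++}:\Gamma(E^{++})\to\Gamma(F^{-+})$ is a first order operator with symbol $\sigma_{D^{++}}=\hat p_T\sigma_D|_{E^{++}}$, $(\sigma_{D^{++}},A^{++})$ is a concentrating pair, and low eigensections of $D^{++}+sA^{++}$ concentrate along $Z_{A^{++}}$. -/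

import Mathlib

open Bundle Manifold ContDiff MeasureTheory
open scoped InnerProductSpace

noncomputable section

/-! ### The Riemannian volume measure -/

section Volume

variable {n : ℕ} {M : Type*} [TopologicalSpace M] [ChartedSpace (EuclideanSpace ℝ (Fin n)) M]
  [IsManifold (𝓡 n) ∞ M] [RiemannianBundle (fun x : M => TangentSpace (𝓡 n) x)]

/-- The `i`-th coordinate vector field `∂_i` of the preferred chart at `x₀`, at the point `p`; that
is, the derivative of the inverse chart in the direction of the `i`-th basis vector. -/
def coordVector (x₀ : M) (i : Fin n) (p : M) : TangentSpace (𝓡 n) p :=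
  (trivializationAt (EuclideanSpace ℝ (Fin n)) (fun x : M => TangentSpace (𝓡 n) x) x₀).symm p
    (EuclideanSpace.single i (1 : ℝ))

/-- The Gram matrix `g_{ij} = ⟨∂_i, ∂_j⟩` of the metric in the preferred chart at `x₀`, at the
point `p` of the domain of that chart. -/
def chartGram (x₀ : M) (p : M) : Matrix (Fin n) (Fin n) ℝ :=
  Matrix.of fun i j => ⟪coordVector x₀ i p, coordVector x₀ j p⟫_ℝ

/-- The measure `√(det g_{ij}) dy` of the preferred chart at `x₀`, as a measure on `M` carried by
the domain of that chart. -/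
def chartVolume [MeasurableSpace M] (x₀ : M) : Measure M :=
  ((volume.restrict (extChartAt (𝓡 n) x₀).target).withDensity
    (fun y => ENNReal.ofReal
      (Real.sqrt (chartGram (n := n) x₀ ((extChartAt (𝓡 n) x₀).symm y)).det))).map
    (extChartAt (𝓡 n) x₀).symm

variable (n M) in
/-- The Riemannian volume measure. By the change of variables formula the measures `chartVolume x₀`
agree on overlaps of charts, so that their supremum is the measure which on the domain of
each chart is `√(det g_{ij}) dy`. -/
def riemannianVolume [MeasurableSpace M] : Measure M :=
  ⨆ x₀ : M, chartVolume (n := n) x₀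

end Volume

/-! ### Concentrating pairs -/

section Pairs

variable {n : ℕ} {M : Type*} [TopologicalSpace M] [ChartedSpace (EuclideanSpace ℝ (Fin n)) M]

/-- The cotangent space at `x`. -/
abbrev Cotangent (n : ℕ) {M : Type*} [TopologicalSpace M]
    [ChartedSpace (EuclideanSpace ℝ (Fin n)) M] (x : M) : Type :=
  TangentSpace (𝓡 n) x →L[ℝ] ℝ

section Fibres

variable {E F : M → Type*} [∀ x, NormedAddCommGroup (E x)] [∀ x, InnerProductSpace ℝ (E x)]
  [∀ x, FiniteDimensional ℝ (E x)]
  [∀ x, NormedAddCommGroup (F x)] [∀ x, InnerProductSpace ℝ (F x)]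
  [∀ x, FiniteDimensional ℝ (F x)]

/-- `(σ, A)` is a concentrating pair: `A* ∘ σ(u) = σ(u)* ∘ A` for every covector `u`. -/
def IsConcentratingPair (σ : ∀ x : M, Cotangent n x → (E x →ₗ[ℝ] F x))
    (A : ∀ x : M, E x →ₗ[ℝ] F x) : Prop :=
  ∀ (x : M) (u : Cotangent n x),
    LinearMap.adjoint (A x) ∘ₗ σ x u = LinearMap.adjoint (σ x u) ∘ₗ A x

end Fibres

/-- The singular set `Z_A`, the set of points at which `A` fails to be injective. -/
def singularSet {E F : M → Type*} [∀ x, AddCommGroup (E x)] [∀ x, Module ℝ (E x)]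
    [∀ x, AddCommGroup (F x)] [∀ x, Module ℝ (F x)] (A : ∀ x : M, E x →ₗ[ℝ] F x) : Set M :=
  {x | LinearMap.ker (A x) ≠ ⊥}

end Pairs

/-! ### Smooth bundle maps, Dirac operators and involutions -/

section Bundles

variable {n : ℕ} {M : Type*} [TopologicalSpace M] [ChartedSpace (EuclideanSpace ℝ (Fin n)) M]
  {FE : Type*} [NormedAddCommGroup FE] [NormedSpace ℝ FE]
  {FF : Type*} [NormedAddCommGroup FF] [NormedSpace ℝ FF]
  {E : M → Type*} [TopologicalSpace (TotalSpace FE E)]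
  [∀ x, NormedAddCommGroup (E x)] [∀ x, InnerProductSpace ℝ (E x)]
  [FiberBundle FE E] [VectorBundle ℝ FE E]
  {F : M → Type*} [TopologicalSpace (TotalSpace FF F)]
  [∀ x, NormedAddCommGroup (F x)] [∀ x, InnerProductSpace ℝ (F x)]
  [FiberBundle FF F] [VectorBundle ℝ FF F]

variable (n FE) in
/-- The smooth sections of `E` with values in the family of subspaces `E'`. If `E'` is a subbundle,
these are the smooth sections of `E'`. -/
def sectionsIn (E' : ∀ x, Submodule ℝ (E x)) : Set (∀ x, E x) :=
  {ξ | ContMDiff (𝓡 n) ((𝓡 n).prod 𝓘(ℝ, FE)) ∞ (fun x => TotalSpace.mk' FE x (ξ x)) ∧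
    ∀ x, ξ x ∈ E' x}

variable (n FE FF) in
/-- `A : E → F` is a smooth bundle map. -/
def IsSmoothHom (A : ∀ x : M, E x →L[ℝ] F x) : Prop :=
  ContMDiff (𝓡 n) ((𝓡 n).prod 𝓘(ℝ, FE →L[ℝ] FF)) ∞
    (fun x => TotalSpace.mk' (FE →L[ℝ] FF) (E := fun x => E x →L[ℝ] F x) x (A x))

variable [IsManifold (𝓡 n) ∞ M]

variable (FE FF) in
/-- `σ : T*M → Hom(E, F)` is a smooth bundle map. -/
def IsSmoothSymbol (σ : ∀ x : M, Cotangent n x →L[ℝ] (E x →L[ℝ] F x)) : Prop :=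
  ContMDiff (𝓡 n)
    ((𝓡 n).prod 𝓘(ℝ, (EuclideanSpace ℝ (Fin n) →L[ℝ] ℝ) →L[ℝ] (FE →L[ℝ] FF))) ∞
    (fun x => TotalSpace.mk' ((EuclideanSpace ℝ (Fin n) →L[ℝ] ℝ) →L[ℝ] (FE →L[ℝ] FF))
      (E := fun x => (TangentSpace (𝓡 n) x →L[ℝ] Bundle.Trivial M ℝ x) →L[ℝ] (E x →L[ℝ] F x))
      x (σ x))

/-- The operator `σ ∘ p ∇`, i.e. `ξ ↦ ∑ᵢ σ(eⁱ) (p (∇_{eᵢ} ξ))` for a (equivalently any) basis `eᵢ` of the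
tangent space with dual basis `eⁱ`, where `p` is an endomorphism of `E`. -/
def diracOp (nabla : CovariantDerivative (𝓡 n) FE E)
    (σ : ∀ x : M, Cotangent n x →L[ℝ] (E x →L[ℝ] F x)) (p : ∀ x : M, E x →L[ℝ] E x)
    (ξ : ∀ x, E x) (x : M) : F x :=
  ∑ i : Fin n,
    let e : TangentSpace (𝓡 n) x := EuclideanSpace.single i (1 : ℝ)
    let e' : Cotangent n x := (EuclideanSpace.proj i : EuclideanSpace ℝ (Fin n) →L[ℝ] ℝ)
    σ x e' (p x (nabla ξ x e))

/-- `τ` is a smooth metric-preserving bundle involution of `E`. -/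
structure IsMetricInvolution (n : ℕ) {M : Type*} [TopologicalSpace M]
    [ChartedSpace (EuclideanSpace ℝ (Fin n)) M] (FE : Type*) [NormedAddCommGroup FE]
    [NormedSpace ℝ FE] {E : M → Type*} [TopologicalSpace (TotalSpace FE E)]
    [∀ x, NormedAddCommGroup (E x)] [∀ x, InnerProductSpace ℝ (E x)]
    [FiberBundle FE E] [VectorBundle ℝ FE E] (τ : ∀ x : M, E x →L[ℝ] E x) : Prop where
  smooth : IsSmoothHom n FE FE τ
  involutive : ∀ x e, τ x (τ x e) = e
  isometry : ∀ x e e', ⟪τ x e, τ x e'⟫_ℝ = ⟪e, e'⟫_ℝ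

/-- The bundle endomorphism `τ` is parallel: `∇ (τ ξ) = τ (∇ ξ)` for smooth sections `ξ`. -/
def IsParallel (nabla : CovariantDerivative (𝓡 n) FE E) (τ : ∀ x : M, E x →L[ℝ] E x) : Prop :=
  ∀ ξ : (∀ x, E x),
    ContMDiff (𝓡 n) ((𝓡 n).prod 𝓘(ℝ, FE)) ∞ (fun x => TotalSpace.mk' FE x (ξ x)) →
    ∀ (x : M) (v : TangentSpace (𝓡 n) x),
      nabla (fun y => τ y (ξ y)) x v = τ x (nabla ξ x v)

/-- The eigenspaces of `τ` for the eigenvalue `ε = ±1`. -/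
def eigenbundle (τ : ∀ x : M, E x →L[ℝ] E x) (ε : ℝ) (x : M) : Submodule ℝ (E x) :=
  Module.End.eigenspace (τ x : E x →ₗ[ℝ] E x) ε

/-- The projection `½ (1 + ε τ)` onto the eigenspaces of `τ` for the eigenvalue `ε = ±1`. -/
def eigenproj (τ : ∀ x : M, E x →L[ℝ] E x) (ε : ℝ) (x : M) : E x →L[ℝ] E x :=
  (1 / 2 : ℝ) • (ContinuousLinearMap.id ℝ (E x) + ε • τ x)

end Bundles

/-! ### Concentration of low eigensections -/

section Concentration

variable {n : ℕ} {M : Type*} [EMetricSpace M] [ChartedSpace (EuclideanSpace ℝ (Fin n)) M]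
  [IsManifold (𝓡 n) ∞ M] [MeasurableSpace M]
  [RiemannianBundle (fun x : M => TangentSpace (𝓡 n) x)]
  {FE : Type*} [NormedAddCommGroup FE] [NormedSpace ℝ FE]
  {FF : Type*} [NormedAddCommGroup FF] [NormedSpace ℝ FF]
  {E : M → Type*} [TopologicalSpace (TotalSpace FE E)]
  [∀ x, NormedAddCommGroup (E x)] [∀ x, InnerProductSpace ℝ (E x)]
  [FiberBundle FE E] [VectorBundle ℝ FE E]
  {F : M → Type*} [TopologicalSpace (TotalSpace FF F)]
  [∀ x, NormedAddCommGroup (F x)] [∀ x, InnerProductSpace ℝ (F x)]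
  [FiberBundle FF F] [VectorBundle ℝ FF F]

variable (n) in
/-- `P* η = ζ`, where `P*` is the formal `L²` adjoint of the operator `P` whose domain is the
space `Γ` of sections. -/
def FormalAdjointEq {E F : M → Type*}
    [∀ x, NormedAddCommGroup (E x)] [∀ x, InnerProductSpace ℝ (E x)]
    [∀ x, NormedAddCommGroup (F x)] [∀ x, InnerProductSpace ℝ (F x)]
    (Γ : Set (∀ x, E x)) (P : (∀ x, E x) → ∀ x, F x)
    (η : ∀ x, F x) (ζ : ∀ x, E x) : Prop :=
  ∀ θ ∈ Γ, ∫ x, ⟪P θ x, η x⟫_ℝ ∂(riemannianVolume n M) = ∫ x, ⟪θ x, ζ x⟫_ℝ ∂(riemannianVolume n M)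

variable (n) in
/-- The low eigensections of the family `P s` of operators on the space `Γ` of sections concentrate
along `Z`: for `δ > 0` and `C ≥ 0` there is a constant `C'` such that every `ξ ∈ Γ` with
`‖ξ‖₂ = 1` which satisfies `‖P_s ξ‖₂² ≤ C |s|`, or solves `P_s* P_s ξ = lam ξ` with
`|lam| ≤ C |s|`, satisfies `∫ |ξ|² < C' / |s|` over the complement of the `δ`-neighbourhood
of `Z`. -/
def ConcentratesAlong {E F : M → Type*}
    [∀ x, NormedAddCommGroup (E x)] [∀ x, InnerProductSpace ℝ (E x)]
    [∀ x, NormedAddCommGroup (F x)] [∀ x, InnerProductSpace ℝ (F x)]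
    (Γ : Set (∀ x, E x)) (P : ℝ → (∀ x, E x) → ∀ x, F x) (Z : Set M) : Prop :=
  ∀ δ : ℝ, 0 < δ → ∀ C : ℝ, 0 ≤ C → ∃ C' : ℝ, 0 < C' ∧
    ∀ s : ℝ, s ≠ 0 → ∀ ξ ∈ Γ, ∫ x, ‖ξ x‖ ^ 2 ∂(riemannianVolume n M) = 1 →
      (∫ x, ‖P s ξ x‖ ^ 2 ∂(riemannianVolume n M) ≤ C * |s| ∨
        ∃ lam : ℝ, |lam| ≤ C * |s| ∧
          FormalAdjointEq n Γ (P s) (P s ξ) (fun x => lam • ξ x)) →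
      ∫ x in (Metric.thickening δ Z)ᶜ, ‖ξ x‖ ^ 2 ∂(riemannianVolume n M) < C' / |s|

variable (FE FF) in
/-- Let `E' ⊆ E` and `F' ⊆ F` be subbundles, `D' : Γ(E') → Γ(F')` an operator,
`σ'(u)` a family of maps and `A'` a bundle map. The statement that `D'` is a first order operator
from `Γ(E')` to `Γ(F')` with symbol `σ'|_{E'} : T*M → Hom(E', F')`, that
`(σ'|_{E'}, A'|_{E'})` is a concentrating pair for `E'` and `F'`, and that the low eigensections of
`D' + s A' : Γ(E') → Γ(F')` concentrate along the singular set of `A'|_{E'} : E' → F'`. -/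
def IsConcentratingRestriction [∀ x, FiniteDimensional ℝ (E x)] [∀ x, FiniteDimensional ℝ (F x)]
    (E' : ∀ x, Submodule ℝ (E x)) (F' : ∀ x, Submodule ℝ (F x))
    (D' : (∀ x, E x) → ∀ x, F x)
    (σ' : ∀ x : M, Cotangent n x → (E x →L[ℝ] F x)) (A' : ∀ x : M, E x →L[ℝ] F x) : Prop :=
  ∃ (hσ : ∀ x u, ∀ e ∈ E' x, (σ' x u : E x →ₗ[ℝ] F x) e ∈ F' x)
    (hA : ∀ x, ∀ e ∈ E' x, (A' x : E x →ₗ[ℝ] F x) e ∈ F' x),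
    (∀ ξ ∈ sectionsIn n FE E', D' ξ ∈ sectionsIn n FF F') ∧
    (∀ ξ ∈ sectionsIn n FE E', ∀ f : M → ℝ, ContMDiff (𝓡 n) 𝓘(ℝ) ∞ f → ∀ x,
      D' (fun y => f y • ξ y) x = σ' x (mvfderiv (𝓡 n) f x) (ξ x) + f x • D' ξ x) ∧
    IsConcentratingPair (E := fun x => E' x) (F := fun x => F' x)
      (fun x u => (σ' x u : E x →ₗ[ℝ] F x).restrict (hσ x u))
      (fun x => (A' x : E x →ₗ[ℝ] F x).restrict (hA x)) ∧
    ConcentratesAlong n (sectionsIn n FE E') (fun s ξ x => D' ξ x + s • A' x (ξ x))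
      (singularSet (E := fun x => E' x) (F := fun x => F' x)
        (fun x => (A' x : E x →ₗ[ℝ] F x).restrict (hA x)))

end Concentration

/-! ### Spinor-form pairs at a point -/

section SpinorForm

/-- The complex exterior algebra `Λ*_ℂ ℝⁿ` with its Hermitian metric, in coordinates with respect to
the orthonormal basis `e_S = e_{j₁} ∧ ⋯ ∧ e_{j_p}`, `S = {j₁ < ⋯ < j_p}`. -/
abbrev Form (n : ℕ) : Type := EuclideanSpace ℂ (Finset (Fin n))

/-- The sign with `e_S ∧ e_R = shuffleSign S R • e_{S ∪ R}` for disjoint `S` and `R`. -/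
def shuffleSign {n : ℕ} (S R : Finset (Fin n)) : ℂ :=
  (-1) ^ ((S ×ˢ R).filter fun a => a.2 < a.1).card

/-- The exterior product `v ∧ α` of a vector and a form. -/
def extMul {n : ℕ} (v : EuclideanSpace ℝ (Fin n)) : Form n →ₗ[ℂ] Form n where
  toFun α := WithLp.toLp 2 fun S =>
    ∑ j ∈ S, shuffleSign {j} (S.erase j) * (v j : ℂ) * α (S.erase j)
  map_add' α β := by
    ext S
    simp [mul_add, Finset.sum_add_distrib]
  map_smul' a α := by
    ext S
    simp [Finset.mul_sum, mul_left_comm]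

/-- The interior product `ι_v α` of a vector and a form. -/
def intMul {n : ℕ} (v : EuclideanSpace ℝ (Fin n)) : Form n →ₗ[ℂ] Form n where
  toFun α := WithLp.toLp 2 fun S =>
    ∑ j ∈ Sᶜ, shuffleSign {j} S * (v j : ℂ) * α (insert j S)
  map_add' α β := by
    ext S
    simp [mul_add, Finset.sum_add_distrib]
  map_smul' a α := by
    ext S
    simp [Finset.mul_sum, mul_left_comm]

/-- The symbol `v ∧ · - ι_v` of `d + d*`. -/
def formClifford {n : ℕ} (v : EuclideanSpace ℝ (Fin n)) : Form n →ₗ[ℂ] Form n :=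
  extMul v - intMul v

/-- The operator `(-1)^{p+1}` on `p`-forms. -/
def formParity (n : ℕ) : Form n →ₗ[ℂ] Form n where
  toFun α := WithLp.toLp 2 fun S => (-1) ^ (S.card + 1) * α S
  map_add' α β := by
    ext S
    simp [mul_add]
  map_smul' a α := by
    ext S
    simp [mul_left_comm]

/-- The Hodge star operator, `⋆ e_R = shuffleSign R Rᶜ • e_{Rᶜ}`. -/
def hodgeStar (n : ℕ) : Form n →ₗ[ℂ] Form n where
  toFun α := WithLp.toLp 2 fun S => shuffleSign Sᶜ S * α Sᶜ
  map_add' α β := by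
    ext S
    simp [mul_add]
  map_smul' a α := by
    ext S
    simp [mul_left_comm]

/-- For `k = n / 2`: the operator which is the identity on `p`-forms with `p < k`, the
Hodge star on `k`-forms, and minus the identity on `p`-forms with `k < p`. -/
def formSelfDuality (n k : ℕ) : Form n →ₗ[ℂ] Form n where
  toFun α := WithLp.toLp 2 fun S =>
    if S.card < k then α S else if S.card = k then hodgeStar n α S else -α S
  map_add' α β := by
    ext S
    simp only [map_add, PiLp.add_apply]
    split_ifs <;> ring
  map_smul' a α := by
    ext S
    simp only [map_smul, PiLp.smul_apply, smul_eq_mul, RingHom.id_apply]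
    split_ifs <;> ring

/-- A Hermitian Clifford module structure on `W`: Clifford multiplication is complex linear and
satisfies `c(u)c(v) + c(v)c(u) = -2⟨u, v⟩`, and `c(v)* = -c(v)`. -/
structure CliffordAction (n : ℕ) (W : Type*) [NormedAddCommGroup W] [InnerProductSpace ℂ W] where
  c : EuclideanSpace ℝ (Fin n) →ₗ[ℝ] (W →ₗ[ℂ] W)
  clifford : ∀ u v φ, c u (c v φ) + c v (c u φ) = ((-2 * ⟪u, v⟫_ℝ : ℝ) : ℂ) • φ
  skew : ∀ v φ φ', ⟪c v φ, φ'⟫_ℂ = -⟪φ, c v φ'⟫_ℂ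

namespace CliffordAction

variable {n : ℕ} {W : Type*} [NormedAddCommGroup W] [InnerProductSpace ℂ W]

/-- `c(e_S) = c(e_{j₁}) ⋯ c(e_{j_p})` for `S = {j₁ < ⋯ < j_p}`. -/
def basisForm (κ : CliffordAction n W) (S : Finset (Fin n)) : W →ₗ[ℂ] W :=
  ((S.sort (· ≤ ·)).map fun j => (κ.c (EuclideanSpace.single j (1 : ℝ)) : Module.End ℂ W)).prod

/-- The map `P_ψ : Λ*_ℂ → W`, `α ↦ c(α) ψ`. -/
def formToSpinor (κ : CliffordAction n W) (ψ : W) : Form n →ₗ[ℂ] W where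
  toFun α := ∑ S, α S • κ.basisForm S ψ
  map_add' α β := by simp [add_smul, Finset.sum_add_distrib]
  map_smul' a α := by simp [mul_smul, Finset.smul_sum]

/-- The chirality operator `i^m c(dvol)`. -/
def chirality (κ : CliffordAction n W) (m : ℕ) : W →ₗ[ℂ] W :=
  Complex.I ^ m • κ.basisForm Finset.univ

/-- The symbol `c(v) ⊕ (v ∧ · - ι_v)` of `D_A ⊕ (d + d*)` on spinor-form pairs. -/
def pairSymbol (κ : CliffordAction n W) (v : EuclideanSpace ℝ (Fin n))
    (w : WithLp 2 (W × Form n)) : WithLp 2 (W × Form n) :=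
  WithLp.toLp 2 (κ.c v w.fst, formClifford v w.snd)

/-- The perturbation `A_ψ (φ, α) = (P_ψ α, -P_ψ* φ)`. -/
def pairPerturbation [FiniteDimensional ℂ W] (κ : CliffordAction n W) (ψ : W)
    (w : WithLp 2 (W × Form n)) : WithLp 2 (W × Form n) :=
  WithLp.toLp 2
    (κ.formToSpinor ψ w.snd, -(LinearMap.adjoint (κ.formToSpinor ψ) w.fst))

/-- The parity involution `i^m c(dvol) ⊕ (-1)^{p+1}`, in dimension `n = 2m`. -/
def pairParity (κ : CliffordAction n W) (m : ℕ)
    (w : WithLp 2 (W × Form n)) : WithLp 2 (W × Form n) :=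
  WithLp.toLp 2 (κ.chirality m w.fst, formParity n w.snd)

end CliffordAction

/-- The self-duality involution of spinor-form pairs, with `k = n / 2`. -/
def pairSelfDuality {n : ℕ} {W : Type*} [NormedAddCommGroup W] [InnerProductSpace ℂ W] (k : ℕ)
    (w : WithLp 2 (W × Form n)) : WithLp 2 (W × Form n) :=
  WithLp.toLp 2 (w.fst, formSelfDuality n k w.snd)

variable {n : ℕ} {M : Type*} [TopologicalSpace M] [ChartedSpace (EuclideanSpace ℝ (Fin n)) M]
  [RiemannianBundle (fun x : M => TangentSpace (𝓡 n) x)]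

/-- The coordinates `u(e_1), …, u(e_n)` of a covector with respect to an orthonormal frame. -/
def frameCoord {x : M} (b : TangentSpace (𝓡 n) x ≃ₗᵢ[ℝ] EuclideanSpace ℝ (Fin n))
    (u : Cotangent n x) : EuclideanSpace ℝ (Fin n) :=
  WithLp.toLp 2 fun i => u (b.symm (EuclideanSpace.single i (1 : ℝ)))

/-- Fibrewise isometric identifications of `E` and `F` with the spinor-form bundle `W ⊕ Λ*_ℂ T*M` of
a Hermitian bundle `W` of Clifford modules, under which `σ` becomes the symbol of
`D_A ⊕ (d + d*)` and `A` becomes `A_ψ`. The fibres of `Λ*_ℂ T*M` are written in orthonormal frames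
of the tangent spaces. -/
structure SpinorFormBundle (E F : M → Type*)
    [∀ x, NormedAddCommGroup (E x)] [∀ x, InnerProductSpace ℝ (E x)]
    [∀ x, NormedAddCommGroup (F x)] [∀ x, InnerProductSpace ℝ (F x)]
    (σ : ∀ x : M, Cotangent n x → (E x →L[ℝ] F x)) (A : ∀ x : M, E x →L[ℝ] F x)
    (W : M → Type*) [∀ x, NormedAddCommGroup (W x)] [∀ x, InnerProductSpace ℂ (W x)]
    [∀ x, FiniteDimensional ℂ (W x)] where
  frame : ∀ x : M, TangentSpace (𝓡 n) x ≃ₗᵢ[ℝ] EuclideanSpace ℝ (Fin n)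
  action : ∀ x, CliffordAction n (W x)
  spinor : ∀ x, W x
  isoE : ∀ x, E x ≃ₗᵢ[ℝ] WithLp 2 (W x × Form n)
  isoF : ∀ x, F x ≃ₗᵢ[ℝ] WithLp 2 (W x × Form n)
  symbol_eq : ∀ x (u : Cotangent n x) (e : E x),
    isoF x (σ x u e) = (action x).pairSymbol (frameCoord (frame x) u) (isoE x e)
  perturbation_eq : ∀ x (e : E x), isoF x (A x e) = (action x).pairPerturbation (spinor x) (isoE x e)

end SpinorForm

end

/-! The energy of `D_s = D + sA` expands as `‖D_s ξ‖² = ‖Dξ‖² + 2s ∫ ⟨Dξ, Aξ⟩ + s² ‖Aξ‖²`. For a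
concentrating pair `⟨σ(u) ξ, A η⟩` is symmetric in `ξ` and `η`, so that in terms of a generating
family of sections the first order part of `⟨Dξ, Aξ⟩` is a combination of the derivatives
`d(vₐ v_b)` of products of coefficients. Integration by parts leaves `|∫ ⟨Dξ, Aξ⟩| ≤ K ‖ξ‖²`. By
compactness `|Aξ|² ≥ κ |ξ|²` off the `δ`-neighbourhood of the singular set, whence
`s² κ ∫_{X \ Z(δ)} |ξ|² ≤ C |s| + 2 K |s|` for low eigensections of unit norm.

Only the symmetry of the pairing on the subbundle enters, so the reductions are pointwise algebra.
The projections onto eigenbundles are self-adjoint and can be dropped against sections of the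
eigenbundles. For the self-duality reduction, `σ(u)` maps the forms of odd degree below the middle
degree `k` into degrees at most `k`. There the self-duality involution is invisible to
`α ↦ c(α) ψ`, since `c(⋆α) ψ = c(α) ψ` on `k`-forms for a spinor `ψ` of positive chirality. -/

noncomputable section

/-! ### The Riemannian volume in charts -/

section LinearAlgebra

theorem gram_eq_conjTranspose_mul_gram_mul {𝕜 ι κ V : Type*} [RCLike 𝕜] [Fintype ι]
    [SeminormedAddCommGroup V] [InnerProductSpace 𝕜 V] {v : κ → V} {w : ι → V} {J : Matrix ι κ 𝕜}
    (h : ∀ i, v i = ∑ k, J k i • w k) :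
    Matrix.gram 𝕜 v = J.conjTranspose * Matrix.gram 𝕜 w * J := by
  ext i j
  simp only [Matrix.gram_apply, Matrix.mul_apply, Matrix.conjTranspose_apply, Finset.sum_mul]
  rw [h i, h j, sum_inner]
  simp only [inner_sum, inner_smul_left, inner_smul_right, starRingEnd_apply]
  rw [Finset.sum_comm]
  exact Finset.sum_congr rfl fun k _ => Finset.sum_congr rfl fun l _ => by ring

theorem map_eq_sum_smul_map_single {ι V : Type*} [Fintype ι] [DecidableEq ι] [AddCommGroup V]
    [Module ℝ V] (L : EuclideanSpace ℝ ι →ₗ[ℝ] V) (v : EuclideanSpace ℝ ι) :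
    L v = ∑ i, v i • L (EuclideanSpace.single i (1 : ℝ)) := by
  conv_lhs => rw [← (EuclideanSpace.basisFun ι ℝ).sum_repr v]
  simp

end LinearAlgebra

section CoordVectors

variable {n : ℕ} {M : Type*} [TopologicalSpace M] [ChartedSpace (EuclideanSpace ℝ (Fin n)) M]
  [IsManifold (𝓡 n) ∞ M] {x₀ x₁ p : M}

theorem coordVector_eq_tangentCoordChange (hp : p ∈ (extChartAt (𝓡 n) x₀).source) (i : Fin n) :
    coordVector (n := n) x₀ i p =
      tangentCoordChange (𝓡 n) x₀ p p (EuclideanSpace.single i (1 : ℝ)) := by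
  rw [extChartAt_source] at hp
  rw [coordVector, ← Trivialization.symmL_apply (R := ℝ) _ (by simpa using hp)]
  exact congrArg (fun L => L (EuclideanSpace.single i (1 : ℝ)))
    (TangentBundle.symmL_trivializationAt_eq_core (I := 𝓡 n) hp)

theorem coordVector_eq_sum (h₀ : p ∈ (extChartAt (𝓡 n) x₀).source)
    (h₁ : p ∈ (extChartAt (𝓡 n) x₁).source) (i : Fin n) :
    coordVector (n := n) x₀ i p = ∑ j, tangentCoordChange (𝓡 n) x₀ x₁ p
      (EuclideanSpace.single i (1 : ℝ)) j • coordVector (n := n) x₁ j p := by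
  have hp : p ∈ (extChartAt (𝓡 n) p).source := mem_extChartAt_source p
  rw [coordVector_eq_tangentCoordChange h₀, ← tangentCoordChange_comp ⟨⟨h₀, h₁⟩, hp⟩]
  simp only [coordVector_eq_tangentCoordChange h₁]
  exact map_eq_sum_smul_map_single (tangentCoordChange (𝓡 n) x₁ p p).toLinearMap _

theorem linearIndependent_coordVector (hp : p ∈ (extChartAt (𝓡 n) x₀).source) :
    LinearIndependent ℝ fun i => coordVector (n := n) x₀ i p := by
  let e := trivializationAt (EuclideanSpace ℝ (Fin n)) (fun x : M => TangentSpace (𝓡 n) x) x₀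
  have hpe : p ∈ e.baseSet := by simpa [e] using hp
  have hbasis : (fun i => coordVector (n := n) x₀ i p) =
      (EuclideanSpace.basisFun (Fin n) ℝ).toBasis.map (e.linearEquivAt ℝ p hpe).symm := by
    ext i
    simp [coordVector, e]
  rw [hbasis]
  exact Module.Basis.linearIndependent _

theorem contMDiffOn_coordVector (x₀ : M) (i : Fin n) :
    ContMDiffOn (𝓡 n) ((𝓡 n).prod 𝓘(ℝ, EuclideanSpace ℝ (Fin n))) ∞
      (fun p => TotalSpace.mk' (EuclideanSpace ℝ (Fin n)) p (coordVector (n := n) x₀ i p))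
      (extChartAt (𝓡 n) x₀).source := by
  let e := trivializationAt (EuclideanSpace ℝ (Fin n)) (fun x : M => TangentSpace (𝓡 n) x) x₀
  have he : e.baseSet = (extChartAt (𝓡 n) x₀).source := by simp [e]
  rw [← he]
  refine (e.contMDiffOn_localFrame_baseSet (I := 𝓡 n) ∞
    (EuclideanSpace.basisFun (Fin n) ℝ).toBasis i).congr fun p hp => ?_
  rw [e.localFrame_apply_of_mem_baseSet _ hp]
  simp [coordVector, e, Trivialization.basisAt]

end CoordVectors

section ChartDensity

variable {n : ℕ} {M : Type*} [TopologicalSpace M] [ChartedSpace (EuclideanSpace ℝ (Fin n)) M]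
  [IsManifold (𝓡 n) ∞ M] [RiemannianBundle (fun x : M => TangentSpace (𝓡 n) x)] {x₀ x₁ p : M}

/-- The density `√(det g_{ij})` of the Riemannian volume with respect to the Lebesgue measure of
the preferred chart at `x₀`. -/
def chartDensity (x₀ p : M) : ℝ := Real.sqrt (chartGram (n := n) x₀ p).det

theorem det_chartGram_pos (hp : p ∈ (extChartAt (𝓡 n) x₀).source) :
    0 < (chartGram (n := n) x₀ p).det := by
  -- The module structure of the tangent space and that of its inner product agree only after
  -- unfolding; passing through vanishing linear combinations keeps the unifier from doing this.
  have hli : LinearIndependent ℝ fun i => coordVector (n := n) x₀ i p :=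
    Fintype.linearIndependent_iff.2 (Fintype.linearIndependent_iff.1
      (linearIndependent_coordVector hp))
  exact (Matrix.posDef_gram_of_linearIndependent hli).det_pos

theorem chartDensity_pos (hp : p ∈ (extChartAt (𝓡 n) x₀).source) :
    0 < chartDensity (n := n) x₀ p :=
  Real.sqrt_pos.2 (det_chartGram_pos hp)

theorem chartDensity_eq_abs_det_mul (h₀ : p ∈ (extChartAt (𝓡 n) x₀).source)
    (h₁ : p ∈ (extChartAt (𝓡 n) x₁).source) :
    chartDensity (n := n) x₀ p =
      |(tangentCoordChange (𝓡 n) x₀ x₁ p).det| * chartDensity (n := n) x₁ p := by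
  let b := (EuclideanSpace.basisFun (Fin n) ℝ).toBasis
  let J := LinearMap.toMatrix b b (tangentCoordChange (𝓡 n) x₀ x₁ p).toLinearMap
  have hJ : J.det = (tangentCoordChange (𝓡 n) x₀ x₁ p).det := LinearMap.det_toMatrix ..
  have hgram : chartGram (n := n) x₀ p = J.conjTranspose * chartGram (n := n) x₁ p * J :=
    gram_eq_conjTranspose_mul_gram_mul fun i => by
      rw [coordVector_eq_sum h₀ h₁ i]
      simp [J, b, LinearMap.toMatrix_apply]
  have hdet : (chartGram (n := n) x₀ p).det = J.det ^ 2 * (chartGram (n := n) x₁ p).det := by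
    rw [hgram, Matrix.det_mul, Matrix.det_mul, Matrix.det_conjTranspose, star_trivial]
    ring
  rw [chartDensity, chartDensity, hdet, hJ, Real.sqrt_mul (sq_nonneg _), Real.sqrt_sq_eq_abs]

variable [IsContMDiffRiemannianBundle (𝓡 n) ∞ (EuclideanSpace ℝ (Fin n))
  (fun x : M => TangentSpace (𝓡 n) x)]

theorem contMDiffOn_det_chartGram (x₀ : M) :
    ContMDiffOn (𝓡 n) 𝓘(ℝ) ∞ (fun p => (chartGram (n := n) x₀ p).det)
      (extChartAt (𝓡 n) x₀).source := by
  simp only [Matrix.det_apply, Units.smul_def, zsmul_eq_mul]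
  exact contMDiffOn_finsetSum fun g _ => contMDiffOn_const.mul <| contMDiffOn_finsetProd fun i _ =>
    (contMDiffOn_coordVector x₀ (g i)).inner_bundle (contMDiffOn_coordVector x₀ i)

theorem contMDiffAt_chartDensity (hp : p ∈ (extChartAt (𝓡 n) x₀).source) :
    ContMDiffAt (𝓡 n) 𝓘(ℝ) ∞ (chartDensity (n := n) x₀) p :=
  ContMDiffAt.comp (g := Real.sqrt) p
    (Real.contDiffAt_sqrt (det_chartGram_pos hp).ne').contMDiffAt
    ((contMDiffOn_det_chartGram x₀).contMDiffAt ((isOpen_extChartAt_source x₀).mem_nhds hp))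

theorem continuousOn_chartDensity_comp_symm (x₀ : M) :
    ContinuousOn (fun y => chartDensity (n := n) x₀ ((extChartAt (𝓡 n) x₀).symm y))
      (extChartAt (𝓡 n) x₀).target := fun _ hy =>
  (contMDiffAt_chartDensity ((extChartAt (𝓡 n) x₀).map_target hy)).continuousAt
    |>.comp_continuousWithinAt (continuousOn_extChartAt_symm x₀ _ hy)

end ChartDensity

section VolumeMeasure

variable {n : ℕ} {M : Type*} [TopologicalSpace M] [ChartedSpace (EuclideanSpace ℝ (Fin n)) M]

theorem extChartAt_symm_preimage_inter_eq_image {x₀ x₁ : M} {B : Set M}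
    (h₀ : B ⊆ (extChartAt (𝓡 n) x₀).source) (h₁ : B ⊆ (extChartAt (𝓡 n) x₁).source) :
    (extChartAt (𝓡 n) x₁).symm ⁻¹' B ∩ (extChartAt (𝓡 n) x₁).target =
      (extChartAt (𝓡 n) x₁ ∘ (extChartAt (𝓡 n) x₀).symm) ''
        ((extChartAt (𝓡 n) x₀).symm ⁻¹' B ∩ (extChartAt (𝓡 n) x₀).target) := by
  rw [Set.image_comp, Set.inter_comm _ (extChartAt (𝓡 n) x₀).target,
    ← (extChartAt (𝓡 n) x₀).image_eq_target_inter_inv_preimage h₀,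
    (extChartAt (𝓡 n) x₀).symm_image_image_of_subset_source h₀,
    (extChartAt (𝓡 n) x₁).image_eq_target_inter_inv_preimage h₁, Set.inter_comm]

variable [MeasurableSpace M] [BorelSpace M]

theorem aemeasurable_extChartAt_symm (x₀ : M) :
    AEMeasurable (extChartAt (𝓡 n) x₀).symm (volume.restrict (extChartAt (𝓡 n) x₀).target) :=
  (continuousOn_extChartAt_symm x₀).aemeasurable (isOpen_extChartAt_target x₀).measurableSet

theorem measurableSet_extChartAt_symm_preimage_inter (x₀ : M) {B : Set M} (hB : MeasurableSet B) :
    MeasurableSet ((extChartAt (𝓡 n) x₀).symm ⁻¹' B ∩ (extChartAt (𝓡 n) x₀).target) := by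
  have hsymm := continuousOn_iff_continuous_domRestrict.1
    (continuousOn_extChartAt_symm (I := 𝓡 n) x₀)
  convert (isOpen_extChartAt_target (I := 𝓡 n) x₀).measurableSet.subtype_image
    (hsymm.measurable hB) using 1
  ext y
  simp [and_comm]

variable [IsManifold (𝓡 n) ∞ M] [RiemannianBundle (fun x : M => TangentSpace (𝓡 n) x)]

theorem chartVolume_apply (x₀ : M) {B : Set M} (hB : MeasurableSet B) :
    chartVolume (n := n) x₀ B =
      ∫⁻ y in (extChartAt (𝓡 n) x₀).symm ⁻¹' B ∩ (extChartAt (𝓡 n) x₀).target,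
        ENNReal.ofReal (chartDensity (n := n) x₀ ((extChartAt (𝓡 n) x₀).symm y)) := by
  rw [chartVolume, Measure.map_apply_of_aemeasurable _ hB, withDensity_apply',
    Measure.restrict_restrict' (isOpen_extChartAt_target x₀).measurableSet]
  · rfl
  · exact (aemeasurable_extChartAt_symm x₀).mono_ac (withDensity_absolutelyContinuous _ _)

theorem chartVolume_eq_of_subset {x₀ x₁ : M} {B : Set M} (hB : MeasurableSet B)
    (h₀ : B ⊆ (extChartAt (𝓡 n) x₀).source) (h₁ : B ⊆ (extChartAt (𝓡 n) x₁).source) :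
    chartVolume (n := n) x₀ B = chartVolume (n := n) x₁ B := by
  set φ₀ := extChartAt (𝓡 n) x₀
  set φ₁ := extChartAt (𝓡 n) x₁
  have hBm := measurableSet_extChartAt_symm_preimage_inter (n := n) x₀ hB
  have hderiv : ∀ y ∈ φ₀.symm ⁻¹' B ∩ φ₀.target, HasFDerivWithinAt (φ₁ ∘ φ₀.symm)
      (tangentCoordChange (𝓡 n) x₀ x₁ (φ₀.symm y)) (φ₀.symm ⁻¹' B ∩ φ₀.target) y := by
    intro y hy
    have h := hasFDerivWithinAt_tangentCoordChange (I := 𝓡 n) ⟨h₀ hy.1, h₁ hy.1⟩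
    rw [φ₀.right_inv hy.2] at h
    exact h.mono (by simp)
  have hinj : Set.InjOn (φ₁ ∘ φ₀.symm) (φ₀.symm ⁻¹' B ∩ φ₀.target) :=
    (φ₁.injOn.mono h₁).comp (φ₀.symm.injOn.mono Set.inter_subset_right) fun _ hy => hy.1
  rw [chartVolume_apply x₀ hB, chartVolume_apply x₁ hB,
    extChartAt_symm_preimage_inter_eq_image h₀ h₁,
    lintegral_image_eq_lintegral_abs_det_fderiv_mul _ hBm hderiv hinj]
  refine setLIntegral_congr_fun hBm fun y hy => ?_
  rw [chartDensity_eq_abs_det_mul (h₀ hy.1) (h₁ hy.1), ENNReal.ofReal_mul (abs_nonneg _),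
    Function.comp_apply, φ₁.left_inv (h₁ hy.1)]

theorem chartVolume_compl_source (x₀ : M) :
    chartVolume (n := n) x₀ (extChartAt (𝓡 n) x₀).sourceᶜ = 0 := by
  have hempty : (extChartAt (𝓡 n) x₀).symm ⁻¹' (extChartAt (𝓡 n) x₀).sourceᶜ ∩
      (extChartAt (𝓡 n) x₀).target = ∅ :=
    Set.eq_empty_of_forall_notMem fun _ hy => hy.1 ((extChartAt (𝓡 n) x₀).map_target hy.2)
  rw [chartVolume_apply x₀ (isOpen_extChartAt_source x₀).measurableSet.compl, hempty,
    Measure.restrict_empty, lintegral_zero_measure]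

theorem chartVolume_restrict_source (x₀ : M) :
    (chartVolume (n := n) x₀).restrict (extChartAt (𝓡 n) x₀).source = chartVolume (n := n) x₀ :=
  Measure.restrict_eq_self_of_ae_mem (ae_iff.2 (chartVolume_compl_source x₀))

theorem chartVolume_restrict_source_le (x₀ x₁ : M) :
    (chartVolume (n := n) x₁).restrict (extChartAt (𝓡 n) x₀).source ≤
      chartVolume (n := n) x₀ := by
  have hS : MeasurableSet (extChartAt (𝓡 n) x₀).source :=
    (isOpen_extChartAt_source x₀).measurableSet
  have hT : MeasurableSet (extChartAt (𝓡 n) x₁).source :=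
    (isOpen_extChartAt_source x₁).measurableSet
  refine Measure.le_intro fun B hB _ => ?_
  rw [Measure.restrict_apply hB, ← chartVolume_restrict_source x₁,
    Measure.restrict_apply (hB.inter hS),
    ← chartVolume_eq_of_subset ((hB.inter hS).inter hT) (fun _ hy => hy.1.2) fun _ hy => hy.2]
  exact measure_mono fun _ hy => hy.1.1

theorem riemannianVolume_restrict_source (x₀ : M) :
    (riemannianVolume n M).restrict (extChartAt (𝓡 n) x₀).source = chartVolume (n := n) x₀ := by
  set S := (extChartAt (𝓡 n) x₀).source
  have hS : MeasurableSet S := (isOpen_extChartAt_source x₀).measurableSet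
  refine le_antisymm ?_ ?_
  · have hle : riemannianVolume n M ≤ chartVolume (n := n) x₀ + (⊤ : Measure M).restrict Sᶜ := by
      refine iSup_le fun x₁ => ?_
      rw [← Measure.restrict_add_restrict_compl (μ := chartVolume (n := n) x₁) hS]
      exact add_le_add (chartVolume_restrict_source_le x₀ x₁) (Measure.restrict_mono le_rfl le_top)
    refine (Measure.restrict_mono le_rfl hle).trans ?_
    rw [Measure.restrict_add, Measure.restrict_restrict hS, Set.inter_compl_self,
      Measure.restrict_empty, add_zero, chartVolume_restrict_source]
  · rw [← chartVolume_restrict_source x₀]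
    exact Measure.restrict_mono le_rfl (le_iSup (fun x => chartVolume (n := n) x) x₀)

variable [IsContMDiffRiemannianBundle (𝓡 n) ∞ (EuclideanSpace ℝ (Fin n))
  (fun x : M => TangentSpace (𝓡 n) x)]

theorem isLocallyFiniteMeasure_riemannianVolume :
    IsLocallyFiniteMeasure (riemannianVolume n M) := by
  refine ⟨fun x₀ => ?_⟩
  set φ := extChartAt (𝓡 n) x₀
  obtain ⟨r, hr, hrt⟩ := Metric.nhds_basis_closedBall.mem_iff.1
    ((isOpen_extChartAt_target (I := 𝓡 n) x₀).mem_nhds (mem_extChartAt_target x₀))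
  set N := φ.source ∩ φ ⁻¹' Metric.ball (φ x₀) r
  have hN : IsOpen N := (continuousOn_extChartAt (I := 𝓡 n) x₀).isOpen_inter_preimage
    (isOpen_extChartAt_source x₀) Metric.isOpen_ball
  have hvol : riemannianVolume n M N = chartVolume (n := n) x₀ N := by
    rw [← riemannianVolume_restrict_source, Measure.restrict_apply hN.measurableSet,
      Set.inter_eq_left.2 Set.inter_subset_left]
  have hsub : φ.symm ⁻¹' N ∩ φ.target ⊆ Metric.closedBall (φ x₀) r := fun y hy => by
    simpa [φ.right_inv hy.2] using Metric.ball_subset_closedBall hy.1.2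
  have hintegrable : IntegrableOn (fun y => chartDensity (n := n) x₀ (φ.symm y))
      (Metric.closedBall (φ x₀) r) volume :=
    ((continuousOn_chartDensity_comp_symm x₀).mono hrt).integrableOn_compact
      (isCompact_closedBall _ _)
  refine ⟨N, hN.mem_nhds ⟨mem_extChartAt_source x₀, Metric.mem_ball_self hr⟩, ?_⟩
  rw [hvol, chartVolume_apply x₀ hN.measurableSet]
  exact (lintegral_mono_set hsub).trans_lt hintegrable.lintegral_lt_top

theorem isFiniteMeasure_riemannianVolume [CompactSpace M] :
    IsFiniteMeasure (riemannianVolume n M) := by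
  have := isLocallyFiniteMeasure_riemannianVolume (n := n) (M := M)
  infer_instance

theorem integrable_riemannianVolume [CompactSpace M] {f : M → ℝ}
    (hf : Continuous f) : Integrable f (riemannianVolume n M) := by
  have := isFiniteMeasure_riemannianVolume (n := n) (M := M)
  exact hf.integrable_of_hasCompactSupport (HasCompactSupport.of_compactSpace f)

end VolumeMeasure

/-! ### Integration by parts -/

section PartitionOfUnity

variable {n : ℕ} {M : Type*} [TopologicalSpace M] [CompactSpace M] [T2Space M]
  [ChartedSpace (EuclideanSpace ℝ (Fin n)) M] [IsManifold (𝓡 n) ∞ M]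

theorem exists_finset_contMDiff_sum_sq_eq_one (U : M → Set M) (hU : ∀ x, U x ∈ nhds x) :
    ∃ (t : Finset M) (χ : M → M → ℝ), (∀ x, ContMDiff (𝓡 n) 𝓘(ℝ) ∞ (χ x)) ∧
      (∀ x, tsupport (χ x) ⊆ U x) ∧ ∀ y, ∑ x ∈ t, χ x y ^ 2 = 1 := by
  choose f _ hf using fun x =>
    (SmoothBumpFunction.nhds_basis_tsupport (I := 𝓡 n) x).mem_iff.1 (hU x)
  obtain ⟨t, -, ht⟩ := isCompact_univ.elim_nhds_subcover (fun x => Function.support (f x))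
    fun x _ => (f x).support_mem_nhds
  have hpos : ∀ y, 0 < ∑ x ∈ t, f x y ^ 2 := fun y => by
    obtain ⟨x, hx, hy⟩ := Set.mem_iUnion₂.1 (ht (Set.mem_univ y))
    exact Finset.sum_pos' (fun _ _ => sq_nonneg _) ⟨x, hx, pow_pos ((f x).nonneg.lt_of_ne' hy) 2⟩
  have hsum : ContMDiff (𝓡 n) 𝓘(ℝ) ∞ fun y => ∑ x ∈ t, f x y ^ 2 :=
    contMDiff_finsetSum fun x _ => (f x).contMDiff.pow 2
  have hnorm : ContMDiff (𝓡 n) 𝓘(ℝ) ∞ fun y => (Real.sqrt (∑ x ∈ t, f x y ^ 2))⁻¹ := fun y =>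
    ContMDiffAt.comp (g := fun r => (Real.sqrt r)⁻¹) y
      ((Real.contDiffAt_sqrt (hpos y).ne').inv (Real.sqrt_pos.2 (hpos y)).ne').contMDiffAt (hsum y)
  refine ⟨t, fun x y => (Real.sqrt (∑ x ∈ t, f x y ^ 2))⁻¹ * f x y,
    fun x => hnorm.mul (f x).contMDiff, fun x => tsupport_mul_subset_right.trans (hf x),
    fun y => ?_⟩
  simp only [mul_pow, inv_pow, Real.sq_sqrt (hpos y).le]
  rw [← Finset.mul_sum, inv_mul_cancel₀ (hpos y).ne']

end PartitionOfUnity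

section IntegrationByParts

theorem continuous_mul_of_tsupport_subset {X : Type*} [TopologicalSpace X] {U : Set X}
    (hU : IsOpen U) {a b : X → ℝ} (ha : Continuous a) (hs : tsupport a ⊆ U)
    (hb : ContinuousOn b U) : Continuous fun x => a x * b x :=
  (ha.continuousOn.mul hb).continuous_of_tsupport_subset hU (tsupport_mul_subset_left.trans hs)

theorem integral_mul_fderiv_eq_neg_of_tsupport_subset {V : Type*} [NormedAddCommGroup V]
    [NormedSpace ℝ V] [FiniteDimensional ℝ V] [MeasurableSpace V] [BorelSpace V] {μ : Measure V}
    [μ.IsAddHaarMeasure] {U : Set V} (hU : IsOpen U) {w f : V → ℝ} (hw : ContDiff ℝ 1 w)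
    (hc : HasCompactSupport w) (hs : tsupport w ⊆ U) (hf : ContDiffOn ℝ 1 f U) (v : V) :
    ∫ y, w y * fderiv ℝ f y v ∂μ = -∫ y, fderiv ℝ w y v * f y ∂μ := by
  have hintegrable : ∀ {a b : V → ℝ}, Continuous a → tsupport a ⊆ tsupport w →
      ContinuousOn b U → Integrable (fun y => a y * b y) μ := fun ha has hb =>
    (continuous_mul_of_tsupport_subset hU ha (has.trans hs) hb).integrable_of_hasCompactSupport
      (HasCompactSupport.mul_right (hc.of_isClosed_subset (isClosed_tsupport _) has))
  have hw' : Continuous fun y => fderiv ℝ w y v :=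
    (hw.continuous_fderiv one_ne_zero).clm_apply continuous_const
  have hf' : ContinuousOn (fun y => fderiv ℝ f y v) U :=
    (hf.continuousOn_fderiv_of_isOpen hU le_rfl).clm_apply continuousOn_const
  refine integral_mul_fderiv_eq_neg_fderiv_mul_of_integrable
    (hintegrable hw' (tsupport_fderiv_apply_subset ℝ v) hf.continuousOn)
    (hintegrable hw.continuous subset_rfl hf')
    (hintegrable hw.continuous subset_rfl hf.continuousOn)
    (fun y _ => hw.differentiable one_ne_zero y) fun y hy => ?_
  exact (hf.contDiffAt (hU.mem_nhds (hs hy))).differentiableAt one_ne_zero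

end IntegrationByParts

section ChartDerivative

variable {n : ℕ} {M : Type*} [TopologicalSpace M] [ChartedSpace (EuclideanSpace ℝ (Fin n)) M]
  {x₀ p : M} {f : M → ℝ}

/-- The partial derivative `∂_i f` in the preferred chart at `x₀`. -/
def chartDeriv (x₀ : M) (i : Fin n) (f : M → ℝ) (p : M) : ℝ :=
  fderiv ℝ (f ∘ (extChartAt (𝓡 n) x₀).symm) (extChartAt (𝓡 n) x₀ p)
    (EuclideanSpace.single i (1 : ℝ))

/-- The function `f` in the preferred chart at `x₀`, extended by zero. -/
def chartExtend (x₀ : M) (f : M → ℝ) : EuclideanSpace ℝ (Fin n) → ℝ :=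
  (extChartAt (𝓡 n) x₀).target.indicator (f ∘ (extChartAt (𝓡 n) x₀).symm)

theorem chartExtend_of_mem (f : M → ℝ) {y : EuclideanSpace ℝ (Fin n)}
    (hy : y ∈ (extChartAt (𝓡 n) x₀).target) :
    chartExtend x₀ f y = f ((extChartAt (𝓡 n) x₀).symm y) :=
  Set.indicator_of_mem hy _

theorem chartExtend_of_notMem (f : M → ℝ) {y : EuclideanSpace ℝ (Fin n)}
    (hy : y ∉ (extChartAt (𝓡 n) x₀).target) : chartExtend x₀ f y = 0 :=
  Set.indicator_of_notMem hy _

theorem chartExtend_eventuallyEq (f : M → ℝ) {y : EuclideanSpace ℝ (Fin n)}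
    (hy : y ∈ (extChartAt (𝓡 n) x₀).target) :
    chartExtend x₀ f =ᶠ[nhds y] f ∘ (extChartAt (𝓡 n) x₀).symm :=
  Filter.eventuallyEq_of_mem ((isOpen_extChartAt_target x₀).mem_nhds hy)
    fun _ hz => chartExtend_of_mem f hz

theorem chartDeriv_extChartAt_symm (i : Fin n) (f : M → ℝ) {y : EuclideanSpace ℝ (Fin n)}
    (hy : y ∈ (extChartAt (𝓡 n) x₀).target) :
    chartDeriv x₀ i f ((extChartAt (𝓡 n) x₀).symm y) =
      fderiv ℝ (f ∘ (extChartAt (𝓡 n) x₀).symm) y (EuclideanSpace.single i (1 : ℝ)) := by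
  rw [chartDeriv, (extChartAt (𝓡 n) x₀).right_inv hy]

theorem chartDeriv_of_notMem_tsupport (i : Fin n) (hp : p ∈ (extChartAt (𝓡 n) x₀).source)
    (hf : p ∉ tsupport f) : chartDeriv x₀ i f p = 0 := by
  have hsymm : Filter.Tendsto (extChartAt (𝓡 n) x₀).symm (nhds (extChartAt (𝓡 n) x₀ p))
      (nhds p) := by
    simpa only [ContinuousAt, (extChartAt (𝓡 n) x₀).left_inv hp] using
      continuousAt_extChartAt_symm' (I := 𝓡 n) hp
  have hzero : f ∘ (extChartAt (𝓡 n) x₀).symm =ᶠ[nhds (extChartAt (𝓡 n) x₀ p)] fun _ => 0 :=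
    hsymm.eventually (notMem_tsupport_iff_eventuallyEq.1 hf)
  rw [chartDeriv, hzero.fderiv_eq, fderiv_fun_const]
  rfl

theorem tsupport_chartExtend_subset [CompactSpace M]
    (hs : tsupport f ⊆ (extChartAt (𝓡 n) x₀).source) :
    tsupport (chartExtend x₀ f) ⊆ extChartAt (𝓡 n) x₀ '' tsupport f := by
  refine closure_minimal (fun y hy => ?_) ((isClosed_tsupport f).isCompact.image_of_continuousOn
    ((continuousOn_extChartAt x₀).mono hs)).isClosed
  by_cases hyt : y ∈ (extChartAt (𝓡 n) x₀).target
  · rw [Function.mem_support, chartExtend_of_mem f hyt] at hy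
    exact ⟨_, subset_tsupport f hy, (extChartAt (𝓡 n) x₀).right_inv hyt⟩
  · exact absurd (chartExtend_of_notMem f hyt) hy

theorem tsupport_chartExtend_subset_target [CompactSpace M]
    (hs : tsupport f ⊆ (extChartAt (𝓡 n) x₀).source) :
    tsupport (chartExtend x₀ f) ⊆ (extChartAt (𝓡 n) x₀).target :=
  (tsupport_chartExtend_subset hs).trans
    (Set.image_subset_iff.2 fun _ hp => (extChartAt (𝓡 n) x₀).map_source (hs hp))

theorem hasCompactSupport_chartExtend [CompactSpace M]
    (hs : tsupport f ⊆ (extChartAt (𝓡 n) x₀).source) :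
    HasCompactSupport (chartExtend (n := n) x₀ f) :=
  ((isClosed_tsupport f).isCompact.image_of_continuousOn
    ((continuousOn_extChartAt x₀).mono hs)).of_isClosed_subset (isClosed_tsupport _)
      (tsupport_chartExtend_subset hs)

variable [IsManifold (𝓡 n) ∞ M]

theorem contDiffOn_comp_extChartAt_symm
    (hf : ContMDiffOn (𝓡 n) 𝓘(ℝ) ∞ f (extChartAt (𝓡 n) x₀).source) :
    ContDiffOn ℝ ∞ (f ∘ (extChartAt (𝓡 n) x₀).symm) (extChartAt (𝓡 n) x₀).target :=
  contMDiffOn_iff_contDiffOn.1 <|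
    hf.comp (contMDiffOn_extChartAt_symm x₀) fun _ hy => (extChartAt (𝓡 n) x₀).map_target hy

theorem contDiff_chartExtend [CompactSpace M] (hf : ContMDiff (𝓡 n) 𝓘(ℝ) ∞ f)
    (hs : tsupport f ⊆ (extChartAt (𝓡 n) x₀).source) :
    ContDiff ℝ ∞ (chartExtend (n := n) x₀ f) := by
  refine (contMDiff_of_tsupport fun y hy => ?_).contDiff
  have hyt := tsupport_chartExtend_subset_target hs hy
  exact (((contDiffOn_comp_extChartAt_symm hf.contMDiffOn).contDiffAt
    ((isOpen_extChartAt_target x₀).mem_nhds hyt)).congr_of_eventuallyEq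
      (chartExtend_eventuallyEq f hyt)).contMDiffAt

theorem continuousOn_chartDeriv (i : Fin n)
    (hf : ContMDiffOn (𝓡 n) 𝓘(ℝ) ∞ f (extChartAt (𝓡 n) x₀).source) :
    ContinuousOn (chartDeriv x₀ i f) (extChartAt (𝓡 n) x₀).source :=
  (((contDiffOn_comp_extChartAt_symm hf).continuousOn_fderiv_of_isOpen
    (isOpen_extChartAt_target x₀) (by simp)).comp (continuousOn_extChartAt x₀)
      fun _ hp => (extChartAt (𝓡 n) x₀).map_source hp).clm_apply continuousOn_const

theorem continuous_mul_chartDeriv (i : Fin n) {h : M → ℝ} (hh : Continuous h)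
    (hs : tsupport h ⊆ (extChartAt (𝓡 n) x₀).source) (hf : ContMDiff (𝓡 n) 𝓘(ℝ) ∞ f) :
    Continuous fun p => h p * chartDeriv x₀ i f p :=
  continuous_mul_of_tsupport_subset (isOpen_extChartAt_source x₀) hh hs
    (continuousOn_chartDeriv i hf.contMDiffOn)

end ChartDerivative

section ChartDivergence

variable {n : ℕ} {M : Type*} [TopologicalSpace M] [ChartedSpace (EuclideanSpace ℝ (Fin n)) M]
  [IsManifold (𝓡 n) ∞ M] [RiemannianBundle (fun x : M => TangentSpace (𝓡 n) x)]
  {x₀ p : M} {f h : M → ℝ}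

/-- The divergence of the vector field `h ∂_i` supported in the domain of the preferred chart at
`x₀`, which is `ρ⁻¹ ∂_i (h ρ)` for the Riemannian density `ρ` of that chart. -/
def chartDivergence (x₀ : M) (i : Fin n) (h : M → ℝ) : M → ℝ :=
  (extChartAt (𝓡 n) x₀).source.indicator fun p =>
    chartDeriv x₀ i (fun q => h q * chartDensity (n := n) x₀ q) p / chartDensity (n := n) x₀ p

theorem chartDivergence_mul_chartDensity (i : Fin n) (h : M → ℝ)
    (hp : p ∈ (extChartAt (𝓡 n) x₀).source) :
    chartDivergence x₀ i h p * chartDensity (n := n) x₀ p =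
      chartDeriv x₀ i (fun q => h q * chartDensity (n := n) x₀ q) p := by
  rw [chartDivergence, Set.indicator_of_mem hp, div_mul_cancel₀ _ (chartDensity_pos hp).ne']

theorem tsupport_chartDivergence_subset (x₀ : M) (i : Fin n) (h : M → ℝ) :
    tsupport (chartDivergence x₀ i h) ⊆ tsupport h := by
  refine closure_minimal (fun p hp => ?_) (isClosed_tsupport h)
  contrapose! hp
  rw [Function.notMem_support, chartDivergence]
  refine Set.indicator_apply_eq_zero.2 fun hps => ?_
  rw [chartDeriv_of_notMem_tsupport i hps fun hp' => hp (tsupport_mul_subset_left hp'), zero_div]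

variable [IsContMDiffRiemannianBundle (𝓡 n) ∞ (EuclideanSpace ℝ (Fin n))
  (fun x : M => TangentSpace (𝓡 n) x)]

theorem contMDiff_mul_chartDensity (hh : ContMDiff (𝓡 n) 𝓘(ℝ) ∞ h)
    (hs : tsupport h ⊆ (extChartAt (𝓡 n) x₀).source) :
    ContMDiff (𝓡 n) 𝓘(ℝ) ∞ fun q => h q * chartDensity (n := n) x₀ q :=
  contMDiff_of_tsupport fun p hp =>
    (hh p).mul (contMDiffAt_chartDensity (hs (tsupport_mul_subset_left hp)))

theorem continuous_chartDivergence (i : Fin n) (hh : ContMDiff (𝓡 n) 𝓘(ℝ) ∞ h)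
    (hs : tsupport h ⊆ (extChartAt (𝓡 n) x₀).source) : Continuous (chartDivergence x₀ i h) := by
  refine ContinuousOn.continuous_of_tsupport_subset (s := (extChartAt (𝓡 n) x₀).source) ?_
    (isOpen_extChartAt_source (I := 𝓡 n) x₀) ((tsupport_chartDivergence_subset x₀ i h).trans hs)
  exact ((continuousOn_chartDeriv i (contMDiff_mul_chartDensity hh hs).contMDiffOn).div
    (fun p hp => (contMDiffAt_chartDensity (n := n) hp).continuousAt.continuousWithinAt)
    fun p hp => (chartDensity_pos (n := n) hp).ne').congr fun p hp => Set.indicator_of_mem hp _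

variable [MeasurableSpace M] [BorelSpace M]

theorem integral_riemannianVolume_eq_integral_chartExtend (hf : Continuous f)
    (hf₀ : ∀ p ∉ (extChartAt (𝓡 n) x₀).source, f p = 0) :
    ∫ p, f p ∂(riemannianVolume n M) =
      ∫ y, chartExtend (n := n) x₀ (fun p => f p * chartDensity (n := n) x₀ p) y := by
  have ht := (isOpen_extChartAt_target (I := 𝓡 n) x₀).measurableSet
  have hρ : AEMeasurable (fun y => ENNReal.ofReal (chartDensity (n := n) x₀
      ((extChartAt (𝓡 n) x₀).symm y))) (volume.restrict (extChartAt (𝓡 n) x₀).target) :=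
    ((continuousOn_chartDensity_comp_symm x₀).aemeasurable ht).ennreal_ofReal
  rw [← setIntegral_eq_integral_of_forall_compl_eq_zero hf₀, riemannianVolume_restrict_source,
    chartVolume, integral_map ((aemeasurable_extChartAt_symm x₀).mono_ac
      (withDensity_absolutelyContinuous _ _)) hf.aestronglyMeasurable]
  refine (integral_withDensity_eq_integral_toReal_smul₀ hρ (by simp) _).trans ?_
  simp only [chartExtend, integral_indicator ht]
  refine integral_congr_ae (ae_of_all _ fun y => ?_)
  simp only [smul_eq_mul, Function.comp_apply, mul_comm (f _)]
  exact congrArg (· * _) (ENNReal.toReal_ofReal (Real.sqrt_nonneg _))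

theorem integral_mul_chartDeriv [CompactSpace M] (i : Fin n)
    (hh : ContMDiff (𝓡 n) 𝓘(ℝ) ∞ h) (hs : tsupport h ⊆ (extChartAt (𝓡 n) x₀).source)
    (hf : ContMDiff (𝓡 n) 𝓘(ℝ) ∞ f) :
    ∫ p, h p * chartDeriv x₀ i f p ∂(riemannianVolume n M) =
      -∫ p, chartDivergence x₀ i h p * f p ∂(riemannianVolume n M) := by
  set φ := extChartAt (𝓡 n) x₀
  set w : M → ℝ := fun q => h q * chartDensity (n := n) x₀ q
  have hw : ContMDiff (𝓡 n) 𝓘(ℝ) ∞ w := contMDiff_mul_chartDensity hh hs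
  have hws : tsupport w ⊆ φ.source := tsupport_mul_subset_left.trans hs
  have hdiv := tsupport_chartDivergence_subset x₀ i h
  have hleft (y) : chartExtend x₀
      (fun p => h p * chartDeriv x₀ i f p * chartDensity (n := n) x₀ p) y =
      chartExtend x₀ w y * fderiv ℝ (f ∘ φ.symm) y (EuclideanSpace.single i (1 : ℝ)) := by
    by_cases hy : y ∈ φ.target
    · rw [chartExtend_of_mem _ hy, chartExtend_of_mem _ hy, chartDeriv_extChartAt_symm i f hy]
      ring
    · rw [chartExtend_of_notMem _ hy, chartExtend_of_notMem _ hy, zero_mul]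
  have hright (y) : chartExtend x₀
      (fun p => chartDivergence x₀ i h p * f p * chartDensity (n := n) x₀ p) y =
      fderiv ℝ (chartExtend x₀ w) y (EuclideanSpace.single i (1 : ℝ)) * (f ∘ φ.symm) y := by
    by_cases hy : y ∈ φ.target
    · rw [chartExtend_of_mem _ hy, (chartExtend_eventuallyEq w hy).fderiv_eq,
        ← chartDeriv_extChartAt_symm i w hy, mul_right_comm,
        chartDivergence_mul_chartDensity i h (φ.map_target hy), Function.comp_apply]
    · have hzero : fderiv ℝ (chartExtend x₀ w) y = 0 := image_eq_zero_of_notMem_tsupport fun hy' =>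
        hy (tsupport_chartExtend_subset_target hws (tsupport_fderiv_subset ℝ hy'))
      rw [chartExtend_of_notMem _ hy, hzero, zero_apply, zero_mul]
  rw [integral_riemannianVolume_eq_integral_chartExtend (x₀ := x₀)
      (continuous_mul_chartDeriv i hh.continuous hs hf) fun p hp => by
        rw [image_eq_zero_of_notMem_tsupport fun hp' => hp (hs hp'), zero_mul],
    integral_riemannianVolume_eq_integral_chartExtend (x₀ := x₀)
      (f := fun p => chartDivergence x₀ i h p * f p)
      ((continuous_chartDivergence i hh hs).mul hf.continuous) fun p hp => by
        rw [image_eq_zero_of_notMem_tsupport fun hp' => hp (hs (hdiv hp')), zero_mul]]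
  simp only [hleft, hright]
  exact integral_mul_fderiv_eq_neg_of_tsupport_subset (isOpen_extChartAt_target x₀)
    ((contDiff_chartExtend hw hws).of_le (by simp)) (hasCompactSupport_chartExtend hws)
    (tsupport_chartExtend_subset_target hws)
    ((contDiffOn_comp_extChartAt_symm hf.contMDiffOn).of_le (by simp)) _

end ChartDivergence

section Divergence

variable {n : ℕ} {M : Type*} [TopologicalSpace M] [ChartedSpace (EuclideanSpace ℝ (Fin n)) M]
  [IsManifold (𝓡 n) ∞ M] {x₀ p : M} {f : M → ℝ}

/-- The `i`-th coordinate function of the preferred chart at `x₀`. -/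
def chartCoord (x₀ : M) (i : Fin n) (p : M) : ℝ := extChartAt (𝓡 n) x₀ p i

theorem contMDiffAt_chartCoord (i : Fin n) (hp : p ∈ (extChartAt (𝓡 n) x₀).source) :
    ContMDiffAt (𝓡 n) 𝓘(ℝ) ∞ (chartCoord x₀ i) p :=
  (EuclideanSpace.proj i : EuclideanSpace ℝ (Fin n) →L[ℝ] ℝ).contMDiff.contMDiffAt.comp p
    (contMDiffAt_extChartAt' (by simpa only [extChartAt_source] using hp))

theorem mvfderiv_comp_extChartAt_apply {G : EuclideanSpace ℝ (Fin n) → ℝ}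
    (hp : p ∈ (extChartAt (𝓡 n) x₀).source) (hG : DifferentiableAt ℝ G (extChartAt (𝓡 n) x₀ p))
    (v : TangentSpace (𝓡 n) p) :
    mvfderiv (𝓡 n) (G ∘ extChartAt (𝓡 n) x₀) p v = fderiv ℝ G (extChartAt (𝓡 n) x₀ p)
      (mfderiv (𝓡 n) 𝓘(ℝ, EuclideanSpace ℝ (Fin n)) (extChartAt (𝓡 n) x₀) p v) := by
  have hφ : MDifferentiableAt (𝓡 n) 𝓘(ℝ, EuclideanSpace ℝ (Fin n)) (extChartAt (𝓡 n) x₀) p :=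
    (contMDiffAt_extChartAt' (I := 𝓡 n) (n := ∞)
      (by simpa only [extChartAt_source] using hp)).mdifferentiableAt (by simp)
  rw [mvfderiv_comp_apply p hG.mdifferentiableAt hφ]
  simp only [mvfderiv, mfderiv_eq_fderiv]
  rfl

theorem mvfderiv_eq_sum_chartDeriv (hp : p ∈ (extChartAt (𝓡 n) x₀).source)
    (hf : ContMDiff (𝓡 n) 𝓘(ℝ) ∞ f) :
    mvfderiv (𝓡 n) f p =
      ∑ i, chartDeriv x₀ i f p • mvfderiv (𝓡 n) (chartCoord (n := n) x₀ i) p := by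
  set φ := extChartAt (𝓡 n) x₀
  have hF : DifferentiableAt ℝ (f ∘ φ.symm) (φ p) :=
    ((contDiffOn_comp_extChartAt_symm hf.contMDiffOn).contDiffAt
      ((isOpen_extChartAt_target x₀).mem_nhds (φ.map_source hp))).differentiableAt (by simp)
  have hfφ : f =ᶠ[nhds p] (f ∘ φ.symm) ∘ φ :=
    Filter.eventuallyEq_of_mem ((isOpen_extChartAt_source x₀).mem_nhds hp)
      fun q hq => congrArg f (φ.left_inv hq).symm
  have hdf : mvfderiv (𝓡 n) f p = mvfderiv (𝓡 n) ((f ∘ φ.symm) ∘ φ) p := by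
    simp only [mvfderiv, hfφ.mfderiv_eq]
    rfl
  ext v
  set w : EuclideanSpace ℝ (Fin n) := mfderiv (𝓡 n) 𝓘(ℝ, EuclideanSpace ℝ (Fin n)) φ p v
  have hcoord (i) : mvfderiv (𝓡 n) (chartCoord (n := n) x₀ i) p v = w i := by
    let proj : EuclideanSpace ℝ (Fin n) →L[ℝ] ℝ := EuclideanSpace.proj i
    rw [show chartCoord (n := n) x₀ i = proj ∘ φ from rfl,
      mvfderiv_comp_extChartAt_apply hp proj.differentiableAt, proj.fderiv]
    rfl
  rw [hdf, mvfderiv_comp_extChartAt_apply hp hF]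
  simp only [sum_apply, smul_apply, hcoord]
  refine (map_eq_sum_smul_map_single (fderiv ℝ (f ∘ φ.symm) (φ p)).toLinearMap w).trans ?_
  exact Finset.sum_congr rfl fun i _ => mul_comm _ _

variable {y : ∀ x : M, Cotangent n x →ₗ[ℝ] ℝ}

theorem contMDiff_sq_mul_apply_mvfderiv_chartCoord
    (hy : ∀ f : M → ℝ, ContMDiff (𝓡 n) 𝓘(ℝ) ∞ f →
      ContMDiff (𝓡 n) 𝓘(ℝ) ∞ fun x => y x (mvfderiv (𝓡 n) f x))
    {χ : M → ℝ} (hχ : ContMDiff (𝓡 n) 𝓘(ℝ) ∞ χ)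
    (hs : tsupport χ ⊆ (extChartAt (𝓡 n) x₀).source) (i : Fin n) :
    ContMDiff (𝓡 n) 𝓘(ℝ) ∞ fun p =>
      χ p ^ 2 * y p (mvfderiv (𝓡 n) (chartCoord (n := n) x₀ i) p) := by
  have hχx : ContMDiff (𝓡 n) 𝓘(ℝ) ∞ fun p => χ p * chartCoord (n := n) x₀ i p :=
    contMDiff_of_tsupport fun p hp =>
      (hχ p).mul (contMDiffAt_chartCoord i (hs (tsupport_mul_subset_left hp)))
  refine contMDiff_of_tsupport fun p hp => ?_
  simp only [pow_two, mul_assoc] at hp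
  have hps : p ∈ (extChartAt (𝓡 n) x₀).source := hs (tsupport_mul_subset_left hp)
  -- The chart coordinate is not a global function: write `χ² dxᵢ = χ (d(χ xᵢ) - xᵢ dχ)`.
  have hlocal : ContMDiffAt (𝓡 n) 𝓘(ℝ) ∞ (fun p => χ p *
      (y p (mvfderiv (𝓡 n) (fun p => χ p * chartCoord (n := n) x₀ i p) p) -
        chartCoord (n := n) x₀ i p * y p (mvfderiv (𝓡 n) χ p))) p :=
    (hχ p).mul ((hy _ hχx p).sub ((contMDiffAt_chartCoord i hps).mul (hy _ hχ p)))
  refine hlocal.congr_of_eventuallyEq (Filter.eventuallyEq_of_mem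
    ((isOpen_extChartAt_source x₀).mem_nhds hps) fun q hq => ?_)
  simp only [mvfderiv_fun_mul ((hχ q).mdifferentiableAt (by simp))
    ((contMDiffAt_chartCoord i hq).mdifferentiableAt (by simp)), map_add, map_smul, smul_eq_mul]
  ring

variable [CompactSpace M] [T2Space M] [MeasurableSpace M] [BorelSpace M]
  [RiemannianBundle (fun x : M => TangentSpace (𝓡 n) x)]
  [IsContMDiffRiemannianBundle (𝓡 n) ∞ (EuclideanSpace ℝ (Fin n))
    (fun x : M => TangentSpace (𝓡 n) x)]

-- A vector field is encoded as its pairing `y` with covectors.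
theorem exists_divergence
    (hy : ∀ f : M → ℝ, ContMDiff (𝓡 n) 𝓘(ℝ) ∞ f →
      ContMDiff (𝓡 n) 𝓘(ℝ) ∞ fun x => y x (mvfderiv (𝓡 n) f x)) :
    ∃ d : M → ℝ, Continuous d ∧ ∀ f : M → ℝ, ContMDiff (𝓡 n) 𝓘(ℝ) ∞ f →
      ∫ p, y p (mvfderiv (𝓡 n) f p) ∂(riemannianVolume n M) =
        -∫ p, d p * f p ∂(riemannianVolume n M) := by
  obtain ⟨t, χ, hχ, hs, hsum⟩ := exists_finset_contMDiff_sum_sq_eq_one (n := n)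
    (fun x : M => (extChartAt (𝓡 n) x).source) (fun x => extChartAt_source_mem_nhds x)
  let h : M × Fin n → M → ℝ := fun a p =>
    χ a.1 p ^ 2 * y p (mvfderiv (𝓡 n) (chartCoord (n := n) a.1 a.2) p)
  have hh (a) : ContMDiff (𝓡 n) 𝓘(ℝ) ∞ (h a) :=
    contMDiff_sq_mul_apply_mvfderiv_chartCoord hy (hχ a.1) (hs a.1) a.2
  have hhs (a) : tsupport (h a) ⊆ (extChartAt (𝓡 n) a.1).source := by
    refine subset_trans ?_ (hs a.1)
    simp only [h, pow_two, mul_assoc]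
    exact tsupport_mul_subset_left
  have hdiv (a) : Continuous (chartDivergence a.1 a.2 (h a)) :=
    continuous_chartDivergence a.2 (hh a) (hhs a)
  have hexpand (f : M → ℝ) (hf : ContMDiff (𝓡 n) 𝓘(ℝ) ∞ f) (p) : y p (mvfderiv (𝓡 n) f p) =
      ∑ a ∈ t ×ˢ Finset.univ, h a p * chartDeriv a.1 a.2 f p := by
    rw [← one_mul (y p _), ← hsum p, Finset.sum_mul, Finset.sum_product]
    refine Finset.sum_congr rfl fun x _ => ?_
    by_cases hp : p ∈ (extChartAt (𝓡 n) x).source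
    · simp only [mvfderiv_eq_sum_chartDeriv hp hf, map_sum, map_smul, smul_eq_mul, Finset.mul_sum,
        h, mul_assoc, mul_comm (chartDeriv _ _ _ _)]
    · have hχp : χ x p = 0 := image_eq_zero_of_notMem_tsupport fun hp' => hp (hs x hp')
      simp [h, hχp]
  refine ⟨fun p => ∑ a ∈ t ×ˢ Finset.univ, chartDivergence a.1 a.2 (h a) p,
    continuous_finsetSum _ fun a _ => hdiv a, fun f hf => ?_⟩
  simp only [hexpand f hf, Finset.sum_mul]
  rw [integral_finsetSum _ fun a _ => integrable_riemannianVolume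
      (continuous_mul_chartDeriv a.2 (hh a).continuous (hhs a) hf),
    integral_finsetSum (f := fun a p => chartDivergence a.1 a.2 (h a) p * f p) _ fun a _ =>
      integrable_riemannianVolume ((hdiv a).mul hf.continuous),
    ← Finset.sum_neg_distrib]
  exact Finset.sum_congr rfl fun a _ => integral_mul_chartDeriv a.2 (hh a) (hhs a) hf

end Divergence

/-! ### Sections of subbundles -/

section SmoothSections

variable (n : ℕ) {M : Type*} [TopologicalSpace M] [ChartedSpace (EuclideanSpace ℝ (Fin n)) M]
  (FE : Type*) [NormedAddCommGroup FE] [NormedSpace ℝ FE]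
  {E : M → Type*} [TopologicalSpace (TotalSpace FE E)]
  [∀ x, NormedAddCommGroup (E x)] [∀ x, InnerProductSpace ℝ (E x)] [FiberBundle FE E]

/-- The section `ξ` is smooth at `x`. -/
abbrev SmoothSectionAt (ξ : ∀ x, E x) (x : M) : Prop :=
  ContMDiffAt (𝓡 n) ((𝓡 n).prod 𝓘(ℝ, FE)) ∞ (fun x => TotalSpace.mk' FE x (ξ x)) x

/-- The section `ξ` is smooth. -/
abbrev SmoothSection (ξ : ∀ x, E x) : Prop :=
  ContMDiff (𝓡 n) ((𝓡 n).prod 𝓘(ℝ, FE)) ∞ (fun x => TotalSpace.mk' FE x (ξ x))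

/-- The family of maps `A x` sends sections smooth at a point to sections smooth at that point.
For a bundle map this is a consequence of smoothness which involves no topology on the bundle of
homomorphisms. -/
def PreservesSmooth (FF : Type*) [NormedAddCommGroup FF] [NormedSpace ℝ FF]
    {F : M → Type*} [TopologicalSpace (TotalSpace FF F)]
    [∀ x, NormedAddCommGroup (F x)] [∀ x, InnerProductSpace ℝ (F x)] [FiberBundle FF F]
    (A : ∀ x, E x →L[ℝ] F x) : Prop :=
  ∀ (ξ : ∀ x, E x) (x : M), SmoothSectionAt n FE ξ x → SmoothSectionAt n FF (fun x => A x (ξ x)) x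

/-- `p` is a smooth family of projections of `E` onto the subbundle `E'`. -/
structure IsSmoothProjection (E' : ∀ x, Submodule ℝ (E x)) (p : ∀ x, E x →L[ℝ] E x) : Prop where
  preservesSmooth : PreservesSmooth n FE FE p
  apply_mem : ∀ x e, p x e ∈ E' x
  apply_of_mem : ∀ x, ∀ e ∈ E' x, p x e = e

variable {n FE}

theorem PreservesSmooth.id : PreservesSmooth n FE FE fun x => ContinuousLinearMap.id ℝ (E x) :=
  fun _ _ hξ => hξ

theorem PreservesSmooth.sub {FF : Type*} [NormedAddCommGroup FF]
    [NormedSpace ℝ FF] {F : M → Type*} [TopologicalSpace (TotalSpace FF F)]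
    [∀ x, NormedAddCommGroup (F x)] [∀ x, InnerProductSpace ℝ (F x)] [FiberBundle FF F]
    [VectorBundle ℝ FF F] {A B : ∀ x, E x →L[ℝ] F x} (hA : PreservesSmooth n FE FF A)
    (hB : PreservesSmooth n FE FF B) : PreservesSmooth n FE FF fun x => A x - B x :=
  fun ξ x hξ => (hA ξ x hξ).sub_section (hB ξ x hξ)

theorem IsSmoothProjection.map_mem_sectionsIn {E' : ∀ x, Submodule ℝ (E x)}
    {p : ∀ x, E x →L[ℝ] E x} (hp : IsSmoothProjection n FE E' p) {ξ : ∀ x, E x}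
    (hξ : SmoothSection n FE ξ) : (fun x => p x (ξ x)) ∈ sectionsIn n FE E' :=
  ⟨fun x => hp.preservesSmooth ξ x (hξ x), fun x => hp.apply_mem x (ξ x)⟩

end SmoothSections

section GeneratingFamilies

variable {n : ℕ} {M : Type*} [TopologicalSpace M] [ChartedSpace (EuclideanSpace ℝ (Fin n)) M]
  {FE : Type*} [NormedAddCommGroup FE] [NormedSpace ℝ FE]
  {E : M → Type*} [TopologicalSpace (TotalSpace FE E)]
  [∀ x, NormedAddCommGroup (E x)] [∀ x, InnerProductSpace ℝ (E x)]
  [FiberBundle FE E]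

variable (n FE) in
/-- The sections `s a`, `a ∈ T`, generate the smooth sections of `E'`, with smooth coefficients
which are bounded by `K` times the section. -/
structure IsGeneratingFamily {ι : Type*} (E' : ∀ x, Submodule ℝ (E x)) (T : Finset ι)
    (s : ι → ∀ x, E x) (K : ℝ) : Prop where
  mem : ∀ a, s a ∈ sectionsIn n FE E'
  exists_coeff : ∀ ξ ∈ sectionsIn n FE E', ∃ v : ι → M → ℝ,
    (∀ a, ContMDiff (𝓡 n) 𝓘(ℝ) ∞ (v a)) ∧ (ξ = fun x => ∑ a ∈ T, v a x • s a x) ∧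
      ∀ a ∈ T, ∀ x, |v a x| ≤ K * ‖ξ x‖

theorem IsGeneratingFamily.map_projection {ι : Type*} {T : Finset ι} {s : ι → ∀ x, E x} {K : ℝ}
    (hs : IsGeneratingFamily n FE (fun _ => ⊤) T s K) {E' : ∀ x, Submodule ℝ (E x)}
    {p : ∀ x, E x →L[ℝ] E x} (hp : IsSmoothProjection n FE E' p) :
    IsGeneratingFamily n FE E' T (fun a x => p x (s a x)) K where
  mem a := hp.map_mem_sectionsIn (hs.mem a).1
  exists_coeff ξ hξ := by
    obtain ⟨v, hv, hsum, hbound⟩ := hs.exists_coeff ξ ⟨hξ.1, fun _ => trivial⟩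
    refine ⟨v, hv, funext fun x => ?_, hbound⟩
    rw [← hp.apply_of_mem x _ (hξ.2 x)]
    conv_lhs => rw [hsum]
    simp only [map_sum, map_smul]

variable [VectorBundle ℝ FE E]

theorem abs_localFrameCoeff_le [ContMDiffVectorBundle 1 FE E (𝓡 n)]
    (e : Trivialization FE (TotalSpace.proj : TotalSpace FE E → M)) [MemTrivializationAtlas e]
    {ι : Type*} [Fintype ι] (b : Module.Basis ι ℝ FE) (i : ι) {x : M} (hx : x ∈ e.baseSet)
    (ξ : ∀ x, E x) :
    |e.localFrameCoeff (𝓡 n) b i x (ξ x)| ≤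
      ‖(b.equivFunL : FE →L[ℝ] (ι → ℝ))‖ * (‖e.continuousLinearMapAt ℝ x‖ * ‖ξ x‖) := by
  have hcoeff : e.localFrameCoeff (𝓡 n) b i x (ξ x) =
      (b.equivFunL : FE →L[ℝ] (ι → ℝ)) (e.continuousLinearMapAt ℝ x (ξ x)) i := by
    rw [e.localFrameCoeff_eq_coeff hx, Trivialization.continuousLinearMapAt_apply,
      Trivialization.coe_linearMapAt_of_mem _ hx]
    rfl
  rw [hcoeff, ← Real.norm_eq_abs]
  exact (norm_le_pi_norm _ i).trans ((ContinuousLinearMap.le_opNorm _ _).trans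
    (by gcongr; exact ContinuousLinearMap.le_opNorm _ _))

theorem sum_mul_localFrameCoeff_smul_localFrame [ContMDiffVectorBundle 1 FE E (𝓡 n)]
    (e : Trivialization FE (TotalSpace.proj : TotalSpace FE E → M)) [MemTrivializationAtlas e]
    {ι : Type*} [Fintype ι] (b : Module.Basis ι ℝ FE) {c : ℝ} {x : M}
    (hc : c ≠ 0 → x ∈ e.baseSet) (ξ : ∀ x, E x) :
    ∑ i, (c * e.localFrameCoeff (𝓡 n) b i x (ξ x)) • c • e.localFrame b i x = c ^ 2 • ξ x := by
  rcases eq_or_ne c 0 with rfl | hc₀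
  · simp
  · conv_rhs => rw [e.eq_sum_localFrameCoeff_smul (I := 𝓡 n) (b := b) (s := ξ) (hc hc₀)]
    rw [Finset.smul_sum]
    refine Finset.sum_congr rfl fun i _ => ?_
    module

variable [FiniteDimensional ℝ FE] [IsManifold (𝓡 n) ∞ M] [ContMDiffVectorBundle ∞ FE E (𝓡 n)]

theorem exists_isGeneratingFamily [IsContinuousRiemannianBundle FE E] [CompactSpace M]
    [T2Space M] :
    ∃ (T : Finset (M × Fin (Module.finrank ℝ FE))) (s : _ → ∀ x, E x) (K : ℝ),
      IsGeneratingFamily n FE (fun _ => ⊤) T s K := by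
  have : ContMDiffVectorBundle 1 FE E (𝓡 n) := ContMDiffVectorBundle.of_le (n := ∞) (by simp)
  let e (x : M) := trivializationAt FE E x
  choose C hC₀ hC using fun x => eventually_norm_trivializationAt_lt FE E x
  obtain ⟨t, χ, hχ, hχs, hsum⟩ := exists_finset_contMDiff_sum_sq_eq_one (n := n)
    (fun x => (e x).baseSet ∩ {y | ‖(e x).continuousLinearMapAt ℝ y‖ < C x}) fun x =>
      Filter.inter_mem ((e x).open_baseSet.mem_nhds
        (FiberBundle.mem_baseSet_trivializationAt' x)) (hC x)
  let b := Module.finBasis ℝ FE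
  refine ⟨t ×ˢ Finset.univ, fun a x => χ a.1 x • (e a.1).localFrame b a.2 x,
    ‖(b.equivFunL : FE →L[ℝ] (Fin (Module.finrank ℝ FE) → ℝ))‖ * ∑ x ∈ t, C x,
    fun a => ⟨?_, fun _ => trivial⟩,
    fun ξ hξ => ⟨fun a x => χ a.1 x * (e a.1).localFrameCoeff (𝓡 n) b a.2 x (ξ x),
      fun a => ?_, funext fun x => ?_, fun a ha x => ?_⟩⟩
  · exact ContMDiffOn.smul_section_of_tsupport (hχ _).contMDiffOn (e a.1).open_baseSet
      ((hχs _).trans Set.inter_subset_left)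
      ((e a.1).contMDiffOn_localFrame_baseSet (I := 𝓡 n) ∞ b a.2)
  · exact contMDiff_of_tsupport fun x hx => (hχ _ x).mul (contMDiffAt_localFrameCoeff b
      (hχs _ (tsupport_mul_subset_left hx)).1 (hξ.1 x) a.2)
  · rw [Finset.sum_product, ← one_smul ℝ (ξ x), ← hsum x, Finset.sum_smul]
    exact Finset.sum_congr rfl fun z _ => (sum_mul_localFrameCoeff_smul_localFrame (e z) b
      (fun hz => (hχs z (subset_tsupport _ hz)).1) ξ).symm
  · have hχ_le : |χ a.1 x| ≤ 1 := by
      rw [← sq_le_one_iff_abs_le_one, ← hsum x]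
      exact Finset.single_le_sum (f := fun z => χ z x ^ 2) (fun _ _ => sq_nonneg _)
        (Finset.mem_product.1 ha).1
    by_cases hx : x ∈ tsupport (χ a.1)
    · have hCx : ‖(e a.1).continuousLinearMapAt ℝ x‖ ≤ ∑ x ∈ t, C x :=
        (hχs _ hx).2.le.trans
          (Finset.single_le_sum (f := C) (fun x _ => (hC₀ x).le) (Finset.mem_product.1 ha).1)
      rw [abs_mul, mul_assoc]
      refine (mul_le_of_le_one_left (abs_nonneg _) hχ_le).trans
        ((abs_localFrameCoeff_le (e a.1) b a.2 (hχs _ hx).1 ξ).trans ?_)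
      gcongr
    · have hC_nonneg : 0 ≤ ∑ x ∈ t, C x := Finset.sum_nonneg fun x _ => (hC₀ x).le
      simp only [image_eq_zero_of_notMem_tsupport hx, zero_mul, abs_zero]
      positivity

end GeneratingFamilies

section LowerBound

theorem exists_pos_eventually_forall_mul_le {X V : Type*} [TopologicalSpace X]
    [NormedAddCommGroup V] [NormedSpace ℝ V] [FiniteDimensional ℝ V] {x₀ : X} {q g : X → V → ℝ}
    (hq : ∀ v, ContinuousAt (fun z : X × V => q z.1 z.2) (x₀, v))
    (hg : ∀ v, ContinuousAt (fun z : X × V => g z.1 z.2) (x₀, v))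
    (hq_smul : ∀ x (c : ℝ) v, q x (c • v) = c ^ 2 * q x v)
    (hg_smul : ∀ x (c : ℝ) v, g x (c • v) = c ^ 2 * g x v)
    (hpos : ∀ v, v ≠ 0 → 0 < q x₀ v) :
    ∃ κ > 0, ∀ᶠ x in nhds x₀, ∀ v, κ * g x v ≤ q x v := by
  have hsphere : ∀ᶠ z in nhds ((0 : ℝ), x₀), ∀ v ∈ Metric.sphere (0 : V) 1,
      z.1 * g z.2 v < q z.2 v := by
    refine (isCompact_sphere (0 : V) 1).eventually_forall_of_forall_eventually fun v hv => ?_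
    have hproj : Filter.Tendsto (fun z : (ℝ × X) × V => (z.1.2, z.2)) (nhds ((0, x₀), v))
        (nhds (x₀, v)) := Continuous.tendsto' (by fun_prop) _ _ rfl
    have hfst : ContinuousAt (fun z : (ℝ × X) × V => z.1.1) ((0, x₀), v) := by fun_prop
    refine (hfst.mul ((hg v).tendsto.comp hproj)).eventually_lt ((hq v).tendsto.comp hproj) ?_
    simpa using hpos v (Metric.ne_of_mem_sphere hv one_ne_zero)
  obtain ⟨κ, hκ, hκ₀⟩ := ((hsphere.curry_nhds.filter_mono
    (nhdsWithin_le_nhds (s := Set.Ioi 0))).and self_mem_nhdsWithin).exists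
  refine ⟨κ, hκ₀, hκ.mono fun x hx v => ?_⟩
  rcases eq_or_ne v 0 with rfl | hv
  · have hq₀ := hq_smul x 0 0
    have hg₀ := hg_smul x 0 0
    simp_all
  · have hunit := hx (‖v‖⁻¹ • v) (by simp [norm_smul, hv])
    rw [hq_smul, hg_smul, mul_left_comm] at hunit
    exact (lt_of_mul_lt_mul_left hunit (sq_nonneg _)).le

theorem continuousAt_norm_sq_sum_smul {X ι : Type*} [TopologicalSpace X] [Fintype ι]
    {G : X → Type*} [∀ x, NormedAddCommGroup (G x)] [∀ x, InnerProductSpace ℝ (G x)]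
    {u : ι → ∀ x, G x} {x₀ : X} (hu : ∀ a b, ContinuousAt (fun x => ⟪u a x, u b x⟫_ℝ) x₀)
    (v : ι → ℝ) :
    ContinuousAt (fun z : X × (ι → ℝ) => ‖∑ a, z.2 a • u a z.1‖ ^ 2) (x₀, v) := by
  simp only [← real_inner_self_eq_norm_sq, sum_inner, inner_sum, real_inner_smul_left,
    real_inner_smul_right]
  have hcoord (a : ι) : ContinuousAt (fun z : X × (ι → ℝ) => z.2 a) (x₀, v) := by fun_prop
  have hinner (a b : ι) : ContinuousAt (fun z : X × (ι → ℝ) => ⟪u a z.1, u b z.1⟫_ℝ) (x₀, v) :=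
    Filter.Tendsto.comp (hu a b) continuousAt_fst
  exact tendsto_finsetSum _ fun a _ => tendsto_finsetSum _ fun b _ =>
    (hcoord a).mul ((hcoord b).mul (hinner b a))

variable {n : ℕ} {M : Type*} [TopologicalSpace M] [ChartedSpace (EuclideanSpace ℝ (Fin n)) M]
  {FE : Type*} [NormedAddCommGroup FE] [NormedSpace ℝ FE]
  {E : M → Type*} [TopologicalSpace (TotalSpace FE E)]
  [∀ x, NormedAddCommGroup (E x)] [∀ x, InnerProductSpace ℝ (E x)] [FiberBundle FE E]
  {FF : Type*} [NormedAddCommGroup FF] [NormedSpace ℝ FF]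
  {F : M → Type*} [TopologicalSpace (TotalSpace FF F)]
  [∀ x, NormedAddCommGroup (F x)] [∀ x, InnerProductSpace ℝ (F x)]
  [FiberBundle FF F] [VectorBundle ℝ FF F] [IsContMDiffRiemannianBundle (𝓡 n) ∞ FF F]
  {A : ∀ x, E x →L[ℝ] F x}

theorem PreservesSmooth.continuousAt_norm_sq (hA : PreservesSmooth n FE FF A) {ι : Type*}
    [Fintype ι] {s : ι → ∀ x, E x} {x₀ : M} (hs : ∀ a, SmoothSectionAt n FE (s a) x₀)
    (v : ι → ℝ) :
    ContinuousAt (fun z : M × (ι → ℝ) => ‖A z.1 (∑ a, z.2 a • s a z.1)‖ ^ 2) (x₀, v) := by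
  simp only [map_sum, map_smul]
  exact continuousAt_norm_sq_sum_smul
    (fun a b => ((hA _ x₀ (hs a)).inner_bundle (hA _ x₀ (hs b))).continuousAt) v

variable [FiniteDimensional ℝ FE] [VectorBundle ℝ FE E]
  [ContMDiffVectorBundle ∞ FE E (𝓡 n)] [IsContMDiffRiemannianBundle (𝓡 n) ∞ FE E]
  {p : ∀ x, E x →L[ℝ] E x}

theorem exists_pos_eventually_mul_norm_sq_le_of_projection (hp : PreservesSmooth n FE FE p)
    (hA : PreservesSmooth n FE FF A) {x₀ : M} (h₀ : ∀ e, p x₀ e = e → A x₀ e = 0 → e = 0) :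
    ∃ κ > 0, ∀ᶠ x in nhds x₀, ∀ e, p x e = e → κ * ‖e‖ ^ 2 ≤ ‖A x e‖ ^ 2 := by
  let b := Module.finBasis ℝ FE
  let frame := (trivializationAt FE E x₀).localFrame b
  have hx₀ : x₀ ∈ (trivializationAt FE E x₀).baseSet :=
    FiberBundle.mem_baseSet_trivializationAt' x₀
  have hframe := (trivializationAt FE E x₀).isLocalFrameOn_localFrame_baseSet (𝓡 n) ∞ b
  have hsmooth (a) : SmoothSectionAt n FE (frame a) x₀ :=
    ((trivializationAt FE E x₀).contMDiffOn_localFrame_baseSet (I := 𝓡 n) ∞ b a).contMDiffAt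
      ((trivializationAt FE E x₀).open_baseSet.mem_nhds hx₀)
  let w (x : M) : (Fin (Module.finrank ℝ FE) → ℝ) →ₗ[ℝ] E x :=
    Fintype.linearCombination ℝ fun a => frame a x
  -- Penalizing the component outside the range of `p` makes the form definite on all of `E x₀`.
  obtain ⟨κ, hκ, hle⟩ := exists_pos_eventually_forall_mul_le
    (q := fun x v => ‖A x (w x v)‖ ^ 2 + ‖w x v - p x (w x v)‖ ^ 2) (g := fun x v => ‖w x v‖ ^ 2)
    (fun v => (hA.continuousAt_norm_sq hsmooth v).add
      ((PreservesSmooth.id.sub hp).continuousAt_norm_sq hsmooth v))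
    (fun v => PreservesSmooth.id.continuousAt_norm_sq hsmooth v)
    (fun x c v => by
      simp only [map_smul, ← smul_sub, norm_smul, mul_pow, Real.norm_eq_abs, sq_abs]; ring)
    (fun x c v => by simp only [map_smul, norm_smul, mul_pow, Real.norm_eq_abs, sq_abs])
    (fun v hv => by
      by_contra! hle
      obtain ⟨hA₀, hp₀⟩ : A x₀ (w x₀ v) = 0 ∧ w x₀ v - p x₀ (w x₀ v) = 0 := by
        simpa using (add_eq_zero_iff_of_nonneg (sq_nonneg _) (sq_nonneg _)).1
          (hle.antisymm (by positivity))
      exact hv (funext (Fintype.linearIndependent_iff.1 (hframe.linearIndependent hx₀) v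
        (h₀ _ (sub_eq_zero.1 hp₀).symm hA₀))))
  refine ⟨κ, hκ, ?_⟩
  filter_upwards [hle, (trivializationAt FE E x₀).open_baseSet.mem_nhds hx₀] with x hx hxb e he
  obtain ⟨v, rfl⟩ : ∃ v, w x v = e := by
    have hspan := hframe.generating hxb
    rw [← Fintype.range_linearCombination] at hspan
    exact hspan trivial
  simpa [he] using hx v

theorem exists_pos_forall_mul_norm_sq_le_of_projection (hp : PreservesSmooth n FE FE p)
    (hA : PreservesSmooth n FE FF A) {K : Set M} (hK : IsCompact K)
    (h₀ : ∀ x ∈ K, ∀ e, p x e = e → A x e = 0 → e = 0) :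
    ∃ κ > 0, ∀ x ∈ K, ∀ e, p x e = e → κ * ‖e‖ ^ 2 ≤ ‖A x e‖ ^ 2 := by
  refine hK.induction_on (p := fun K => ∃ κ > 0, ∀ x ∈ K, ∀ e, p x e = e →
    κ * ‖e‖ ^ 2 ≤ ‖A x e‖ ^ 2) ⟨1, one_pos, by simp⟩ ?_ ?_ ?_
  · rintro s t hst ⟨κ, hκ, hle⟩
    exact ⟨κ, hκ, fun x hx => hle x (hst hx)⟩
  · rintro s t ⟨κ, hκ, hle⟩ ⟨κ', hκ', hle'⟩
    refine ⟨min κ κ', lt_min hκ hκ', ?_⟩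
    rintro x (hx | hx) e he
    · exact le_trans (by gcongr; exact min_le_left _ _) (hle x hx e he)
    · exact le_trans (by gcongr; exact min_le_right _ _) (hle' x hx e he)
  · intro x hx
    obtain ⟨κ, hκ, hle⟩ := exists_pos_eventually_mul_norm_sq_le_of_projection hp hA (h₀ x hx)
    exact ⟨_, mem_nhdsWithin_of_mem_nhds hle, κ, hκ, fun _ hy => hy⟩

end LowerBound

/-! ### Concentration for first order operators -/

section FirstOrderOperators

variable {n : ℕ} {M : Type*} [TopologicalSpace M] [ChartedSpace (EuclideanSpace ℝ (Fin n)) M]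
  {FE : Type*} [NormedAddCommGroup FE] [NormedSpace ℝ FE]
  {E : M → Type*} [TopologicalSpace (TotalSpace FE E)]
  [∀ x, NormedAddCommGroup (E x)] [∀ x, InnerProductSpace ℝ (E x)]
  [FiberBundle FE E] [VectorBundle ℝ FE E]
  {FF : Type*} [NormedAddCommGroup FF] [NormedSpace ℝ FF]
  {F : M → Type*} [TopologicalSpace (TotalSpace FF F)]
  [∀ x, NormedAddCommGroup (F x)] [∀ x, InnerProductSpace ℝ (F x)]
  [FiberBundle FF F]
  {E' : ∀ x, Submodule ℝ (E x)} {σ : ∀ x : M, Cotangent n x →ₗ[ℝ] (E x →L[ℝ] F x)}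
  {D : (∀ x, E x) → ∀ x, F x} {ξ : ∀ x, E x} {ζ : ∀ x, F x} {f : M → ℝ}

variable (FE FF) in
/-- `D` is a first order differential operator from the smooth sections of `E'` to those of `F`,
with symbol `σ`. -/
structure IsFirstOrderOperator (E' : ∀ x, Submodule ℝ (E x)) (D : (∀ x, E x) → ∀ x, F x)
    (σ : ∀ x : M, Cotangent n x →ₗ[ℝ] (E x →L[ℝ] F x)) : Prop where
  smooth : ∀ ξ ∈ sectionsIn n FE E', SmoothSection n FF (D ξ)
  map_add : ∀ ξ ∈ sectionsIn n FE E', ∀ η ∈ sectionsIn n FE E', ∀ x,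
    D (fun y => ξ y + η y) x = D ξ x + D η x
  leibniz : ∀ ξ ∈ sectionsIn n FE E', ∀ f : M → ℝ, ContMDiff (𝓡 n) 𝓘(ℝ) ∞ f → ∀ x,
    D (fun y => f y • ξ y) x = σ x (mvfderiv (𝓡 n) f x) (ξ x) + f x • D ξ x

/-- The vector field `u ↦ ⟨σ(u) ξ, ζ⟩`, as a linear form on covectors. -/
def symbolPairing (σ : ∀ x : M, Cotangent n x →ₗ[ℝ] (E x →L[ℝ] F x)) (ξ : ∀ x, E x)
    (ζ : ∀ x, F x) (x : M) : Cotangent n x →ₗ[ℝ] ℝ :=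
  innerₛₗ ℝ (ζ x) ∘ₗ LinearMap.applyₗ (ξ x) ∘ₗ ContinuousLinearMap.coeLM ℝ ∘ₗ σ x

theorem symbolPairing_apply (x : M) (u : Cotangent n x) :
    symbolPairing σ ξ ζ x u = ⟪σ x u (ξ x), ζ x⟫_ℝ :=
  real_inner_comm _ _

theorem smul_mem_sectionsIn (hf : ContMDiff (𝓡 n) 𝓘(ℝ) ∞ f) (hξ : ξ ∈ sectionsIn n FE E') :
    (fun x => f x • ξ x) ∈ sectionsIn n FE E' :=
  ⟨hf.smul_section hξ.1, fun x => (E' x).smul_mem _ (hξ.2 x)⟩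

theorem sum_mem_sectionsIn {ι : Type*} (T : Finset ι) {s : ι → ∀ x, E x}
    (hs : ∀ a, s a ∈ sectionsIn n FE E') : (fun x => ∑ a ∈ T, s a x) ∈ sectionsIn n FE E' :=
  ⟨ContMDiff.sum_section fun a _ => (hs a).1, fun x => sum_mem fun a _ => (hs a).2 x⟩

theorem IsFirstOrderOperator.map_sum (hD : IsFirstOrderOperator FE FF E' D σ) {ι : Type*}
    (T : Finset ι) {s : ι → ∀ x, E x} (hs : ∀ a, s a ∈ sectionsIn n FE E') (x : M) :
    D (fun x => ∑ a ∈ T, s a x) x = ∑ a ∈ T, D (s a) x := by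
  classical
  induction T using Finset.induction_on with
  | empty =>
    have hzero : (fun x => (0 : E x)) ∈ sectionsIn n FE E' :=
      ⟨contMDiff_zeroSection ℝ E, fun x => zero_mem _⟩
    simpa using hD.map_add _ hzero _ hzero x
  | insert a T ha ih =>
    simp only [Finset.sum_insert ha]
    rw [hD.map_add _ (hs a) _ (sum_mem_sectionsIn T hs), ih]

theorem IsFirstOrderOperator.contMDiff_symbolPairing [VectorBundle ℝ FF F]
    [IsContMDiffRiemannianBundle (𝓡 n) ∞ FF F] (hD : IsFirstOrderOperator FE FF E' D σ)
    (hξ : ξ ∈ sectionsIn n FE E') (hζ : SmoothSection n FF ζ) (hf : ContMDiff (𝓡 n) 𝓘(ℝ) ∞ f) :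
    ContMDiff (𝓡 n) 𝓘(ℝ) ∞ fun x => symbolPairing σ ξ ζ x (mvfderiv (𝓡 n) f x) := by
  have hcommutator : SmoothSection n FF fun x => D (fun y => f y • ξ y) x - f x • D ξ x :=
    (hD.smooth _ (smul_mem_sectionsIn hf hξ)).sub_section (hf.smul_section (hD.smooth _ hξ))
  refine (hcommutator.inner_bundle hζ).congr fun x => ?_
  rw [symbolPairing_apply, hD.leibniz _ hξ f hf, add_sub_cancel_right]

variable {A : ∀ x, E x →L[ℝ] F x}

-- The symmetry of `(a, b) ↦ ⟨σ(u) s_a, A s_b⟩` turns `v_b dv_a` into half of `d(v_a v_b)`.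
theorem IsFirstOrderOperator.inner_apply_sum_smul (hD : IsFirstOrderOperator FE FF E' D σ)
    (hsymm : ∀ x u, ∀ e ∈ E' x, ∀ e' ∈ E' x, ⟪σ x u e, A x e'⟫_ℝ = ⟪σ x u e', A x e⟫_ℝ)
    {ι : Type*} (T : Finset ι) {s : ι → ∀ x, E x} (hs : ∀ a, s a ∈ sectionsIn n FE E')
    {v : ι → M → ℝ} (hv : ∀ a, ContMDiff (𝓡 n) 𝓘(ℝ) ∞ (v a)) (x : M) :
    ⟪D (fun x => ∑ a ∈ T, v a x • s a x) x, A x (∑ a ∈ T, v a x • s a x)⟫_ℝ =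
      ∑ a ∈ T, ∑ b ∈ T,
        (symbolPairing σ (s a) (fun x => A x (s b x)) x
            (mvfderiv (𝓡 n) (fun x => v a x * v b x) x) / 2 +
          ⟪D (s a) x, A x (s b x)⟫_ℝ * (v a x * v b x)) := by
  let y (a b : ι) (c : ι) : ℝ :=
    symbolPairing σ (s a) (fun x => A x (s b x)) x (mvfderiv (𝓡 n) (v c) x)
  have hy_symm (a b c) : y a b c = y b a c := by
    simp only [y, symbolPairing_apply, hsymm x _ _ ((hs a).2 x) _ ((hs b).2 x)]
  have hy_mul (a b) : symbolPairing σ (s a) (fun x => A x (s b x)) x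
      (mvfderiv (𝓡 n) (fun x => v a x * v b x) x) = v a x * y b a b + v b x * y a b a := by
    rw [mvfderiv_fun_mul ((hv a x).mdifferentiableAt (by simp))
      ((hv b x).mdifferentiableAt (by simp)), _root_.map_add, map_smul, map_smul, hy_symm b a]
    simp only [smul_eq_mul, y]
  have hterm (a b) : ⟪D (fun x => v a x • s a x) x, A x (v b x • s b x)⟫_ℝ =
      v b x * y a b a + ⟪D (s a) x, A x (s b x)⟫_ℝ * (v a x * v b x) := by
    rw [hD.leibniz _ (hs a) _ (hv a), map_smul, inner_smul_right, inner_add_left,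
      real_inner_smul_left]
    simp only [y, symbolPairing_apply]
    ring
  rw [hD.map_sum T fun a => smul_mem_sectionsIn (hv a) (hs a), _root_.map_sum, sum_inner]
  simp only [inner_sum, hterm, hy_mul, Finset.sum_add_distrib, add_div]
  congr 1
  rw [Finset.sum_comm (f := fun a b => v a x * y b a b / 2)]
  simp only [← Finset.sum_add_distrib]
  exact Finset.sum_congr rfl fun a _ => Finset.sum_congr rfl fun b _ => by ring

end FirstOrderOperators

section Integrability

variable {n : ℕ} {M : Type*} [TopologicalSpace M] [CompactSpace M]
  [MeasurableSpace M] [BorelSpace M]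
  [ChartedSpace (EuclideanSpace ℝ (Fin n)) M] [IsManifold (𝓡 n) ∞ M]
  [RiemannianBundle (fun x : M => TangentSpace (𝓡 n) x)]
  [IsContMDiffRiemannianBundle (𝓡 n) ∞ (EuclideanSpace ℝ (Fin n))
    (fun x : M => TangentSpace (𝓡 n) x)]
  {FF : Type*} [NormedAddCommGroup FF] [NormedSpace ℝ FF]
  {F : M → Type*} [TopologicalSpace (TotalSpace FF F)]
  [∀ x, NormedAddCommGroup (F x)] [∀ x, InnerProductSpace ℝ (F x)]
  [FiberBundle FF F] [VectorBundle ℝ FF F] [IsContMDiffRiemannianBundle (𝓡 n) ∞ FF F]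
  {η ζ : ∀ x, F x}

theorem SmoothSection.integrable_inner (hη : SmoothSection n FF η) (hζ : SmoothSection n FF ζ) :
    Integrable (fun x => ⟪η x, ζ x⟫_ℝ) (riemannianVolume n M) :=
  integrable_riemannianVolume (hη.inner_bundle hζ).continuous

theorem SmoothSection.integrable_norm_sq (hη : SmoothSection n FF η) :
    Integrable (fun x => ‖η x‖ ^ 2) (riemannianVolume n M) := by
  simpa only [real_inner_self_eq_norm_sq] using SmoothSection.integrable_inner hη hη

theorem SmoothSection.integral_norm_sq_add_smul (hη : SmoothSection n FF η)
    (hζ : SmoothSection n FF ζ) (s : ℝ) :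
    ∫ x, ‖η x + s • ζ x‖ ^ 2 ∂(riemannianVolume n M) =
      ∫ x, ‖η x‖ ^ 2 ∂(riemannianVolume n M) +
        2 * s * ∫ x, ⟪η x, ζ x⟫_ℝ ∂(riemannianVolume n M) +
        s ^ 2 * ∫ x, ‖ζ x‖ ^ 2 ∂(riemannianVolume n M) := by
  have hη_int := SmoothSection.integrable_norm_sq hη
  have hinner_int := SmoothSection.integrable_inner hη hζ
  have hζ_int := SmoothSection.integrable_norm_sq hζ
  have hsum_int : Integrable (fun x => ‖η x‖ ^ 2 + 2 * s * ⟪η x, ζ x⟫_ℝ) (riemannianVolume n M) :=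
    hη_int.add (hinner_int.const_mul _)
  rw [← integral_const_mul, ← integral_const_mul, ← integral_add hη_int (hinner_int.const_mul _),
    ← integral_add hsum_int (hζ_int.const_mul _)]
  refine integral_congr_ae (ae_of_all _ fun x => ?_)
  dsimp only
  rw [norm_add_sq_real, real_inner_smul_right, norm_smul, mul_pow, Real.norm_eq_abs, sq_abs]
  ring

theorem abs_integral_mul_mul_le {r v w : M → ℝ} {R K : ℝ} (hη : SmoothSection n FF η)
    (hr : Continuous r) (hv : Continuous v) (hw : Continuous w) (hrR : ∀ x, |r x| ≤ R)
    (hvK : ∀ x, |v x| ≤ K * ‖η x‖) (hwK : ∀ x, |w x| ≤ K * ‖η x‖) :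
    |∫ x, r x * (v x * w x) ∂(riemannianVolume n M)| ≤
      R * K ^ 2 * ∫ x, ‖η x‖ ^ 2 ∂(riemannianVolume n M) := by
  rw [← integral_const_mul]
  refine abs_integral_le_integral_abs.trans (integral_mono
    (integrable_riemannianVolume (hr.mul (hv.mul hw))).abs
    ((SmoothSection.integrable_norm_sq hη).const_mul _) fun x => ?_)
  have hR : 0 ≤ R := (abs_nonneg _).trans (hrR x)
  simp only [abs_mul]
  calc |r x| * (|v x| * |w x|) ≤ R * ((K * ‖η x‖) * (K * ‖η x‖)) := by
        have := (abs_nonneg _).trans (hvK x)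
        gcongr
        exacts [hrR x, hvK x, hwK x]
    _ = R * K ^ 2 * ‖η x‖ ^ 2 := by ring

end Integrability

section CrossTerm

variable {n : ℕ} {M : Type*} [TopologicalSpace M] [CompactSpace M] [T2Space M]
  [MeasurableSpace M] [BorelSpace M]
  [ChartedSpace (EuclideanSpace ℝ (Fin n)) M] [IsManifold (𝓡 n) ∞ M]
  [RiemannianBundle (fun x : M => TangentSpace (𝓡 n) x)]
  [IsContMDiffRiemannianBundle (𝓡 n) ∞ (EuclideanSpace ℝ (Fin n))
    (fun x : M => TangentSpace (𝓡 n) x)]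
  {FE : Type*} [NormedAddCommGroup FE] [NormedSpace ℝ FE]
  {E : M → Type*} [TopologicalSpace (TotalSpace FE E)]
  [∀ x, NormedAddCommGroup (E x)] [∀ x, InnerProductSpace ℝ (E x)]
  [FiberBundle FE E] [VectorBundle ℝ FE E]
  {FF : Type*} [NormedAddCommGroup FF] [NormedSpace ℝ FF]
  {F : M → Type*} [TopologicalSpace (TotalSpace FF F)]
  [∀ x, NormedAddCommGroup (F x)] [∀ x, InnerProductSpace ℝ (F x)]
  [FiberBundle FF F] [VectorBundle ℝ FF F] [IsContMDiffRiemannianBundle (𝓡 n) ∞ FF F]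
  {E' : ∀ x, Submodule ℝ (E x)} {σ : ∀ x : M, Cotangent n x →ₗ[ℝ] (E x →L[ℝ] F x)}
  {D : (∀ x, E x) → ∀ x, F x} {ξ : ∀ x, E x} {ζ : ∀ x, F x}

theorem IsFirstOrderOperator.exists_integral_eq_integral_mul
    (hD : IsFirstOrderOperator FE FF E' D σ) (hξ : ξ ∈ sectionsIn n FE E')
    (hζ : SmoothSection n FF ζ) :
    ∃ r : M → ℝ, Continuous r ∧ ∀ f : M → ℝ, ContMDiff (𝓡 n) 𝓘(ℝ) ∞ f →
      ∫ x, (symbolPairing σ ξ ζ x (mvfderiv (𝓡 n) f x) / 2 + ⟪D ξ x, ζ x⟫_ℝ * f x)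
        ∂(riemannianVolume n M) = ∫ x, r x * f x ∂(riemannianVolume n M) := by
  obtain ⟨d, hd, hdiv⟩ := exists_divergence fun f hf => hD.contMDiff_symbolPairing hξ hζ hf
  have hm : Continuous fun x => ⟪D ξ x, ζ x⟫_ℝ :=
    ((hD.smooth _ hξ).inner_bundle hζ).continuous
  refine ⟨fun x => ⟪D ξ x, ζ x⟫_ℝ - d x / 2, hm.sub (hd.div_const 2), fun f hf => ?_⟩
  have hd_int : Integrable (fun x => d x * f x) (riemannianVolume n M) :=
    integrable_riemannianVolume (hd.mul hf.continuous)
  have hm_int : Integrable (fun x => ⟪D ξ x, ζ x⟫_ℝ * f x) (riemannianVolume n M) :=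
    integrable_riemannianVolume (hm.mul hf.continuous)
  have hy_int := integrable_riemannianVolume (n := n)
    (hD.contMDiff_symbolPairing hξ hζ hf).continuous
  simp only [sub_mul, div_mul_eq_mul_div]
  rw [integral_add (hy_int.div_const 2) hm_int, integral_sub hm_int (hd_int.div_const 2),
    integral_div, integral_div, hdiv f hf]
  ring

variable [FiniteDimensional ℝ FE] [ContMDiffVectorBundle ∞ FE E (𝓡 n)]
  [IsContMDiffRiemannianBundle (𝓡 n) ∞ FE E]
  {p : ∀ x, E x →L[ℝ] E x} {A : ∀ x, E x →L[ℝ] F x}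

theorem IsFirstOrderOperator.exists_abs_integral_inner_le
    (hD : IsFirstOrderOperator FE FF E' D σ) (hp : IsSmoothProjection n FE E' p)
    (hA : PreservesSmooth n FE FF A)
    (hsymm : ∀ x u, ∀ e ∈ E' x, ∀ e' ∈ E' x, ⟪σ x u e, A x e'⟫_ℝ = ⟪σ x u e', A x e⟫_ℝ) :
    ∃ C, 0 ≤ C ∧ ∀ ξ ∈ sectionsIn n FE E',
      |∫ x, ⟪D ξ x, A x (ξ x)⟫_ℝ ∂(riemannianVolume n M)| ≤
        C * ∫ x, ‖ξ x‖ ^ 2 ∂(riemannianVolume n M) := by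
  have : IsContinuousRiemannianBundle FE E := by
    obtain ⟨g, hg, hinner⟩ := IsContMDiffRiemannianBundle.exists_contMDiff (IB := 𝓡 n) (n := ∞)
      (F := FE) (E := E)
    exact ⟨g, hg.continuous, hinner⟩
  obtain ⟨T, s₀, K, hs₀⟩ := exists_isGeneratingFamily (n := n) (FE := FE) (E := E)
  let s := fun a x => p x (s₀ a x)
  have hs : IsGeneratingFamily n FE E' T s K := hs₀.map_projection hp
  have hAs (a) : SmoothSection n FF fun x => A x (s a x) := fun x => hA _ x ((hs.mem a).1 x)
  choose r hr hparts using fun a b => hD.exists_integral_eq_integral_mul (hs.mem a) (hAs b)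
  choose R hR using fun a b =>
    isCompact_univ.exists_bound_of_continuousOn (hr a b).continuousOn
  refine ⟨∑ a ∈ T, ∑ b ∈ T, |R a b| * K ^ 2, by positivity, fun ξ hξ => ?_⟩
  obtain ⟨v, hv, hsum, hvK⟩ := hs.exists_coeff ξ hξ
  have hvv (a b) : ContMDiff (𝓡 n) 𝓘(ℝ) ∞ fun x => v a x * v b x := (hv a).mul (hv b)
  have hintegrable (a b) : Integrable (fun x =>
      symbolPairing σ (s a) (fun x => A x (s b x)) x
          (mvfderiv (𝓡 n) (fun x => v a x * v b x) x) / 2 +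
        ⟪D (s a) x, A x (s b x)⟫_ℝ * (v a x * v b x)) (riemannianVolume n M) :=
    integrable_riemannianVolume
      (((hD.contMDiff_symbolPairing (hs.mem a) (hAs b) (hvv a b)).continuous.div_const 2).add
        (((hD.smooth _ (hs.mem a)).inner_bundle (hAs b)).continuous.mul (hvv a b).continuous))
  have hexpand : ∫ x, ⟪D ξ x, A x (ξ x)⟫_ℝ ∂(riemannianVolume n M) =
      ∑ a ∈ T, ∑ b ∈ T, ∫ x, r a b x * (v a x * v b x) ∂(riemannianVolume n M) := by
    simp only [hsum, hD.inner_apply_sum_smul hsymm T hs.mem hv]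
    rw [integral_finsetSum _ fun a _ => integrable_finsetSum _ fun b _ => hintegrable a b]
    refine Finset.sum_congr rfl fun a _ => ?_
    rw [integral_finsetSum _ fun b _ => hintegrable a b]
    exact Finset.sum_congr rfl fun b _ => hparts a b _ (hvv a b)
  simp only [hexpand, Finset.sum_mul]
  refine (Finset.abs_sum_le_sum_abs _ _).trans (Finset.sum_le_sum fun a ha =>
    (Finset.abs_sum_le_sum_abs _ _).trans (Finset.sum_le_sum fun b hb => ?_))
  exact abs_integral_mul_mul_le hξ.1 (hr a b) (hv a).continuous (hv b).continuous
    (fun x => (hR a b x trivial).trans (le_abs_self _)) (hvK a ha) (hvK b hb)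

end CrossTerm

section Concentration

theorem mul_lt_of_add_sq_mul_le {s I X a b C C₀ κ : ℝ} (hs : s ≠ 0) (hκ : 0 < κ) (ha : 0 ≤ a)
    (hX : |X| ≤ C₀) (hI : κ * I ≤ b) (hle : a + 2 * s * X + s ^ 2 * b ≤ C * |s|) :
    I < ((C + 2 * C₀) / κ + 1) / |s| := by
  have hs_pos : 0 < |s| := abs_pos.2 hs
  have hcross : -(2 * s * X) ≤ 2 * C₀ * |s| := by
    refine (neg_le_abs _).trans ?_
    rw [abs_mul, abs_mul, abs_two]
    nlinarith
  have hquadratic : |s| * (|s| * (κ * I)) ≤ |s| * (C + 2 * C₀) := by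
    rw [← mul_assoc, ← sq, sq_abs]
    linarith [mul_le_mul_of_nonneg_left hI (sq_nonneg s)]
  have hlinear : I * |s| ≤ (C + 2 * C₀) / κ := by
    rw [le_div_iff₀ hκ]
    linarith [le_of_mul_le_mul_left hquadratic hs_pos]
  rw [lt_div_iff₀ hs_pos]
  linarith

section FormalAdjoint

variable {n : ℕ} {M : Type*} [EMetricSpace M] [MeasurableSpace M]
  [ChartedSpace (EuclideanSpace ℝ (Fin n)) M] [IsManifold (𝓡 n) ∞ M]
  [RiemannianBundle (fun x : M => TangentSpace (𝓡 n) x)]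
  {E : M → Type*} [∀ x, NormedAddCommGroup (E x)] [∀ x, InnerProductSpace ℝ (E x)]
  {F : M → Type*} [∀ x, NormedAddCommGroup (F x)] [∀ x, InnerProductSpace ℝ (F x)]

theorem FormalAdjointEq.integral_norm_sq_le {Γ : Set (∀ x, E x)} {P : (∀ x, E x) → ∀ x, F x}
    {ξ : ∀ x, E x} {lam : ℝ} (hadj : FormalAdjointEq n Γ P (P ξ) fun x => lam • ξ x)
    (hξ : ξ ∈ Γ) (hnorm : ∫ x, ‖ξ x‖ ^ 2 ∂(riemannianVolume n M) = 1) :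
    ∫ x, ‖P ξ x‖ ^ 2 ∂(riemannianVolume n M) ≤ |lam| := by
  have hself := hadj ξ hξ
  simp only [real_inner_self_eq_norm_sq, real_inner_smul_right, integral_const_mul] at hself
  rw [hself, hnorm, mul_one]
  exact le_abs_self lam

end FormalAdjoint

variable {n : ℕ} {M : Type*} [EMetricSpace M] [CompactSpace M] [MeasurableSpace M] [BorelSpace M]
  [ChartedSpace (EuclideanSpace ℝ (Fin n)) M] [IsManifold (𝓡 n) ∞ M]
  [RiemannianBundle (fun x : M => TangentSpace (𝓡 n) x)]
  [IsContMDiffRiemannianBundle (𝓡 n) ∞ (EuclideanSpace ℝ (Fin n))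
    (fun x : M => TangentSpace (𝓡 n) x)]
  {FE : Type*} [NormedAddCommGroup FE] [NormedSpace ℝ FE] [FiniteDimensional ℝ FE]
  {E : M → Type*} [TopologicalSpace (TotalSpace FE E)]
  [∀ x, NormedAddCommGroup (E x)] [∀ x, InnerProductSpace ℝ (E x)]
  [FiberBundle FE E] [VectorBundle ℝ FE E] [ContMDiffVectorBundle ∞ FE E (𝓡 n)]
  [IsContMDiffRiemannianBundle (𝓡 n) ∞ FE E]
  {FF : Type*} [NormedAddCommGroup FF] [NormedSpace ℝ FF]
  {F : M → Type*} [TopologicalSpace (TotalSpace FF F)]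
  [∀ x, NormedAddCommGroup (F x)] [∀ x, InnerProductSpace ℝ (F x)]
  [FiberBundle FF F] [VectorBundle ℝ FF F] [IsContMDiffRiemannianBundle (𝓡 n) ∞ FF F]
  {E' : ∀ x, Submodule ℝ (E x)} {p : ∀ x, E x →L[ℝ] E x}
  {D : (∀ x, E x) → ∀ x, F x} {σ : ∀ x : M, Cotangent n x →ₗ[ℝ] (E x →L[ℝ] F x)}
  {A : ∀ x, E x →L[ℝ] F x}

theorem IsFirstOrderOperator.concentratesAlong
    (hD : IsFirstOrderOperator FE FF E' D σ) (hp : IsSmoothProjection n FE E' p)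
    (hA : PreservesSmooth n FE FF A)
    (hsymm : ∀ x u, ∀ e ∈ E' x, ∀ e' ∈ E' x, ⟪σ x u e, A x e'⟫_ℝ = ⟪σ x u e', A x e⟫_ℝ)
    {Z : Set M} (hZ : ∀ x ∉ Z, ∀ e ∈ E' x, A x e = 0 → e = 0) :
    ConcentratesAlong n (sectionsIn n FE E') (fun s ξ x => D ξ x + s • A x (ξ x)) Z := by
  intro δ hδ C hC
  obtain ⟨C₀, hC₀, hcross⟩ := hD.exists_abs_integral_inner_le hp hA hsymm
  set K := (Metric.thickening δ Z)ᶜ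
  have hK : IsClosed K := Metric.isOpen_thickening.isClosed_compl
  obtain ⟨κ, hκ, hlower⟩ := exists_pos_forall_mul_norm_sq_le_of_projection hp.preservesSmooth hA
    hK.isCompact fun x hx e he =>
      hZ x (fun hxZ => hx (Metric.self_subset_thickening hδ Z hxZ)) e (he ▸ hp.apply_mem x e)
  refine ⟨(C + 2 * C₀) / κ + 1, by positivity, fun s hs ξ hξ hnorm hlow => ?_⟩
  have hAξ : SmoothSection n FF fun x => A x (ξ x) := fun x => hA _ x (hξ.1 x)
  have hAξ_int := SmoothSection.integrable_norm_sq hAξ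
  have henergy : ∫ x, ‖D ξ x + s • A x (ξ x)‖ ^ 2 ∂(riemannianVolume n M) ≤ C * |s| := by
    rcases hlow with hle | ⟨lam, hlam, hadj⟩
    · exact hle
    · exact (hadj.integral_norm_sq_le hξ hnorm).trans hlam
  rw [SmoothSection.integral_norm_sq_add_smul (hD.smooth ξ hξ) hAξ] at henergy
  have hpotential : κ * ∫ x in K, ‖ξ x‖ ^ 2 ∂(riemannianVolume n M) ≤
      ∫ x, ‖A x (ξ x)‖ ^ 2 ∂(riemannianVolume n M) := by
    rw [← integral_const_mul]
    exact (setIntegral_mono_on ((SmoothSection.integrable_norm_sq hξ.1).const_mul κ).integrableOn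
      hAξ_int.integrableOn hK.measurableSet fun x hx =>
        hlower x hx _ (hp.apply_of_mem x _ (hξ.2 x))).trans
      (setIntegral_le_integral hAξ_int (ae_of_all _ fun x => sq_nonneg _))
  exact mul_lt_of_add_sq_mul_le hs hκ (integral_nonneg fun x => sq_nonneg _)
    (by simpa only [hnorm, mul_one] using hcross ξ hξ) hpotential henergy

end Concentration

/-! ### Dirac operators -/

section DualContraction

variable {n : ℕ} {G H : Type*} [NormedAddCommGroup G] [NormedSpace ℝ G]
  [NormedAddCommGroup H] [NormedSpace ℝ H]

/-- The contraction `∑ᵢ B(eⁱ) (L eᵢ)` of a bilinear map `B` with a linear map `L`, written in the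
standard basis `eᵢ` of `ℝⁿ` and its dual basis `eⁱ`. -/
def dualContraction (B : (EuclideanSpace ℝ (Fin n) →L[ℝ] ℝ) →L[ℝ] (G →L[ℝ] H)) :
    (EuclideanSpace ℝ (Fin n) →L[ℝ] G) →ₗ[ℝ] H where
  toFun L := ∑ i, B (EuclideanSpace.proj i) (L (EuclideanSpace.single i (1 : ℝ)))
  map_add' L L' := by simp [Finset.sum_add_distrib]
  map_smul' a L := by simp [Finset.smul_sum]

theorem dualContraction_smulRight (B : (EuclideanSpace ℝ (Fin n) →L[ℝ] ℝ) →L[ℝ] (G →L[ℝ] H))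
    (φ : EuclideanSpace ℝ (Fin n) →L[ℝ] ℝ) (g : G) :
    dualContraction B (φ.smulRight g) = B φ g := by
  have hφ : φ = ∑ i, φ (EuclideanSpace.single i (1 : ℝ)) •
      (EuclideanSpace.proj i : EuclideanSpace ℝ (Fin n) →L[ℝ] ℝ) := by
    ext v
    simpa [mul_comm] using map_eq_sum_smul_map_single φ.toLinearMap v
  conv_rhs => rw [hφ]
  simp [dualContraction]

theorem dualContraction_eq_sum (B : (EuclideanSpace ℝ (Fin n) →L[ℝ] ℝ) →L[ℝ] (G →L[ℝ] H))
    (L : EuclideanSpace ℝ (Fin n) →L[ℝ] G) {ι : Type*} [Fintype ι]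
    {φ : ι → EuclideanSpace ℝ (Fin n) →L[ℝ] ℝ} {b : ι → EuclideanSpace ℝ (Fin n)}
    (h : ∀ v, ∑ i, φ i v • b i = v) : dualContraction B L = ∑ i, B (φ i) (L (b i)) := by
  have hL : L = ∑ i, (φ i).smulRight (L (b i)) := by
    ext v
    conv_lhs => rw [← h v]
    simp
  conv_lhs => rw [hL]
  simp only [map_sum, dualContraction_smulRight]

end DualContraction

section SmoothBundleMaps

variable {n : ℕ} {M : Type*} [TopologicalSpace M] [ChartedSpace (EuclideanSpace ℝ (Fin n)) M]
  {FE : Type*} [NormedAddCommGroup FE] [NormedSpace ℝ FE]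
  {E : M → Type*} [TopologicalSpace (TotalSpace FE E)]
  [∀ x, NormedAddCommGroup (E x)] [∀ x, InnerProductSpace ℝ (E x)]
  [FiberBundle FE E]
  {FF : Type*} [NormedAddCommGroup FF] [NormedSpace ℝ FF]
  {F : M → Type*} [TopologicalSpace (TotalSpace FF F)]
  [∀ x, NormedAddCommGroup (F x)] [∀ x, InnerProductSpace ℝ (F x)]
  [FiberBundle FF F]
  {FG : Type*} [NormedAddCommGroup FG] [NormedSpace ℝ FG]
  {G : M → Type*} [TopologicalSpace (TotalSpace FG G)]
  [∀ x, NormedAddCommGroup (G x)] [∀ x, InnerProductSpace ℝ (G x)]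
  [FiberBundle FG G]
  {E' : ∀ x, Submodule ℝ (E x)} {D : (∀ x, E x) → ∀ x, F x}

theorem PreservesSmooth.comp {A : ∀ x, E x →L[ℝ] F x} {B : ∀ x, F x →L[ℝ] G x}
    (hB : PreservesSmooth n FF FG B) (hA : PreservesSmooth n FE FF A) :
    PreservesSmooth n FE FG fun x => B x ∘L A x := fun _ x hξ => hB _ x (hA _ x hξ)

theorem IsSmoothProjection.comp {E'' : ∀ x, Submodule ℝ (E x)} {p q : ∀ x, E x →L[ℝ] E x}
    (hp : IsSmoothProjection n FE E' p) (hq : IsSmoothProjection n FE E'' q)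
    (hqE : ∀ x, ∀ e ∈ E' x, q x e ∈ E' x) :
    IsSmoothProjection n FE (fun x => E' x ⊓ E'' x) fun x => q x ∘L p x where
  preservesSmooth := hq.preservesSmooth.comp hp.preservesSmooth
  apply_mem x e := ⟨hqE x _ (hp.apply_mem x e), hq.apply_mem x _⟩
  apply_of_mem x e he := by
    rw [ContinuousLinearMap.comp_apply, hp.apply_of_mem x e he.1, hq.apply_of_mem x e he.2]

theorem IsFirstOrderOperator.clm_comp {σ : ∀ x : M, Cotangent n x →ₗ[ℝ] (E x →L[ℝ] F x)}
    (hD : IsFirstOrderOperator FE FF E' D σ) {q : ∀ x, F x →L[ℝ] G x}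
    (hq : PreservesSmooth n FF FG q) :
    IsFirstOrderOperator FE FG E' (fun ξ x => q x (D ξ x)) fun x =>
      (ContinuousLinearMap.compL ℝ (E x) (F x) (G x) (q x)).toLinearMap ∘ₗ σ x where
  smooth ξ hξ x := hq _ x (hD.smooth ξ hξ x)
  map_add ξ hξ η hη x := by rw [hD.map_add ξ hξ η hη, _root_.map_add]
  leibniz ξ hξ f hf x := by
    rw [hD.leibniz ξ hξ f hf, _root_.map_add, map_smul]
    rfl

variable [VectorBundle ℝ FE E] [VectorBundle ℝ FF F]

theorem IsSmoothHom.preservesSmooth {A : ∀ x, E x →L[ℝ] F x} (hA : IsSmoothHom n FE FF A) :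
    PreservesSmooth n FE FF A := fun _ x hξ => (hA x).clm_bundle_apply (b := fun x => x) hξ

end SmoothBundleMaps

section CoordCovectors

variable {n : ℕ} {M : Type*} [TopologicalSpace M] [ChartedSpace (EuclideanSpace ℝ (Fin n)) M]
  [IsManifold (𝓡 n) ∞ M]

/-- The coframe dual to the coordinate vector fields of the preferred chart at `x₀`. -/
def coordCovector (x₀ : M) (i : Fin n) (p : M) : Cotangent n p :=
  (EuclideanSpace.proj i : EuclideanSpace ℝ (Fin n) →L[ℝ] ℝ) ∘L
    (trivializationAt (EuclideanSpace ℝ (Fin n))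
      (fun x : M => TangentSpace (𝓡 n) x) x₀).continuousLinearMapAt ℝ p

theorem sum_coordCovector_smul {x₀ p : M} (hp : p ∈ (extChartAt (𝓡 n) x₀).source)
    (v : TangentSpace (𝓡 n) p) :
    ∑ i, coordCovector (n := n) x₀ i p v • coordVector (n := n) x₀ i p = v := by
  let e := trivializationAt (EuclideanSpace ℝ (Fin n)) (fun x : M => TangentSpace (𝓡 n) x) x₀
  have hpe : p ∈ e.baseSet := by simpa [e] using hp
  have hcoord (i) : coordVector (n := n) x₀ i p = e.symmL ℝ p (EuclideanSpace.single i (1 : ℝ)) :=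
    by rw [coordVector, ← Trivialization.symmL_apply (R := ℝ) _ hpe]
  simp only [hcoord]
  exact (map_eq_sum_smul_map_single (e.symmL ℝ p).toLinearMap
    (e.continuousLinearMapAt ℝ p v)).symm.trans (e.symmL_continuousLinearMapAt hpe v)

theorem contMDiffAt_coordCovector (x₀ : M) (i : Fin n) :
    ContMDiffAt (𝓡 n) ((𝓡 n).prod 𝓘(ℝ, EuclideanSpace ℝ (Fin n) →L[ℝ] ℝ)) ∞
      (fun p => TotalSpace.mk' (EuclideanSpace ℝ (Fin n) →L[ℝ] ℝ)
        (E := fun x : M => TangentSpace (𝓡 n) x →L[ℝ] Bundle.Trivial M ℝ x) p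
        (coordCovector (n := n) x₀ i p)) x₀ := by
  let e := trivializationAt (EuclideanSpace ℝ (Fin n)) (fun x : M => TangentSpace (𝓡 n) x) x₀
  rw [contMDiffAt_hom_bundle]
  refine ⟨contMDiffAt_id, (contMDiffAt_const
    (c := (EuclideanSpace.proj i : EuclideanSpace ℝ (Fin n) →L[ℝ] ℝ))).congr_of_eventuallyEq ?_⟩
  filter_upwards [e.open_baseSet.mem_nhds (mem_baseSet_trivializationAt _ _ x₀)] with p hp
  ext v
  rw [ContinuousLinearMap.inCoordinates_eq hp (by simp)]
  have happly : e.continuousLinearMapAt ℝ p ((e.continuousLinearEquivAt ℝ p hp).symm v) = v := by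
    rw [← e.coe_continuousLinearEquivAt_eq hp]
    exact (e.continuousLinearEquivAt ℝ p hp).apply_symm_apply v
  exact congrArg (fun w : EuclideanSpace ℝ (Fin n) => w i) happly

end CoordCovectors

section DiracOp

variable {n : ℕ} {M : Type*} [TopologicalSpace M] [ChartedSpace (EuclideanSpace ℝ (Fin n)) M]
  {FE : Type*} [NormedAddCommGroup FE] [NormedSpace ℝ FE]
  {E : M → Type*} [TopologicalSpace (TotalSpace FE E)]
  [∀ x, NormedAddCommGroup (E x)] [∀ x, InnerProductSpace ℝ (E x)]
  [FiberBundle FE E]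
  {FF : Type*} [NormedAddCommGroup FF] [NormedSpace ℝ FF]
  {F : M → Type*} [TopologicalSpace (TotalSpace FF F)]
  [∀ x, NormedAddCommGroup (F x)] [∀ x, InnerProductSpace ℝ (F x)]
  {nabla : CovariantDerivative (𝓡 n) FE E} {σ : ∀ x : M, Cotangent n x →L[ℝ] (E x →L[ℝ] F x)}
  {p : ∀ x, E x →L[ℝ] E x} {ξ η : ∀ x, E x}

theorem diracOp_mem {F' : ∀ x, Submodule ℝ (F x)} {x : M}
    (h : ∀ u e, σ x u (p x e) ∈ F' x) : diracOp nabla σ p ξ x ∈ F' x :=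
  sum_mem fun _ _ => h _ _

theorem diracOp_add (hξ : SmoothSection n FE ξ) (hη : SmoothSection n FE η) (x : M) :
    diracOp nabla σ p (fun y => ξ y + η y) x =
      diracOp nabla σ p ξ x + diracOp nabla σ p η x := by
  have hnabla : p x ∘L nabla (fun y => ξ y + η y) x = p x ∘L nabla ξ x + p x ∘L nabla η x := by
    rw [← ContinuousLinearMap.comp_add]
    exact congrArg _ (nabla.isCovariantDerivativeOnUniv.add
      ((hξ x).mdifferentiableAt (by simp)) ((hη x).mdifferentiableAt (by simp)))
  exact (congrArg (dualContraction (σ x)) hnabla).trans (map_add _ _ _)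

theorem diracOp_smul (hξ : SmoothSection n FE ξ) {f : M → ℝ}
    (hf : ContMDiff (𝓡 n) 𝓘(ℝ) ∞ f) (x : M) :
    diracOp nabla σ p (fun y => f y • ξ y) x =
      σ x (mvfderiv (𝓡 n) f x) (p x (ξ x)) + f x • diracOp nabla σ p ξ x := by
  have hleibniz : nabla (fun y => f y • ξ y) x =
      f x • nabla ξ x + (mvfderiv (𝓡 n) f x).smulRight (ξ x) :=
    nabla.isCovariantDerivativeOnUniv.leibniz ((hξ x).mdifferentiableAt (by simp))
      ((hf x).mdifferentiableAt (by simp))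
  have hnabla : p x ∘L nabla (fun y => f y • ξ y) x =
      (mvfderiv (𝓡 n) f x).smulRight (p x (ξ x)) + f x • (p x ∘L nabla ξ x) := by
    rw [hleibniz, ContinuousLinearMap.comp_add, ContinuousLinearMap.comp_smul, add_comm]
    congr 1
    ext v
    exact (p x).map_smul _ _
  refine (congrArg (dualContraction (σ x)) hnabla).trans ((map_add _ _ _).trans ?_)
  exact congrArg₂ (· + ·) (dualContraction_smulRight (σ x) _ _) (map_smul _ _ _)

variable [IsManifold (𝓡 n) ∞ M]

theorem diracOp_eq_sum_coordVector {x₀ x : M} (hx : x ∈ (extChartAt (𝓡 n) x₀).source) :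
    diracOp nabla σ p ξ x =
      ∑ i, σ x (coordCovector (n := n) x₀ i x) (p x (nabla ξ x (coordVector (n := n) x₀ i x))) :=
  dualContraction_eq_sum (σ x) (p x ∘L nabla ξ x) (φ := fun i => coordCovector x₀ i x)
    (b := fun i => coordVector x₀ i x) (sum_coordCovector_smul hx)

variable [VectorBundle ℝ FE E] [FiberBundle FF F] [VectorBundle ℝ FF F]
  [CovariantDerivative.ContMDiffCovariantDerivative nabla ∞]

theorem IsSmoothSymbol.smoothSection_diracOp (hσ : IsSmoothSymbol FE FF σ)
    (hp : PreservesSmooth n FE FE p) (hξ : SmoothSection n FE ξ) :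
    SmoothSection n FF (diracOp nabla σ p ξ) := by
  intro x₀
  have hnabla : ContMDiff (𝓡 n) ((𝓡 n).prod 𝓘(ℝ, EuclideanSpace ℝ (Fin n) →L[ℝ] FE)) ∞
      (fun x => TotalSpace.mk' (EuclideanSpace ℝ (Fin n) →L[ℝ] FE)
        (E := fun x => TangentSpace (𝓡 n) x →L[ℝ] E x) x (nabla ξ x)) :=
    contMDiffOn_univ.1 ((CovariantDerivative.ContMDiffCovariantDerivative.contMDiff
      (cov := nabla) (k := ∞)).contMDiff (contMDiffOn_univ.2 hξ))
  have hchart : (extChartAt (𝓡 n) x₀).source ∈ nhds x₀ := extChartAt_source_mem_nhds x₀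
  have hsum : SmoothSectionAt n FF (fun x => ∑ i, σ x (coordCovector (n := n) x₀ i x)
      (p x (nabla ξ x (coordVector (n := n) x₀ i x)))) x₀ := by
    refine ContMDiffAt.sum_section fun i _ => ?_
    have hσi := (hσ x₀).clm_bundle_apply (b := fun x => x) (contMDiffAt_coordCovector (n := n) x₀ i)
    have hnablai := (hnabla x₀).clm_bundle_apply (b := fun x => x)
      ((contMDiffOn_coordVector (n := n) x₀ i).contMDiffAt hchart)
    exact hσi.clm_bundle_apply (b := fun x => x) (hp _ x₀ hnablai)
  refine hsum.congr_of_eventuallyEq ?_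
  filter_upwards [hchart] with x hx
  rw [diracOp_eq_sum_coordVector hx]

theorem IsSmoothSymbol.isFirstOrderOperator_diracOp (hσ : IsSmoothSymbol FE FF σ)
    {E' : ∀ x, Submodule ℝ (E x)} (hp : IsSmoothProjection n FE E' p) :
    IsFirstOrderOperator FE FF E' (diracOp nabla σ p) fun x => (σ x).toLinearMap where
  smooth _ hξ := hσ.smoothSection_diracOp hp.preservesSmooth hξ.1
  map_add _ hξ _ hη := diracOp_add hξ.1 hη.1
  leibniz ξ hξ f hf x := by
    rw [diracOp_smul hξ.1 hf, hp.apply_of_mem x _ (hξ.2 x)]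
    rfl

end DiracOp

/-! ### Restriction by involutions -/

section ConcentratingPairs

variable {n : ℕ} {M : Type*} [TopologicalSpace M] [ChartedSpace (EuclideanSpace ℝ (Fin n)) M]
  {E F : M → Type*} [∀ x, NormedAddCommGroup (E x)] [∀ x, InnerProductSpace ℝ (E x)]
  [∀ x, FiniteDimensional ℝ (E x)]
  [∀ x, NormedAddCommGroup (F x)] [∀ x, InnerProductSpace ℝ (F x)]
  [∀ x, FiniteDimensional ℝ (F x)]

theorem isConcentratingPair_iff {σ : ∀ x : M, Cotangent n x → (E x →ₗ[ℝ] F x)}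
    {A : ∀ x : M, E x →ₗ[ℝ] F x} : IsConcentratingPair σ A ↔
      ∀ x u e e', ⟪σ x u e, A x e'⟫_ℝ = ⟪σ x u e', A x e⟫_ℝ := by
  refine forall_congr' fun x => forall_congr' fun u => ?_
  rw [LinearMap.ext_iff]
  refine forall_congr' fun e => ?_
  rw [ext_iff_inner_right ℝ]
  refine forall_congr' fun e' => ?_
  simp only [LinearMap.comp_apply, LinearMap.adjoint_inner_left]
  rw [real_inner_comm (σ x u e') (A x e)]

end ConcentratingPairs

section ConcentratingRestrictions

variable {n : ℕ} {M : Type*} [EMetricSpace M] [CompactSpace M] [MeasurableSpace M] [BorelSpace M]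
  [ChartedSpace (EuclideanSpace ℝ (Fin n)) M] [IsManifold (𝓡 n) ∞ M]
  [RiemannianBundle (fun x : M => TangentSpace (𝓡 n) x)]
  [IsContMDiffRiemannianBundle (𝓡 n) ∞ (EuclideanSpace ℝ (Fin n))
    (fun x : M => TangentSpace (𝓡 n) x)]
  {FE : Type*} [NormedAddCommGroup FE] [NormedSpace ℝ FE] [FiniteDimensional ℝ FE]
  {E : M → Type*} [TopologicalSpace (TotalSpace FE E)]
  [∀ x, NormedAddCommGroup (E x)] [∀ x, InnerProductSpace ℝ (E x)]
  [∀ x, FiniteDimensional ℝ (E x)]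
  [FiberBundle FE E] [VectorBundle ℝ FE E] [ContMDiffVectorBundle ∞ FE E (𝓡 n)]
  [IsContMDiffRiemannianBundle (𝓡 n) ∞ FE E]
  {FF : Type*} [NormedAddCommGroup FF] [NormedSpace ℝ FF]
  {F : M → Type*} [TopologicalSpace (TotalSpace FF F)]
  [∀ x, NormedAddCommGroup (F x)] [∀ x, InnerProductSpace ℝ (F x)]
  [∀ x, FiniteDimensional ℝ (F x)]
  [FiberBundle FF F] [VectorBundle ℝ FF F] [IsContMDiffRiemannianBundle (𝓡 n) ∞ FF F]

theorem IsFirstOrderOperator.isConcentratingRestriction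
    {E' : ∀ x, Submodule ℝ (E x)} {F' : ∀ x, Submodule ℝ (F x)}
    {D : (∀ x, E x) → ∀ x, F x} {σ : ∀ x : M, Cotangent n x →ₗ[ℝ] (E x →L[ℝ] F x)}
    {p : ∀ x, E x →L[ℝ] E x} {A : ∀ x, E x →L[ℝ] F x}
    (hD : IsFirstOrderOperator FE FF E' D σ) (hp : IsSmoothProjection n FE E' p)
    (hDF : ∀ ξ ∈ sectionsIn n FE E', ∀ x, D ξ x ∈ F' x)
    (hσF : ∀ x u, ∀ e ∈ E' x, σ x u e ∈ F' x)
    (hA : PreservesSmooth n FE FF A) (hAF : ∀ x, ∀ e ∈ E' x, A x e ∈ F' x)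
    (hsymm : ∀ x u, ∀ e ∈ E' x, ∀ e' ∈ E' x, ⟪σ x u e, A x e'⟫_ℝ = ⟪σ x u e', A x e⟫_ℝ) :
    IsConcentratingRestriction FE FF E' F' D (fun x u => σ x u) A := by
  refine ⟨hσF, hAF, fun ξ hξ => ⟨hD.smooth ξ hξ, hDF ξ hξ⟩, hD.leibniz,
    isConcentratingPair_iff.2 fun x u e e' => hsymm x u e e.2 e' e'.2,
    hD.concentratesAlong hp hA hsymm fun x hx e he hAe => ?_⟩
  have hker : LinearMap.ker ((A x : E x →ₗ[ℝ] F x).restrict (hAF x)) = ⊥ := not_not.1 hx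
  exact congrArg Subtype.val (LinearMap.ker_eq_bot'.1 hker ⟨e, he⟩ (Subtype.ext hAe))

end ConcentratingRestrictions

section Eigenbundles

variable {M : Type*} {E : M → Type*} [∀ x, NormedAddCommGroup (E x)]
  [∀ x, InnerProductSpace ℝ (E x)] {τ T : ∀ x, E x →L[ℝ] E x} {ε δ : ℝ} {x : M}

theorem mem_eigenbundle {e : E x} : e ∈ eigenbundle τ ε x ↔ τ x e = ε • e :=
  Module.End.mem_eigenspace_iff

theorem eigenproj_apply (e : E x) : eigenproj τ ε x e = (1 / 2 : ℝ) • (e + ε • τ x e) := rfl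

theorem eigenproj_mem (hτ : ∀ e, τ x (τ x e) = e) (hε : ε * ε = 1) (e : E x) :
    eigenproj τ ε x e ∈ eigenbundle τ ε x := by
  have hετ : ε • ε • τ x e = τ x e := by rw [smul_smul, hε, one_smul]
  rw [mem_eigenbundle, eigenproj_apply, map_smul, map_add, map_smul, hτ, smul_comm ε (1 / 2 : ℝ),
    smul_add ε, hετ, add_comm]

theorem eigenproj_apply_of_mem (hε : ε * ε = 1) {e : E x} (he : e ∈ eigenbundle τ ε x) :
    eigenproj τ ε x e = e := by
  rw [eigenproj_apply, mem_eigenbundle.1 he, smul_smul, hε]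
  module

theorem inner_eigenproj_left (hτ : ∀ e, τ x (τ x e) = e)
    (hi : ∀ e e', ⟪τ x e, τ x e'⟫_ℝ = ⟪e, e'⟫_ℝ) (e e' : E x) :
    ⟪eigenproj τ ε x e, e'⟫_ℝ = ⟪e, eigenproj τ ε x e'⟫_ℝ := by
  have hself : ⟪τ x e, e'⟫_ℝ = ⟪e, τ x e'⟫_ℝ := by rw [← hi, hτ]
  simp only [eigenproj_apply, real_inner_smul_left, real_inner_smul_right, inner_add_left,
    inner_add_right, hself]

theorem inner_eigenproj_right_of_mem (hτ : ∀ e, τ x (τ x e) = e)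
    (hi : ∀ e e', ⟪τ x e, τ x e'⟫_ℝ = ⟪e, e'⟫_ℝ) (hε : ε * ε = 1) {e : E x}
    (he : e ∈ eigenbundle τ ε x) (e' : E x) : ⟪e, eigenproj τ ε x e'⟫_ℝ = ⟪e, e'⟫_ℝ := by
  rw [← inner_eigenproj_left hτ hi, eigenproj_apply_of_mem hε he]

theorem eigenproj_mem_of_comm (hτT : ∀ e, τ x (T x e) = T x (τ x e)) {e : E x}
    (he : e ∈ eigenbundle τ ε x) : eigenproj T δ x e ∈ eigenbundle τ ε x := by
  rw [mem_eigenbundle] at he ⊢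
  rw [eigenproj_apply, map_smul, map_add, map_smul, hτT, he, map_smul]
  module

variable {F : M → Type*} [∀ x, NormedAddCommGroup (F x)] [∀ x, InnerProductSpace ℝ (F x)]
  {τ' : ∀ x, F x →L[ℝ] F x}

theorem clm_apply_mem_eigenbundle (hε : ε * ε = 1) {L : E x →L[ℝ] F x}
    (hL : ∀ e, L (τ x e) = ε • τ' x (L e)) {e : E x} (he : e ∈ eigenbundle τ 1 x) :
    L e ∈ eigenbundle τ' ε x := by
  have hLe : L e = ε • τ' x (L e) := by rw [← hL, mem_eigenbundle.1 he, one_smul]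
  rw [mem_eigenbundle]
  conv_rhs => rw [hLe, smul_smul, hε, one_smul]

theorem clm_bijOn_eigenbundle (hε : ε * ε = 1) {L : E x →L[ℝ] F x}
    (hL : ∀ e, L (τ x e) = ε • τ' x (L e)) (hbij : Function.Bijective L) :
    Set.BijOn L (eigenbundle τ 1 x) (eigenbundle τ' ε x) := by
  refine ⟨fun e he => clm_apply_mem_eigenbundle hε hL he, hbij.1.injOn, fun f hf => ?_⟩
  obtain ⟨e, rfl⟩ := hbij.2 f
  refine ⟨e, mem_eigenbundle.2 (hbij.1 ?_), rfl⟩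
  rw [hL, mem_eigenbundle.1 hf, smul_smul, hε, one_smul, one_smul]

end Eigenbundles

section SmoothInvolutions

variable {n : ℕ} {M : Type*} [TopologicalSpace M] [ChartedSpace (EuclideanSpace ℝ (Fin n)) M]
  {FE : Type*} [NormedAddCommGroup FE] [NormedSpace ℝ FE]
  {E : M → Type*} [TopologicalSpace (TotalSpace FE E)]
  [∀ x, NormedAddCommGroup (E x)] [∀ x, InnerProductSpace ℝ (E x)]
  [FiberBundle FE E] {τ : ∀ x, E x →L[ℝ] E x}

theorem diracOp_eigenproj {F : M → Type*} [∀ x, NormedAddCommGroup (F x)]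
    [∀ x, InnerProductSpace ℝ (F x)] {nabla : CovariantDerivative (𝓡 n) FE E}
    {σ : ∀ x : M, Cotangent n x →L[ℝ] (E x →L[ℝ] F x)} (hτ : IsParallel nabla τ) {ξ : ∀ x, E x}
    (hξ : ξ ∈ sectionsIn n FE (eigenbundle τ 1)) :
    diracOp nabla σ (eigenproj τ 1) ξ =
      diracOp nabla σ (fun x => ContinuousLinearMap.id ℝ (E x)) ξ := by
  have hfixed : (fun y => τ y (ξ y)) = ξ := by
    ext y
    rw [mem_eigenbundle.1 (hξ.2 y), one_smul]
  ext x
  refine Finset.sum_congr rfl fun i _ => congrArg _ (eigenproj_apply_of_mem (mul_one 1) ?_)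
  have hparallel := hτ ξ hξ.1 x (EuclideanSpace.single i (1 : ℝ))
  rw [hfixed] at hparallel
  exact mem_eigenbundle.2 (hparallel.symm.trans (one_smul ℝ _).symm)

variable [VectorBundle ℝ FE E]

theorem PreservesSmooth.eigenproj (hτ : PreservesSmooth n FE FE τ) (ε : ℝ) :
    PreservesSmooth n FE FE (eigenproj τ ε) := fun ξ x hξ =>
  ContMDiffAt.const_smul_section (a := (1 / 2 : ℝ))
    (hξ.add_section (ContMDiffAt.const_smul_section (a := ε) (hτ ξ x hξ)))

theorem IsMetricInvolution.isSmoothProjection_eigenproj (hτ : IsMetricInvolution n FE τ) {ε : ℝ}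
    (hε : ε * ε = 1) : IsSmoothProjection n FE (eigenbundle τ ε) (eigenproj τ ε) where
  preservesSmooth := hτ.smooth.preservesSmooth.eigenproj ε
  apply_mem x := eigenproj_mem (hτ.involutive x) hε
  apply_of_mem _ _ := eigenproj_apply_of_mem hε

end SmoothInvolutions

section InvolutionRestrictions

variable {n : ℕ} {M : Type*} [EMetricSpace M] [CompactSpace M] [MeasurableSpace M] [BorelSpace M]
  [ChartedSpace (EuclideanSpace ℝ (Fin n)) M] [IsManifold (𝓡 n) ∞ M]
  [RiemannianBundle (fun x : M => TangentSpace (𝓡 n) x)]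
  [IsContMDiffRiemannianBundle (𝓡 n) ∞ (EuclideanSpace ℝ (Fin n))
    (fun x : M => TangentSpace (𝓡 n) x)]
  {FE : Type*} [NormedAddCommGroup FE] [NormedSpace ℝ FE] [FiniteDimensional ℝ FE]
  {E : M → Type*} [TopologicalSpace (TotalSpace FE E)]
  [∀ x, NormedAddCommGroup (E x)] [∀ x, InnerProductSpace ℝ (E x)]
  [∀ x, FiniteDimensional ℝ (E x)]
  [FiberBundle FE E] [VectorBundle ℝ FE E] [ContMDiffVectorBundle ∞ FE E (𝓡 n)]
  [IsContMDiffRiemannianBundle (𝓡 n) ∞ FE E]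
  {FF : Type*} [NormedAddCommGroup FF] [NormedSpace ℝ FF]
  {F : M → Type*} [TopologicalSpace (TotalSpace FF F)]
  [∀ x, NormedAddCommGroup (F x)] [∀ x, InnerProductSpace ℝ (F x)]
  [∀ x, FiniteDimensional ℝ (F x)]
  [FiberBundle FF F] [VectorBundle ℝ FF F] [IsContMDiffRiemannianBundle (𝓡 n) ∞ FF F]
  {nabla : CovariantDerivative (𝓡 n) FE E}
  [CovariantDerivative.ContMDiffCovariantDerivative nabla ∞]
  {σ : ∀ x : M, Cotangent n x →L[ℝ] (E x →L[ℝ] F x)} {A : ∀ x, E x →L[ℝ] F x}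
  {τ T : ∀ x : M, E x →L[ℝ] E x} {τ' T' : ∀ x : M, F x →L[ℝ] F x} {ε : ℝ}

theorem IsSmoothSymbol.isConcentratingRestriction_eigenbundle (hσ : IsSmoothSymbol FE FF σ)
    (hA : IsSmoothHom n FE FF A) (hε : ε * ε = 1)
    (hτ : IsMetricInvolution n FE τ) (hτ' : IsMetricInvolution n FF τ')
    (hστ : ∀ x u e, σ x u (τ x e) = ε • τ' x (σ x u e))
    (hsymm : ∀ x u e e', ⟪σ x u e, A x e'⟫_ℝ = ⟪σ x u e', A x e⟫_ℝ) :
    IsConcentratingRestriction FE FF (eigenbundle τ 1) (eigenbundle τ' ε)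
      (diracOp nabla σ (eigenproj τ 1)) (fun x u => σ x u)
      (fun x => eigenproj τ' ε x ∘L A x) := by
  have hp := hτ.isSmoothProjection_eigenproj (mul_one 1)
  have hq := hτ'.isSmoothProjection_eigenproj hε
  have hσF : ∀ x u, ∀ e ∈ eigenbundle τ 1 x, σ x u e ∈ eigenbundle τ' ε x := fun x u _ he =>
    clm_apply_mem_eigenbundle hε (hστ x u) he
  refine (hσ.isFirstOrderOperator_diracOp hp).isConcentratingRestriction hp
    (fun ξ _ x => diracOp_mem fun u e => hσF x u _ (hp.apply_mem x e)) hσF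
    (hq.preservesSmooth.comp hA.preservesSmooth) (fun x _ _ => hq.apply_mem x _)
    fun x u e he e' he' => ?_
  have hpairing : ∀ e ∈ eigenbundle τ 1 x, ∀ e',
      ⟪σ x u e, eigenproj τ' ε x (A x e')⟫_ℝ = ⟪σ x u e, A x e'⟫_ℝ := fun e he e' =>
    inner_eigenproj_right_of_mem (hτ'.involutive x) (hτ'.isometry x) hε (hσF x u e he) _
  exact (hpairing e he e').trans ((hsymm x u e e').trans (hpairing e' he' e).symm)

theorem IsSmoothSymbol.isConcentratingRestriction_inf_eigenbundle (hσ : IsSmoothSymbol FE FF σ)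
    (hA : IsSmoothHom n FE FF A) (hε : ε * ε = 1)
    (hτ : IsMetricInvolution n FE τ) (hτ' : IsMetricInvolution n FF τ')
    (hT : IsMetricInvolution n FE T) (hT' : IsMetricInvolution n FF T')
    (hτT : ∀ x e, τ x (T x e) = T x (τ x e)) (hτT' : ∀ x e, τ' x (T' x e) = T' x (τ' x e))
    (hστ : ∀ x u e, σ x u (τ x e) = ε • τ' x (σ x u e))
    (hAτ : ∀ x, ∀ e ∈ eigenbundle τ 1 x, A x e ∈ eigenbundle τ' ε x)
    (hsymm : ∀ x u e e', ⟪σ x u e, A x e'⟫_ℝ = ⟪σ x u e', A x e⟫_ℝ)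
    (hsymmT : ∀ x u, ∀ e ∈ eigenbundle τ 1 x ⊓ eigenbundle T 1 x,
      ∀ e' ∈ eigenbundle τ 1 x ⊓ eigenbundle T 1 x,
      ⟪T' x (σ x u e), A x e'⟫_ℝ = ⟪T' x (σ x u e'), A x e⟫_ℝ) :
    IsConcentratingRestriction FE FF
      (fun x => eigenbundle τ 1 x ⊓ eigenbundle T 1 x)
      (fun x => eigenbundle τ' ε x ⊓ eigenbundle T' 1 x)
      (fun ξ x => eigenproj T' 1 x
        (diracOp nabla σ (fun x => eigenproj T 1 x ∘L eigenproj τ 1 x) ξ x))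
      (fun x u => eigenproj T' 1 x ∘L σ x u)
      (fun x => eigenproj T' 1 x ∘L eigenproj τ' ε x ∘L A x) := by
  have hp := (hτ.isSmoothProjection_eigenproj (mul_one 1)).comp
    (hT.isSmoothProjection_eigenproj (mul_one 1)) fun x _ he => eigenproj_mem_of_comm (hτT x) he
  have hqτ := hτ'.isSmoothProjection_eigenproj hε
  have hqT := hT'.isSmoothProjection_eigenproj (mul_one 1)
  have hq := hqτ.comp hqT fun x _ hf => eigenproj_mem_of_comm (hτT' x) hf
  have hσF : ∀ x u, ∀ e ∈ eigenbundle τ 1 x, σ x u e ∈ eigenbundle τ' ε x := fun x u _ he =>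
    clm_apply_mem_eigenbundle hε (hστ x u) he
  have hDF : ∀ ξ x, diracOp nabla σ (fun x => eigenproj T 1 x ∘L eigenproj τ 1 x) ξ x ∈
      eigenbundle τ' ε x := fun ξ x => diracOp_mem fun u e => hσF x u _ (hp.apply_mem x e).1
  refine ((hσ.isFirstOrderOperator_diracOp hp).clm_comp hqT.preservesSmooth
    ).isConcentratingRestriction hp
    (fun ξ _ x => ⟨eigenproj_mem_of_comm (hτT' x) (hDF ξ x), hqT.apply_mem x _⟩)
    (fun x u e he => ⟨eigenproj_mem_of_comm (hτT' x) (hσF x u e he.1), hqT.apply_mem x _⟩)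
    (hq.preservesSmooth.comp hA.preservesSmooth) (fun x _ _ => hq.apply_mem x _)
    fun x u e he e' he' => ?_
  have hpairing : ∀ e, ∀ e' ∈ eigenbundle τ 1 x,
      ⟪eigenproj T' 1 x (σ x u e), eigenproj T' 1 x (eigenproj τ' ε x (A x e'))⟫_ℝ =
        (1 / 2 : ℝ) * (⟪σ x u e, A x e'⟫_ℝ + ⟪T' x (σ x u e), A x e'⟫_ℝ) := fun e e' he' => by
    rw [inner_eigenproj_right_of_mem (hT'.involutive x) (hT'.isometry x) (mul_one 1)
      (hqT.apply_mem x _), hqτ.apply_of_mem x _ (hAτ x e' he'), eigenproj_apply, one_smul,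
      real_inner_smul_left, inner_add_left]
  refine (hpairing e e' he'.1).trans (Eq.trans ?_ (hpairing e' e he.1).symm)
  rw [hsymm x u e e', hsymmT x u e he e' he']

end InvolutionRestrictions

/-! ### Clifford algebra on forms and spinors -/

section Signs

variable {n : ℕ} {S S' R R' : Finset (Fin n)}

theorem shuffleSign_eq_prod (S R : Finset (Fin n)) :
    shuffleSign S R = ∏ a ∈ S, ∏ b ∈ R, if b < a then (-1 : ℂ) else 1 := by
  rw [shuffleSign, ← Finset.prod_product', Finset.prod_ite, Finset.prod_const,
    Finset.prod_const_one, mul_one]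

theorem shuffleSign_mul_self (S R : Finset (Fin n)) : shuffleSign S R * shuffleSign S R = 1 := by
  rw [shuffleSign, ← mul_pow, neg_one_mul, neg_neg, one_pow]

theorem norm_shuffleSign (S R : Finset (Fin n)) : ‖shuffleSign S R‖ = 1 := by
  simp [shuffleSign]

theorem shuffleSign_union_left (h : Disjoint S S') (R : Finset (Fin n)) :
    shuffleSign (S ∪ S') R = shuffleSign S R * shuffleSign S' R := by
  simp only [shuffleSign_eq_prod, Finset.prod_union h]

theorem shuffleSign_union_right (S : Finset (Fin n)) (h : Disjoint R R') :
    shuffleSign S (R ∪ R') = shuffleSign S R * shuffleSign S R' := by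
  simp only [shuffleSign_eq_prod, Finset.prod_union h, Finset.prod_mul_distrib]

theorem shuffleSign_insert_left {a : Fin n} (h : a ∉ S) (R : Finset (Fin n)) :
    shuffleSign (insert a S) R = shuffleSign {a} R * shuffleSign S R := by
  rw [Finset.insert_eq, shuffleSign_union_left (Finset.disjoint_singleton_left.2 h)]

theorem shuffleSign_insert_right {b : Fin n} (S : Finset (Fin n)) (h : b ∉ R) :
    shuffleSign S (insert b R) = shuffleSign S {b} * shuffleSign S R := by
  rw [Finset.insert_eq, shuffleSign_union_right S (Finset.disjoint_singleton_left.2 h)]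

theorem shuffleSign_singleton_of_gt {a b : Fin n} (h : b < a) : shuffleSign {a} {b} = -1 := by
  simp [shuffleSign_eq_prod, h]

theorem shuffleSign_singleton_eq_one {a : Fin n} (h : ∀ b ∈ R, a < b) :
    shuffleSign {a} R = 1 := by
  rw [shuffleSign_eq_prod, Finset.prod_singleton]
  exact Finset.prod_eq_one fun b hb => if_neg (h b hb).not_gt

theorem shuffleSign_mul_swap (h : Disjoint S R) :
    shuffleSign S R * shuffleSign R S = (-1) ^ (S.card * R.card) := by
  have hfactor : ∀ a ∈ S, ∀ b ∈ R,
      (if b < a then (-1 : ℂ) else 1) * (if a < b then (-1 : ℂ) else 1) = -1 := fun a ha b hb => by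
    rcases lt_trichotomy a b with hab | rfl | hab
    · rw [if_neg hab.not_gt, if_pos hab, one_mul]
    · exact absurd hb (Finset.disjoint_left.1 h ha)
    · rw [if_pos hab, if_neg hab.not_gt, mul_one]
  calc shuffleSign S R * shuffleSign R S
      = ∏ a ∈ S, ∏ b ∈ R, (if b < a then (-1 : ℂ) else 1) * (if a < b then (-1 : ℂ) else 1) := by
        rw [shuffleSign_eq_prod, shuffleSign_eq_prod R S, Finset.prod_comm (s := R)]
        simp only [Finset.prod_mul_distrib]
    _ = ∏ a ∈ S, ∏ b ∈ R, (-1 : ℂ) :=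
        Finset.prod_congr rfl fun a ha => Finset.prod_congr rfl (hfactor a ha)
    _ = (-1) ^ (S.card * R.card) := by
        rw [Finset.prod_const, Finset.prod_const, ← pow_mul, mul_comm]

end Signs

namespace CliffordAction

variable {n : ℕ} {W : Type*} [NormedAddCommGroup W] [InnerProductSpace ℂ W]
  (κ : CliffordAction n W) {j k : Fin n} {S R : Finset (Fin n)}

/-- Clifford multiplication by the basis vector `e_j`, as an element of the algebra `End W`. -/
def gen (j : Fin n) : Module.End ℂ W := κ.c (EuclideanSpace.single j (1 : ℝ))

theorem c_eq_sum (v : EuclideanSpace ℝ (Fin n)) (φ : W) :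
    κ.c v φ = ∑ j, (v j : ℂ) • κ.gen j φ := by
  rw [map_eq_sum_smul_map_single κ.c v, LinearMap.sum_apply]
  rfl

theorem gen_mul_self (j : Fin n) : κ.gen j * κ.gen j = -1 := by
  ext φ
  have hclifford := κ.clifford (EuclideanSpace.single j (1 : ℝ)) (EuclideanSpace.single j (1 : ℝ)) φ
  have htwice : (2 : ℂ) • κ.gen j (κ.gen j φ) = (2 : ℂ) • -φ := by
    rw [two_smul]
    refine hclifford.trans ?_
    simp
  exact smul_right_injective W (two_ne_zero (α := ℂ)) htwice

theorem gen_mul_gen (hjk : j ≠ k) : κ.gen j * κ.gen k = -(κ.gen k * κ.gen j) := by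
  ext φ
  refine eq_neg_of_add_eq_zero_left
    ((κ.clifford (EuclideanSpace.single j (1 : ℝ)) (EuclideanSpace.single k (1 : ℝ)) φ).trans ?_)
  simp [EuclideanSpace.inner_single_left, hjk]

theorem inner_gen (j : Fin n) (φ φ' : W) : ⟪κ.gen j φ, κ.gen j φ'⟫_ℂ = ⟪φ, φ'⟫_ℂ := by
  have hsq : κ.gen j (κ.gen j φ') = -φ' := DFunLike.congr_fun (κ.gen_mul_self j) φ'
  calc ⟪κ.gen j φ, κ.gen j φ'⟫_ℂ = -⟪φ, κ.gen j (κ.gen j φ')⟫_ℂ := κ.skew _ φ (κ.gen j φ')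
    _ = ⟪φ, φ'⟫_ℂ := by rw [hsq, inner_neg_right, neg_neg]

theorem basisForm_empty : κ.basisForm ∅ = (1 : Module.End ℂ W) := by
  simp [basisForm]

theorem basisForm_insert_of_lt (h : ∀ k ∈ S, j < k) :
    κ.basisForm (insert j S) = κ.gen j * κ.basisForm S := by
  have hj : j ∉ S := fun hj => (h j hj).ne rfl
  rw [basisForm, Finset.sort_insert (· ≤ ·) (fun k hk => (h k hk).le) hj, List.map_cons,
    List.prod_cons]
  rfl

theorem inner_basisForm (S : Finset (Fin n)) (φ φ' : W) :
    ⟪κ.basisForm S φ, κ.basisForm S φ'⟫_ℂ = ⟪φ, φ'⟫_ℂ := by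
  induction S using Finset.induction_on_min generalizing φ φ' with
  | empty => rw [basisForm_empty]; rfl
  | insert a S ha ih =>
    rw [basisForm_insert_of_lt κ ha]
    exact (κ.inner_gen a _ _).trans (ih _ _)

theorem gen_mul_basisForm (hj : j ∉ S) :
    κ.gen j * κ.basisForm S = shuffleSign {j} S • κ.basisForm (insert j S) := by
  induction S using Finset.induction_on_min with
  | empty =>
    rw [κ.basisForm_insert_of_lt (by simp), shuffleSign_singleton_eq_one (by simp), one_smul]
  | insert a S ha ih =>
    rw [Finset.mem_insert, not_or] at hj
    have haS : a ∉ S := fun h => (ha a h).ne rfl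
    rcases lt_or_gt_of_ne hj.1 with hja | hja
    · have hmin : ∀ b ∈ insert a S, j < b := fun b hb => by
        rcases Finset.mem_insert.1 hb with rfl | hb
        exacts [hja, hja.trans (ha b hb)]
      rw [κ.basisForm_insert_of_lt hmin, shuffleSign_singleton_eq_one hmin, one_smul]
    · have hmin : ∀ b ∈ insert j S, a < b := fun b hb => by
        rcases Finset.mem_insert.1 hb with rfl | hb
        exacts [hja, ha b hb]
      rw [Finset.insert_comm, κ.basisForm_insert_of_lt hmin, κ.basisForm_insert_of_lt ha,
        shuffleSign_insert_right _ haS, shuffleSign_singleton_of_gt hja, ← mul_assoc,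
        κ.gen_mul_gen hj.1, neg_mul, mul_assoc, ih hj.2, mul_smul_comm, neg_one_mul, neg_smul]

theorem gen_mul_basisForm_insert (hj : j ∉ S) :
    κ.gen j * κ.basisForm (insert j S) = -shuffleSign {j} S • κ.basisForm S := by
  have hinsert : κ.basisForm (insert j S) = shuffleSign {j} S • (κ.gen j * κ.basisForm S) := by
    rw [κ.gen_mul_basisForm hj, smul_smul, shuffleSign_mul_self, one_smul]
  rw [hinsert, mul_smul_comm, ← mul_assoc, gen_mul_self, neg_one_mul, smul_neg, neg_smul]

theorem basisForm_mul_basisForm (h : Disjoint S R) :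
    κ.basisForm S * κ.basisForm R = shuffleSign S R • κ.basisForm (S ∪ R) := by
  induction S using Finset.induction_on_min with
  | empty => simp [basisForm_empty, shuffleSign]
  | insert a S ha ih =>
    rw [Finset.disjoint_insert_left] at h
    have haS : a ∉ S := fun h => (ha a h).ne rfl
    have haSR : a ∉ S ∪ R := by simp [haS, h.1]
    rw [κ.basisForm_insert_of_lt ha, mul_assoc, ih h.2, mul_smul_comm, κ.gen_mul_basisForm haSR,
      smul_smul, Finset.insert_union, shuffleSign_union_right _ h.2,
      shuffleSign_singleton_eq_one ha, one_mul, shuffleSign_insert_left haS, mul_comm]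

theorem gen_mul_basisForm_comm (j : Fin n) (S : Finset (Fin n)) :
    κ.gen j * κ.basisForm S =
      ((-1 : ℂ) ^ S.card * if j ∈ S then -1 else 1) • (κ.basisForm S * κ.gen j) := by
  induction S using Finset.induction_on_min with
  | empty => simp [basisForm_empty]
  | insert a S ha ih =>
    have haS : a ∉ S := fun h => (ha a h).ne rfl
    rw [κ.basisForm_insert_of_lt ha, Finset.card_insert_of_notMem haS, pow_succ]
    rcases eq_or_ne j a with rfl | hja
    · rw [if_neg haS, mul_one] at ih
      rw [mul_assoc (κ.gen j) (κ.basisForm S), ih, if_pos (Finset.mem_insert_self _ _), mul_assoc,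
        neg_one_mul, neg_neg, mul_one, mul_smul_comm]
    · rw [← mul_assoc, κ.gen_mul_gen hja, neg_mul, mul_assoc, ih, mul_smul_comm, mul_assoc,
        ← neg_smul]
      simp only [Finset.mem_insert, hja, false_or]
      congr 1
      ring

theorem basisForm_mul_self (S : Finset (Fin n)) :
    κ.basisForm S * κ.basisForm S = ((-1 : ℂ) ^ (S.card + 1).choose 2) • (1 : Module.End ℂ W) := by
  induction S using Finset.induction_on_min with
  | empty => simp [basisForm_empty]
  | insert a S ha ih =>
    have haS : a ∉ S := fun h => (ha a h).ne rfl
    have hcomm := κ.gen_mul_basisForm_comm a S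
    rw [if_neg haS, mul_one] at hcomm
    rw [κ.basisForm_insert_of_lt ha, Finset.card_insert_of_notMem haS]
    calc κ.gen a * κ.basisForm S * (κ.gen a * κ.basisForm S)
        = (-1 : ℂ) ^ S.card • (κ.basisForm S * (κ.gen a * κ.gen a) * κ.basisForm S) := by
          conv_lhs => enter [1]; rw [hcomm]
          simp only [smul_mul_assoc, mul_assoc]
      _ = (-1 : ℂ) ^ (S.card + 1) • (κ.basisForm S * κ.basisForm S) := by
          rw [gen_mul_self, mul_neg_one, neg_mul, smul_neg, ← neg_smul, pow_succ, mul_neg_one]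
      _ = (-1 : ℂ) ^ (S.card + 1 + 1).choose 2 • 1 := by
          rw [ih, smul_smul, ← pow_add, Nat.choose_succ_succ' (S.card + 1) 1, Nat.choose_one_right]

end CliffordAction

section Forms

variable {n k : ℕ}

theorem formParity_apply (α : Form n) (S : Finset (Fin n)) :
    formParity n α S = (-1) ^ (S.card + 1) * α S := rfl

theorem extMul_apply (v : EuclideanSpace ℝ (Fin n)) (α : Form n) (S : Finset (Fin n)) :
    extMul v α S = ∑ j ∈ S, shuffleSign {j} (S.erase j) * (v j : ℂ) * α (S.erase j) := rfl

theorem intMul_apply (v : EuclideanSpace ℝ (Fin n)) (α : Form n) (S : Finset (Fin n)) :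
    intMul v α S = ∑ j ∈ Sᶜ, shuffleSign {j} S * (v j : ℂ) * α (insert j S) := rfl

theorem formClifford_eq_sub (v : EuclideanSpace ℝ (Fin n)) (α : Form n) :
    formClifford v α = extMul v α - intMul v α := rfl

theorem hodgeStar_apply (α : Form n) (S : Finset (Fin n)) :
    hodgeStar n α S = shuffleSign Sᶜ S * α Sᶜ := rfl

theorem extMul_formParity (v : EuclideanSpace ℝ (Fin n)) (α : Form n) :
    extMul v (formParity n α) = -formParity n (extMul v α) := by
  ext S
  rw [PiLp.neg_apply, formParity_apply, extMul_apply, extMul_apply, Finset.mul_sum,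
    ← Finset.sum_neg_distrib]
  refine Finset.sum_congr rfl fun j hj => ?_
  rw [formParity_apply, Finset.card_erase_add_one hj, pow_succ]
  ring

theorem intMul_formParity (v : EuclideanSpace ℝ (Fin n)) (α : Form n) :
    intMul v (formParity n α) = -formParity n (intMul v α) := by
  ext S
  rw [PiLp.neg_apply, formParity_apply, intMul_apply, intMul_apply, Finset.mul_sum,
    ← Finset.sum_neg_distrib]
  refine Finset.sum_congr rfl fun j hj => ?_
  rw [formParity_apply, Finset.card_insert_of_notMem (Finset.mem_compl.1 hj),
    pow_succ _ (S.card + 1)]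
  ring

theorem formClifford_formParity (v : EuclideanSpace ℝ (Fin n)) (α : Form n) :
    formClifford v (formParity n α) = -formParity n (formClifford v α) := by
  rw [formClifford_eq_sub, formClifford_eq_sub, extMul_formParity, intMul_formParity, map_sub,
    neg_sub_neg, neg_sub]

theorem inner_eq_of_signedPerm {f : Form n → Form n} {a : Finset (Fin n) → ℂ}
    {r : Finset (Fin n) → Finset (Fin n)} (ha : ∀ S, ‖a S‖ = 1) (hr : Function.Bijective r)
    (hf : ∀ α S, f α S = a S * α (r S)) (α β : Form n) : ⟪f α, f β⟫_ℂ = ⟪α, β⟫_ℂ := by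
  simp only [PiLp.inner_apply, hf]
  refine Eq.trans (Finset.sum_congr rfl fun S _ => ?_) (hr.sum_comp fun S => ⟪α S, β S⟫_ℂ)
  have hunit : a S * (starRingEnd ℂ) (a S) = 1 := by
    rw [Complex.mul_conj, Complex.normSq_eq_norm_sq, ha, one_pow, Complex.ofReal_one]
  simp only [RCLike.inner_apply, map_mul]
  linear_combination (β (r S) * (starRingEnd ℂ) (α (r S))) * hunit

theorem formParity_formParity (α : Form n) : formParity n (formParity n α) = α := by
  ext S
  rw [formParity_apply, formParity_apply, ← mul_assoc, ← mul_pow, neg_one_mul, neg_neg, one_pow,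
    one_mul]

theorem inner_formParity (α β : Form n) : ⟪formParity n α, formParity n β⟫_ℂ = ⟪α, β⟫_ℂ :=
  inner_eq_of_signedPerm (a := fun S => (-1) ^ (S.card + 1)) (r := id) (by simp)
    Function.bijective_id (fun _ _ => rfl) α β

theorem inner_formParity_left (α β : Form n) : ⟪formParity n α, β⟫_ℂ = ⟪α, formParity n β⟫_ℂ := by
  rw [← inner_formParity, formParity_formParity]

/-- The sign of `formSelfDuality` at the index set `S`: it is `1` below the middle degree `k`, the
sign of the Hodge star in degree `k`, and `-1` above. -/
def selfDualitySign (k : ℕ) (S : Finset (Fin n)) : ℂ :=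
  if S.card < k then 1 else if S.card = k then shuffleSign Sᶜ S else -1

/-- The permutation of the index sets underlying `formSelfDuality`: complementation in the middle
degree `k`, the identity in all other degrees. -/
def selfDualityPerm (k : ℕ) (S : Finset (Fin n)) : Finset (Fin n) :=
  if S.card = k then Sᶜ else S

theorem formSelfDuality_apply (k : ℕ) (α : Form n) (S : Finset (Fin n)) :
    formSelfDuality n k α S = selfDualitySign k S * α (selfDualityPerm k S) := by
  change (if S.card < k then α S else if S.card = k then hodgeStar n α S else -α S) = _
  rw [selfDualitySign, selfDualityPerm, hodgeStar_apply]
  by_cases hmiddle : S.card = k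
  · simp [hmiddle]
  · simp only [hmiddle, if_false]
    split_ifs <;> simp

theorem card_compl_of_eq (hn : n = 2 * k) {S : Finset (Fin n)} (hS : S.card = k) :
    Sᶜ.card = k := by
  rw [Finset.card_compl, Fintype.card_fin]
  omega

theorem selfDualityPerm_involutive (hn : n = 2 * k) :
    Function.Involutive (selfDualityPerm (n := n) k) := by
  intro S
  by_cases hS : S.card = k
  · rw [selfDualityPerm, selfDualityPerm, if_pos hS, if_pos (card_compl_of_eq hn hS), compl_compl]
  · rw [selfDualityPerm, selfDualityPerm, if_neg hS, if_neg hS]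

theorem card_selfDualityPerm (hn : n = 2 * k) (S : Finset (Fin n)) :
    (selfDualityPerm k S).card = S.card := by
  rw [selfDualityPerm]
  split_ifs with hS
  · rw [card_compl_of_eq hn hS, hS]
  · rfl

theorem norm_selfDualitySign (k : ℕ) (S : Finset (Fin n)) : ‖selfDualitySign k S‖ = 1 := by
  rw [selfDualitySign]
  split_ifs <;> simp [norm_shuffleSign]

theorem formSelfDuality_involutive (hn : n = 2 * k) (hk : Even k) (α : Form n) :
    formSelfDuality n k (formSelfDuality n k α) = α := by
  ext S
  rw [formSelfDuality_apply, formSelfDuality_apply, selfDualityPerm_involutive hn, ← mul_assoc]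
  suffices hsign : selfDualitySign k S * selfDualitySign k (selfDualityPerm k S) = 1 by
    rw [hsign, one_mul]
  by_cases hS : S.card = k
  · have hSc := card_compl_of_eq hn hS
    simp only [selfDualitySign, selfDualityPerm, hS, hSc, if_true, lt_irrefl, if_false,
      compl_compl]
    rw [shuffleSign_mul_swap disjoint_compl_left, hS, hSc, (hk.mul_right k).neg_one_pow]
  · simp only [selfDualitySign, selfDualityPerm, hS, if_false]
    split_ifs <;> simp

theorem inner_formSelfDuality (hn : n = 2 * k) (α β : Form n) :
    ⟪formSelfDuality n k α, formSelfDuality n k β⟫_ℂ = ⟪α, β⟫_ℂ :=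
  inner_eq_of_signedPerm (norm_selfDualitySign k) (selfDualityPerm_involutive hn).bijective
    (formSelfDuality_apply k) α β

theorem formParity_formSelfDuality (hn : n = 2 * k) (α : Form n) :
    formParity n (formSelfDuality n k α) = formSelfDuality n k (formParity n α) := by
  ext S
  rw [formParity_apply, formSelfDuality_apply, formSelfDuality_apply, formParity_apply,
    card_selfDualityPerm hn, mul_left_comm]

end Forms

theorem sum_sum_mem_eq_sum_sum_compl {ι G : Type*} [Fintype ι] [DecidableEq ι] [AddCommMonoid G]
    (f : ι → Finset ι → G) :
    ∑ S, ∑ j ∈ S, f j S = ∑ S : Finset ι, ∑ j ∈ Sᶜ, f j (insert j S) := by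
  simp only [Finset.sum_sigma']
  refine Finset.sum_bij' (fun x _ => ⟨x.1.erase x.2, x.2⟩) (fun x _ => ⟨insert x.2 x.1, x.2⟩)
    (by simp) (by simp) ?_ ?_ ?_
  · rintro ⟨S, j⟩ h
    rw [Finset.insert_erase (Finset.mem_sigma.1 h).2]
  · rintro ⟨S, j⟩ h
    rw [Finset.erase_insert (Finset.mem_compl.1 (Finset.mem_sigma.1 h).2)]
  · rintro ⟨S, j⟩ h
    rw [Finset.insert_erase (Finset.mem_sigma.1 h).2]

theorem neg_one_pow_choose_two (l : ℕ) : (-1 : ℂ) ^ (2 * l + 1).choose 2 = (-1) ^ l := by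
  rw [Nat.choose_two_right, Nat.add_sub_cancel, mul_comm, mul_assoc,
    Nat.mul_div_cancel_left _ two_pos, mul_comm l, pow_mul, Odd.neg_one_pow ⟨l, rfl⟩]

namespace CliffordAction

variable {n : ℕ} {W : Type*} [NormedAddCommGroup W] [InnerProductSpace ℂ W]
  (κ : CliffordAction n W)

theorem formToSpinor_apply (ψ : W) (α : Form n) :
    κ.formToSpinor ψ α = ∑ S, α S • κ.basisForm S ψ := rfl

theorem formToSpinor_extMul (ψ : W) (v : EuclideanSpace ℝ (Fin n)) (α : Form n) :
    κ.formToSpinor ψ (extMul v α) =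
      ∑ S, ∑ j ∈ Sᶜ, (α S * (v j : ℂ)) • κ.gen j (κ.basisForm S ψ) := by
  simp only [formToSpinor_apply, extMul_apply, Finset.sum_smul]
  rw [sum_sum_mem_eq_sum_sum_compl fun j S =>
    (shuffleSign {j} (S.erase j) * (v j : ℂ) * α (S.erase j)) • κ.basisForm S ψ]
  refine Finset.sum_congr rfl fun S _ => Finset.sum_congr rfl fun j hj => ?_
  have hmul : κ.gen j (κ.basisForm S ψ) = shuffleSign {j} S • κ.basisForm (insert j S) ψ :=
    DFunLike.congr_fun (κ.gen_mul_basisForm (Finset.mem_compl.1 hj)) ψ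
  rw [Finset.erase_insert (Finset.mem_compl.1 hj), hmul, smul_smul]
  congr 1
  ring

theorem formToSpinor_intMul (ψ : W) (v : EuclideanSpace ℝ (Fin n)) (α : Form n) :
    κ.formToSpinor ψ (intMul v α) =
      -∑ S, ∑ j ∈ S, (α S * (v j : ℂ)) • κ.gen j (κ.basisForm S ψ) := by
  simp only [formToSpinor_apply, intMul_apply, Finset.sum_smul]
  rw [sum_sum_mem_eq_sum_sum_compl fun j S => (α S * (v j : ℂ)) • κ.gen j (κ.basisForm S ψ)]
  simp only [← Finset.sum_neg_distrib]
  refine Finset.sum_congr rfl fun S _ => Finset.sum_congr rfl fun j hj => ?_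
  have hmul : κ.gen j (κ.basisForm (insert j S) ψ) = -shuffleSign {j} S • κ.basisForm S ψ :=
    DFunLike.congr_fun (κ.gen_mul_basisForm_insert (Finset.mem_compl.1 hj)) ψ
  rw [hmul, smul_smul, ← neg_smul]
  congr 1
  ring

theorem c_formToSpinor (ψ : W) (v : EuclideanSpace ℝ (Fin n)) (α : Form n) :
    κ.c v (κ.formToSpinor ψ α) = κ.formToSpinor ψ (formClifford v α) := by
  rw [formClifford_eq_sub, map_sub, formToSpinor_extMul, formToSpinor_intMul, sub_neg_eq_add,
    ← Finset.sum_add_distrib, formToSpinor_apply, map_sum]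
  refine Finset.sum_congr rfl fun S _ => ?_
  rw [Finset.sum_compl_add_sum, map_smul, c_eq_sum, Finset.smul_sum]
  simp only [smul_smul]

theorem basisForm_basisForm {l : ℕ} {S : Finset (Fin n)} (hS : S.card = 2 * l) (φ : W) :
    κ.basisForm S (κ.basisForm S φ) = (-1 : ℂ) ^ l • φ := by
  rw [← Module.End.mul_apply, basisForm_mul_self, hS, neg_one_pow_choose_two]
  rfl

section EvenDimension

variable {m : ℕ}

theorem chirality_gen (hn : n = 2 * m) (j : Fin n) (φ : W) :
    κ.chirality m (κ.gen j φ) = -κ.gen j (κ.chirality m φ) := by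
  have hanticomm : κ.gen j (κ.basisForm Finset.univ φ) = -κ.basisForm Finset.univ (κ.gen j φ) := by
    refine (DFunLike.congr_fun (κ.gen_mul_basisForm_comm j Finset.univ) φ).trans ?_
    simp [hn]
  rw [chirality, LinearMap.smul_apply, LinearMap.smul_apply, map_smul, hanticomm, smul_neg,
    neg_neg]

theorem chirality_c (hn : n = 2 * m) (v : EuclideanSpace ℝ (Fin n)) (φ : W) :
    κ.chirality m (κ.c v φ) = -κ.c v (κ.chirality m φ) := by
  rw [c_eq_sum, c_eq_sum, map_sum, ← Finset.sum_neg_distrib]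
  refine Finset.sum_congr rfl fun j _ => ?_
  rw [map_smul, κ.chirality_gen hn, smul_neg]

theorem chirality_basisForm (hn : n = 2 * m) (S : Finset (Fin n)) (φ : W) :
    κ.chirality m (κ.basisForm S φ) = (-1 : ℂ) ^ S.card • κ.basisForm S (κ.chirality m φ) := by
  induction S using Finset.induction_on_min with
  | empty => rw [basisForm_empty, Finset.card_empty, pow_zero, one_smul]; rfl
  | insert a S ha ih =>
    have haS : a ∉ S := fun h => (ha a h).ne rfl
    rw [κ.basisForm_insert_of_lt ha, Module.End.mul_apply, κ.chirality_gen hn, ih, map_smul,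
      Finset.card_insert_of_notMem haS, pow_succ, mul_neg_one, neg_smul]
    rfl

theorem chirality_chirality (hn : n = 2 * m) (φ : W) : κ.chirality m (κ.chirality m φ) = φ := by
  have hcard : (Finset.univ : Finset (Fin n)).card = 2 * m := by
    rw [Finset.card_univ, Fintype.card_fin, hn]
  rw [chirality, LinearMap.smul_apply, LinearMap.smul_apply, map_smul,
    κ.basisForm_basisForm hcard, smul_smul, smul_smul, ← mul_pow, ← mul_pow, Complex.I_mul_I,
    neg_one_mul, neg_neg, one_pow, one_smul]

theorem inner_chirality (φ φ' : W) : ⟪κ.chirality m φ, κ.chirality m φ'⟫_ℂ = ⟪φ, φ'⟫_ℂ := by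
  rw [chirality, LinearMap.smul_apply, LinearMap.smul_apply, inner_smul_left, inner_smul_right,
    inner_basisForm, ← mul_assoc, map_pow, ← mul_pow, Complex.conj_I, neg_mul, Complex.I_mul_I,
    neg_neg, one_pow, one_mul]

theorem inner_chirality_left (hn : n = 2 * m) (φ φ' : W) :
    ⟪κ.chirality m φ, φ'⟫_ℂ = ⟪φ, κ.chirality m φ'⟫_ℂ := by
  rw [← κ.inner_chirality (m := m), κ.chirality_chirality hn]

theorem formToSpinor_formParity (hn : n = 2 * m) {ψ : W} (hψ : κ.chirality m ψ = ψ) (α : Form n) :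
    κ.formToSpinor ψ (formParity n α) = -κ.chirality m (κ.formToSpinor ψ α) := by
  rw [formToSpinor_apply, formToSpinor_apply, map_sum, ← Finset.sum_neg_distrib]
  refine Finset.sum_congr rfl fun S _ => ?_
  rw [map_smul, κ.chirality_basisForm hn, hψ, formParity_apply, smul_smul, ← neg_smul, pow_succ]
  congr 1
  ring

theorem basisForm_compl (hm : Even m) {ψ : W} (hψ : κ.chirality m ψ = ψ)
    {S : Finset (Fin n)} (hS : S.card = m) :
    shuffleSign S Sᶜ • κ.basisForm Sᶜ ψ = κ.basisForm S ψ := by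
  obtain ⟨l, rfl⟩ := hm.exists_two_nsmul
  have hvolume : (-1 : ℂ) ^ l • κ.basisForm Finset.univ ψ = ψ := by
    rw [← Complex.I_sq, ← pow_mul]
    exact hψ
  have hsplit : κ.basisForm S (κ.basisForm Sᶜ ψ) =
      shuffleSign S Sᶜ • κ.basisForm Finset.univ ψ := by
    rw [← Finset.union_compl S]
    exact DFunLike.congr_fun (κ.basisForm_mul_basisForm disjoint_compl_right) ψ
  calc shuffleSign S Sᶜ • κ.basisForm Sᶜ ψ
      = (-1 : ℂ) ^ l • shuffleSign S Sᶜ • κ.basisForm S (κ.basisForm S (κ.basisForm Sᶜ ψ)) := by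
        rw [κ.basisForm_basisForm hS, smul_comm (shuffleSign S Sᶜ), smul_smul, ← mul_pow,
          neg_one_mul, neg_neg, one_pow, one_smul]
    _ = (-1 : ℂ) ^ l • κ.basisForm S (κ.basisForm Finset.univ ψ) := by
        rw [hsplit, map_smul, smul_smul (shuffleSign S Sᶜ), shuffleSign_mul_self, one_smul]
    _ = κ.basisForm S ψ := by rw [← map_smul, hvolume]

end EvenDimension

end CliffordAction

section FormDegrees

variable {n k : ℕ} {α : Form n} {S : Finset (Fin n)}

theorem formSelfDuality_apply_of_lt (hS : k < S.card) : formSelfDuality n k α S = -α S := by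
  rw [formSelfDuality_apply, selfDualitySign, selfDualityPerm, if_neg hS.not_gt, if_neg hS.ne',
    if_neg hS.ne', neg_one_mul]

theorem apply_eq_zero_of_formSelfDuality_eq (hα : formSelfDuality n k α = α) (hS : k < S.card) :
    α S = 0 := by
  have hneg : -α S = α S := by rw [← formSelfDuality_apply_of_lt hS, hα]
  exact neg_eq_self.1 hneg

theorem apply_eq_zero_of_formParity_eq (hα : formParity n α = α) (hS : Even S.card) :
    α S = 0 := by
  have hneg : -α S = α S := by
    rw [← neg_one_mul, ← hS.add_one.neg_one_pow, ← formParity_apply, hα]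
  exact neg_eq_self.1 hneg

theorem formClifford_apply_eq_zero (hα : ∀ R : Finset (Fin n), k ≤ R.card → α R = 0)
    (v : EuclideanSpace ℝ (Fin n)) (hS : k < S.card) : formClifford v α S = 0 := by
  rw [formClifford_eq_sub, PiLp.sub_apply, extMul_apply, intMul_apply, Finset.sum_eq_zero,
    Finset.sum_eq_zero, sub_zero]
  · intro j _
    rw [hα _ (hS.le.trans (Finset.card_le_card (Finset.subset_insert j S))), mul_zero]
  · intro j hj
    rw [hα _ (by rw [Finset.card_erase_of_mem hj]; omega), mul_zero]

end FormDegrees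

section PairSelfDuality

variable {n m : ℕ} {W : Type*} [NormedAddCommGroup W] [InnerProductSpace ℂ W]

theorem pairSelfDuality_pairSelfDuality (hn : n = 2 * m) (hm : Even m)
    (w : WithLp 2 (W × Form n)) : pairSelfDuality m (pairSelfDuality m w) = w :=
  congrArg (WithLp.toLp 2) (Prod.ext rfl (formSelfDuality_involutive hn hm _))

theorem inner_pairSelfDuality (hn : n = 2 * m) (w w' : WithLp 2 (W × Form n)) :
    ⟪pairSelfDuality m w, pairSelfDuality m w'⟫_ℂ = ⟪w, w'⟫_ℂ := by
  simp only [pairSelfDuality, WithLp.prod_inner_apply, inner_formSelfDuality hn]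
  rfl

end PairSelfDuality

namespace CliffordAction

variable {n : ℕ} {W : Type*} [NormedAddCommGroup W] [InnerProductSpace ℂ W]
  (κ : CliffordAction n W) {m : ℕ}

theorem pairParity_pairParity (hn : n = 2 * m) (w : WithLp 2 (W × Form n)) :
    κ.pairParity m (κ.pairParity m w) = w :=
  congrArg (WithLp.toLp 2) (Prod.ext (κ.chirality_chirality hn _) (formParity_formParity _))

theorem inner_pairParity (w w' : WithLp 2 (W × Form n)) :
    ⟪κ.pairParity m w, κ.pairParity m w'⟫_ℂ = ⟪w, w'⟫_ℂ := by
  simp only [pairParity, WithLp.prod_inner_apply, inner_chirality, inner_formParity]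
  rfl

theorem pairSymbol_pairParity (hn : n = 2 * m) (v : EuclideanSpace ℝ (Fin n))
    (w : WithLp 2 (W × Form n)) :
    κ.pairSymbol v (κ.pairParity m w) = -κ.pairParity m (κ.pairSymbol v w) :=
  congrArg (WithLp.toLp 2) (Prod.ext (neg_eq_iff_eq_neg.1 (κ.chirality_c hn v _).symm)
    (formClifford_formParity v _))

theorem pairParity_pairSelfDuality (hn : n = 2 * m) (w : WithLp 2 (W × Form n)) :
    κ.pairParity m (pairSelfDuality m w) = pairSelfDuality m (κ.pairParity m w) :=
  congrArg (WithLp.toLp 2) (Prod.ext rfl (formParity_formSelfDuality hn _))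

theorem formToSpinor_formSelfDuality (hn : n = 2 * m) (hm : Even m) {ψ : W}
    (hψ : κ.chirality m ψ = ψ) {α : Form n} (hα : ∀ S : Finset (Fin n), m < S.card → α S = 0) :
    κ.formToSpinor ψ (formSelfDuality n m α) = κ.formToSpinor ψ α := by
  rw [formToSpinor_apply, formToSpinor_apply,
    ← (selfDualityPerm_involutive hn).bijective.sum_comp]
  refine Finset.sum_congr rfl fun S _ => ?_
  rw [formSelfDuality_apply, selfDualityPerm_involutive hn]
  rcases lt_trichotomy S.card m with hS | hS | hS
  · simp only [selfDualitySign, selfDualityPerm, hS, hS.ne, if_true, if_false, one_mul]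
  · have hSc := card_compl_of_eq hn hS
    simp only [selfDualitySign, selfDualityPerm, hS, hSc, lt_irrefl, if_false, if_true,
      compl_compl]
    rw [← κ.basisForm_compl hm hψ hS, smul_smul, mul_comm]
  · rw [hα S hS, mul_zero, zero_smul, zero_smul]

variable [FiniteDimensional ℂ W]

theorem adjoint_formToSpinor_chirality (hn : n = 2 * m) {ψ : W} (hψ : κ.chirality m ψ = ψ)
    (φ : W) : LinearMap.adjoint (κ.formToSpinor ψ) (κ.chirality m φ) =
      -formParity n (LinearMap.adjoint (κ.formToSpinor ψ) φ) := by
  refine ext_inner_right ℂ fun α => ?_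
  rw [LinearMap.adjoint_inner_left, inner_chirality_left _ hn, inner_neg_left,
    inner_formParity_left, LinearMap.adjoint_inner_left, κ.formToSpinor_formParity hn hψ,
    inner_neg_right, neg_neg]

theorem pairPerturbation_pairParity (hn : n = 2 * m) {ψ : W} (hψ : κ.chirality m ψ = ψ)
    (w : WithLp 2 (W × Form n)) :
    κ.pairPerturbation ψ (κ.pairParity m w) = -κ.pairParity m (κ.pairPerturbation ψ w) :=
  congrArg (WithLp.toLp 2) (Prod.ext (κ.formToSpinor_formParity hn hψ _)
    (congrArg Neg.neg ((κ.adjoint_formToSpinor_chirality hn hψ _).trans (map_neg _ _).symm)))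

theorem inner_pairSymbol_pairPerturbation (ψ : W) (v : EuclideanSpace ℝ (Fin n))
    (w w' : WithLp 2 (W × Form n)) :
    ⟪κ.pairSymbol v w, κ.pairPerturbation ψ w'⟫_ℂ =
      ⟪κ.c v w.fst, κ.formToSpinor ψ w'.snd⟫_ℂ + ⟪κ.formToSpinor ψ w.snd, κ.c v w'.fst⟫_ℂ := by
  simp only [pairSymbol, pairPerturbation, WithLp.prod_inner_apply, inner_neg_right,
    LinearMap.adjoint_inner_right]
  rw [← c_formToSpinor, κ.skew v (κ.formToSpinor ψ w.snd), neg_neg]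

theorem re_inner_pairSymbol_pairPerturbation_symm (ψ : W) (v : EuclideanSpace ℝ (Fin n))
    (w w' : WithLp 2 (W × Form n)) :
    (⟪κ.pairSymbol v w, κ.pairPerturbation ψ w'⟫_ℂ).re =
      (⟪κ.pairSymbol v w', κ.pairPerturbation ψ w⟫_ℂ).re := by
  rw [inner_pairSymbol_pairPerturbation, inner_pairSymbol_pairPerturbation, Complex.add_re,
    Complex.add_re, add_comm]
  exact congrArg₂ _ (inner_re_symm (𝕜 := ℂ) _ _) (inner_re_symm (𝕜 := ℂ) _ _)

theorem inner_pairSelfDuality_pairSymbol (hn : n = 2 * m) (hm : Even m) {ψ : W}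
    (hψ : κ.chirality m ψ = ψ) (v : EuclideanSpace ℝ (Fin n)) {w : WithLp 2 (W × Form n)}
    (hw : κ.pairParity m w = w) (hTw : pairSelfDuality m w = w) (w' : WithLp 2 (W × Form n)) :
    ⟪pairSelfDuality m (κ.pairSymbol v w), κ.pairPerturbation ψ w'⟫_ℂ =
      ⟪κ.pairSymbol v w, κ.pairPerturbation ψ w'⟫_ℂ := by
  have hdegree : ∀ S : Finset (Fin n), m ≤ S.card → w.snd S = 0 := fun S hS => by
    rcases hS.eq_or_lt with rfl | hlt
    · exact apply_eq_zero_of_formParity_eq (congrArg WithLp.snd hw) hm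
    · exact apply_eq_zero_of_formSelfDuality_eq (congrArg WithLp.snd hTw) hlt
  have hselfDuality := κ.formToSpinor_formSelfDuality hn hm hψ
    fun S hS => formClifford_apply_eq_zero hdegree v hS
  simp only [pairSymbol, pairSelfDuality, pairPerturbation, WithLp.prod_inner_apply,
    inner_neg_right, LinearMap.adjoint_inner_right]
  exact congrArg (fun φ => _ + -⟪φ, _⟫_ℂ) hselfDuality

end CliffordAction

theorem real_inner_eq_re_inner_map {V U : Type*} [NormedAddCommGroup V] [InnerProductSpace ℝ V]
    [NormedAddCommGroup U] [InnerProductSpace ℂ U] [Module ℝ U] (f : V ≃ₗᵢ[ℝ] U) (e e' : V) :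
    ⟪e, e'⟫_ℝ = (⟪f e, f e'⟫_ℂ).re := by
  refine (re_inner_eq_norm_add_mul_self_sub_norm_sub_mul_self_div_four (𝕜 := ℝ) _ _).trans ?_
  rw [← f.norm_map (e + e'), ← f.norm_map (e - e'), f.map_add, f.map_sub]
  exact (re_inner_eq_norm_add_mul_self_sub_norm_sub_mul_self_div_four (𝕜 := ℂ) _ _).symm

section ConjugatedInvolutions

variable {n : ℕ} {M : Type*} {FE : Type*} [NormedAddCommGroup FE] [NormedSpace ℝ FE]
  {E : M → Type*} [∀ x, NormedAddCommGroup (E x)] [∀ x, InnerProductSpace ℝ (E x)]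
  {W : M → Type*} [∀ x, NormedAddCommGroup (W x)] [∀ x, InnerProductSpace ℂ (W x)]
  {κ : ∀ x, CliffordAction n (W x)} {f : ∀ x, E x ≃ₗᵢ[ℝ] WithLp 2 (W x × Form n)} {m : ℕ}
  {τ T : ∀ x : M, E x →L[ℝ] E x}

theorem comm_of_conj_pairParity_pairSelfDuality (hn : n = 2 * m)
    (hτ : ∀ x e, f x (τ x e) = (κ x).pairParity m (f x e))
    (hT : ∀ x e, f x (T x e) = pairSelfDuality m (f x e)) (x : M) (e : E x) :
    τ x (T x e) = T x (τ x e) :=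
  (f x).injective <| by rw [hτ, hT, hT, hτ, (κ x).pairParity_pairSelfDuality hn]

variable [TopologicalSpace M] [ChartedSpace (EuclideanSpace ℝ (Fin n)) M]
  [TopologicalSpace (TotalSpace FE E)] [FiberBundle FE E] [VectorBundle ℝ FE E]

theorem isMetricInvolution_of_conj {U : M → Type*} [∀ x, NormedAddCommGroup (U x)]
    [∀ x, InnerProductSpace ℂ (U x)] [∀ x, Module ℝ (U x)] {f : ∀ x, E x ≃ₗᵢ[ℝ] U x}
    {t : ∀ x, U x → U x} (hτ : IsSmoothHom n FE FE τ) (hf : ∀ x e, f x (τ x e) = t x (f x e))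
    (ht : ∀ x w, t x (t x w) = w) (hinner : ∀ x w w', ⟪t x w, t x w'⟫_ℂ = ⟪w, w'⟫_ℂ) :
    IsMetricInvolution n FE τ where
  smooth := hτ
  involutive x e := (f x).injective (by rw [hf, hf, ht])
  isometry x e e' := by
    rw [real_inner_eq_re_inner_map (f x), real_inner_eq_re_inner_map (f x), hf, hf, hinner]

theorem isMetricInvolution_of_conj_pairParity (hn : n = 2 * m) (hsmooth : IsSmoothHom n FE FE τ)
    (hτ : ∀ x e, f x (τ x e) = (κ x).pairParity m (f x e)) : IsMetricInvolution n FE τ :=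
  isMetricInvolution_of_conj hsmooth hτ (fun x => (κ x).pairParity_pairParity hn)
    fun x => (κ x).inner_pairParity

theorem isMetricInvolution_of_conj_pairSelfDuality (hn : n = 2 * m) (hm : Even m)
    (hsmooth : IsSmoothHom n FE FE T) (hT : ∀ x e, f x (T x e) = pairSelfDuality m (f x e)) :
    IsMetricInvolution n FE T :=
  isMetricInvolution_of_conj hsmooth hT (fun _ => pairSelfDuality_pairSelfDuality hn hm)
    fun _ => inner_pairSelfDuality hn

end ConjugatedInvolutions

namespace SpinorFormBundle

variable {n : ℕ} {M : Type*} [TopologicalSpace M] [ChartedSpace (EuclideanSpace ℝ (Fin n)) M]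
  [RiemannianBundle (fun x : M => TangentSpace (𝓡 n) x)] {E F : M → Type*}
  [∀ x, NormedAddCommGroup (E x)] [∀ x, InnerProductSpace ℝ (E x)]
  [∀ x, NormedAddCommGroup (F x)] [∀ x, InnerProductSpace ℝ (F x)]
  {σ : ∀ x : M, Cotangent n x → (E x →L[ℝ] F x)} {A : ∀ x : M, E x →L[ℝ] F x}
  {W : M → Type*} [∀ x, NormedAddCommGroup (W x)] [∀ x, InnerProductSpace ℂ (W x)]
  [∀ x, FiniteDimensional ℂ (W x)]

theorem inner_symbol_perturbation_symm (S : SpinorFormBundle E F σ A W) (x : M)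
    (u : Cotangent n x) (e e' : E x) : ⟪σ x u e, A x e'⟫_ℝ = ⟪σ x u e', A x e⟫_ℝ := by
  rw [real_inner_eq_re_inner_map (S.isoF x), real_inner_eq_re_inner_map (S.isoF x), S.symbol_eq,
    S.symbol_eq, S.perturbation_eq, S.perturbation_eq]
  exact (S.action x).re_inner_pairSymbol_pairPerturbation_symm _ _ _ _

variable (S : SpinorFormBundle E F σ A W) {m : ℕ}
  {τ T : ∀ x : M, E x →L[ℝ] E x} {τ' T' : ∀ x : M, F x →L[ℝ] F x}

theorem symbol_parity (hn : n = 2 * m)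
    (hτ : ∀ x e, S.isoE x (τ x e) = (S.action x).pairParity m (S.isoE x e))
    (hτ' : ∀ x e, S.isoF x (τ' x e) = (S.action x).pairParity m (S.isoF x e))
    (x : M) (u : Cotangent n x) (e : E x) : σ x u (τ x e) = (-1 : ℝ) • τ' x (σ x u e) := by
  refine (S.isoF x).injective ?_
  rw [neg_one_smul, map_neg, S.symbol_eq, hτ, hτ', S.symbol_eq,
    (S.action x).pairSymbol_pairParity hn]

theorem perturbation_parity (hn : n = 2 * m)
    (hψ : ∀ x, (S.action x).chirality m (S.spinor x) = S.spinor x)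
    (hτ : ∀ x e, S.isoE x (τ x e) = (S.action x).pairParity m (S.isoE x e))
    (hτ' : ∀ x e, S.isoF x (τ' x e) = (S.action x).pairParity m (S.isoF x e))
    (x : M) (e : E x) : A x (τ x e) = (-1 : ℝ) • τ' x (A x e) := by
  refine (S.isoF x).injective ?_
  rw [neg_one_smul, map_neg, S.perturbation_eq, hτ, hτ', S.perturbation_eq,
    (S.action x).pairPerturbation_pairParity hn (hψ x)]

theorem perturbation_mem_eigenbundle (hn : n = 2 * m)
    (hψ : ∀ x, (S.action x).chirality m (S.spinor x) = S.spinor x)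
    (hτ : ∀ x e, S.isoE x (τ x e) = (S.action x).pairParity m (S.isoE x e))
    (hτ' : ∀ x e, S.isoF x (τ' x e) = (S.action x).pairParity m (S.isoF x e))
    (x : M) {e : E x} (he : e ∈ eigenbundle τ 1 x) : A x e ∈ eigenbundle τ' (-1) x :=
  clm_apply_mem_eigenbundle (by norm_num : (-1 : ℝ) * -1 = 1)
    (S.perturbation_parity hn hψ hτ hτ' x) he

theorem inner_selfDuality_symbol_perturbation (hn : n = 2 * m) (hm : Even m)
    (hψ : ∀ x, (S.action x).chirality m (S.spinor x) = S.spinor x)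
    (hτ : ∀ x e, S.isoE x (τ x e) = (S.action x).pairParity m (S.isoE x e))
    (hT : ∀ x e, S.isoE x (T x e) = pairSelfDuality m (S.isoE x e))
    (hT' : ∀ x e, S.isoF x (T' x e) = pairSelfDuality m (S.isoF x e))
    (x : M) (u : Cotangent n x) {e : E x} (he : e ∈ eigenbundle τ 1 x ⊓ eigenbundle T 1 x)
    (e' : E x) : ⟪T' x (σ x u e), A x e'⟫_ℝ = ⟪σ x u e, A x e'⟫_ℝ := by
  have hparity := hτ x e
  have hselfDuality := hT x e
  rw [mem_eigenbundle.1 he.1, one_smul] at hparity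
  rw [mem_eigenbundle.1 he.2, one_smul] at hselfDuality
  rw [real_inner_eq_re_inner_map (S.isoF x), real_inner_eq_re_inner_map (S.isoF x), hT',
    S.symbol_eq, S.perturbation_eq, (S.action x).inner_pairSelfDuality_pairSymbol hn hm (hψ x) _
      hparity.symm hselfDuality.symm]

theorem inner_selfDuality_symbol_perturbation_symm (hn : n = 2 * m) (hm : Even m)
    (hψ : ∀ x, (S.action x).chirality m (S.spinor x) = S.spinor x)
    (hτ : ∀ x e, S.isoE x (τ x e) = (S.action x).pairParity m (S.isoE x e))
    (hT : ∀ x e, S.isoE x (T x e) = pairSelfDuality m (S.isoE x e))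
    (hT' : ∀ x e, S.isoF x (T' x e) = pairSelfDuality m (S.isoF x e))
    (x : M) (u : Cotangent n x) {e e' : E x} (he : e ∈ eigenbundle τ 1 x ⊓ eigenbundle T 1 x)
    (he' : e' ∈ eigenbundle τ 1 x ⊓ eigenbundle T 1 x) :
    ⟪T' x (σ x u e), A x e'⟫_ℝ = ⟪T' x (σ x u e'), A x e⟫_ℝ := by
  rw [S.inner_selfDuality_symbol_perturbation hn hm hψ hτ hT hT' x u he,
    S.inner_selfDuality_symbol_perturbation hn hm hψ hτ hT hT' x u he',
    S.inner_symbol_perturbation_symm]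

end SpinorFormBundle

end

theorem mainTheorem10
    -- a closed Riemannian manifold
    {n : ℕ} {M : Type*} [EMetricSpace M] [CompactSpace M] [MeasurableSpace M] [BorelSpace M]
    [ChartedSpace (EuclideanSpace ℝ (Fin n)) M] [IsManifold (𝓡 n) ∞ M]
    [RiemannianBundle (fun x : M => TangentSpace (𝓡 n) x)]
    [IsContMDiffRiemannianBundle (𝓡 n) ∞ (EuclideanSpace ℝ (Fin n))
      (fun x : M => TangentSpace (𝓡 n) x)]
    [IsRiemannianManifold (𝓡 n) M]
    -- real vector bundles with metrics
    {FE : Type*} [NormedAddCommGroup FE] [NormedSpace ℝ FE] [FiniteDimensional ℝ FE]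
    {E : M → Type*} [TopologicalSpace (TotalSpace FE E)]
    [∀ x, NormedAddCommGroup (E x)] [∀ x, InnerProductSpace ℝ (E x)]
    [∀ x, FiniteDimensional ℝ (E x)]
    [FiberBundle FE E] [VectorBundle ℝ FE E] [ContMDiffVectorBundle ∞ FE E (𝓡 n)]
    [IsContMDiffRiemannianBundle (𝓡 n) ∞ FE E]
    {FF : Type*} [NormedAddCommGroup FF] [NormedSpace ℝ FF] [FiniteDimensional ℝ FF]
    {F : M → Type*} [TopologicalSpace (TotalSpace FF F)]
    [∀ x, NormedAddCommGroup (F x)] [∀ x, InnerProductSpace ℝ (F x)]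
    [∀ x, FiniteDimensional ℝ (F x)]
    [FiberBundle FF F] [VectorBundle ℝ FF F] [ContMDiffVectorBundle ∞ FF F (𝓡 n)]
    [IsContMDiffRiemannianBundle (𝓡 n) ∞ FF F]
    -- connections, the symbol `σ` of the Dirac operator `D = σ ∘ ∇`, and a bundle map `A`
    (nablaE : CovariantDerivative (𝓡 n) FE E) [CovariantDerivative.ContMDiffCovariantDerivative nablaE ∞]
    (nablaF : CovariantDerivative (𝓡 n) FF F) [CovariantDerivative.ContMDiffCovariantDerivative nablaF ∞]
    (σ : ∀ x : M, Cotangent n x →L[ℝ] (E x →L[ℝ] F x)) (hσ : IsSmoothSymbol FE FF σ)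
    (A : ∀ x : M, E x →L[ℝ] F x) (hA : IsSmoothHom n FE FF A) :
    -- the restriction of a concentrating pair by an involution `T = diag(τ, τ')`
    (∀ (ε : ℝ) (τ : ∀ x : M, E x →L[ℝ] E x) (τ' : ∀ x : M, F x →L[ℝ] F x),
      (ε = 1 ∨ ε = -1) →
      IsMetricInvolution n FE τ → IsMetricInvolution n FF τ' →
      IsParallel nablaE τ → IsParallel nablaF τ' →
      (∀ x u e, σ x u (τ x e) = ε • τ' x (σ x u e)) →
      IsConcentratingPair (n := n) (fun x u => (σ x u : E x →ₗ[ℝ] F x))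
        (fun x => (A x : E x →ₗ[ℝ] F x)) →
      (∀ ξ ∈ sectionsIn n FE (eigenbundle τ 1),
        diracOp nablaE σ (eigenproj τ 1) ξ =
          diracOp nablaE σ (fun x => ContinuousLinearMap.id ℝ (E x)) ξ) ∧
      (∀ x u, Function.Bijective (σ x u) →
        Set.BijOn (σ x u) (eigenbundle τ 1 x) (eigenbundle τ' ε x)) ∧
      IsConcentratingRestriction FE FF (eigenbundle τ 1) (eigenbundle τ' ε)
        (diracOp nablaE σ (eigenproj τ 1)) (fun x u => σ x u)
        (fun x => eigenproj τ' ε x ∘L A x)) ∧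
    -- the parity reduction of spinor-form pairs, in dimension `2m`
    (∀ (m : ℕ) (W : M → Type*) [∀ x, NormedAddCommGroup (W x)] [∀ x, InnerProductSpace ℂ (W x)]
      [∀ x, FiniteDimensional ℂ (W x)]
      (S : SpinorFormBundle E F (fun x u => σ x u) A W)
      (τ : ∀ x : M, E x →L[ℝ] E x) (τ' : ∀ x : M, F x →L[ℝ] F x),
      n = 2 * m →
      (∀ x, (S.action x).chirality m (S.spinor x) = S.spinor x) →
      IsSmoothHom n FE FE τ → IsSmoothHom n FF FF τ' →
      (∀ x e, S.isoE x (τ x e) = (S.action x).pairParity m (S.isoE x e)) →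
      (∀ x e, S.isoF x (τ' x e) = (S.action x).pairParity m (S.isoF x e)) →
      IsMetricInvolution n FE τ ∧ IsMetricInvolution n FF τ' ∧
      (∀ x u e, σ x u (τ x e) = -τ' x (σ x u e)) ∧
      (∀ x, ∀ e ∈ eigenbundle τ 1 x, A x e ∈ eigenbundle τ' (-1) x) ∧
      IsConcentratingRestriction FE FF (eigenbundle τ 1) (eigenbundle τ' (-1))
        (diracOp nablaE σ (eigenproj τ 1)) (fun x u => σ x u)
        (fun x => eigenproj τ' (-1) x ∘L A x)) ∧
    -- the self-duality reduction of spinor-form pairs, in dimension `4m`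
    (∀ (m : ℕ) (W : M → Type*) [∀ x, NormedAddCommGroup (W x)] [∀ x, InnerProductSpace ℂ (W x)]
      [∀ x, FiniteDimensional ℂ (W x)]
      (S : SpinorFormBundle E F (fun x u => σ x u) A W)
      (τ T : ∀ x : M, E x →L[ℝ] E x) (τ' T' : ∀ x : M, F x →L[ℝ] F x),
      n = 4 * m →
      (∀ x, (S.action x).chirality (2 * m) (S.spinor x) = S.spinor x) →
      IsSmoothHom n FE FE τ → IsSmoothHom n FF FF τ' →
      IsSmoothHom n FE FE T → IsSmoothHom n FF FF T' →
      (∀ x e, S.isoE x (τ x e) = (S.action x).pairParity (2 * m) (S.isoE x e)) →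
      (∀ x e, S.isoF x (τ' x e) = (S.action x).pairParity (2 * m) (S.isoF x e)) →
      (∀ x e, S.isoE x (T x e) = pairSelfDuality (2 * m) (S.isoE x e)) →
      (∀ x e, S.isoF x (T' x e) = pairSelfDuality (2 * m) (S.isoF x e)) →
      IsMetricInvolution n FE T ∧ IsMetricInvolution n FF T' ∧
      IsConcentratingRestriction FE FF
        (fun x => eigenbundle τ 1 x ⊓ eigenbundle T 1 x)
        (fun x => eigenbundle τ' (-1) x ⊓ eigenbundle T' 1 x)
        (fun ξ x => eigenproj T' 1 x
          (diracOp nablaE σ (fun x => eigenproj T 1 x ∘L eigenproj τ 1 x) ξ x))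
        (fun x u => eigenproj T' 1 x ∘L σ x u)
        (fun x => eigenproj T' 1 x ∘L eigenproj τ' (-1) x ∘L A x)) := by
  refine ⟨fun ε τ τ' hε hτ hτ' hτp _ hστ hpair => ?_, ?_, ?_⟩
  · have hεε : ε * ε = 1 := by rcases hε with rfl | rfl <;> norm_num
    exact ⟨fun ξ hξ => diracOp_eigenproj hτp hξ,
      fun x u hu => clm_bijOn_eigenbundle hεε (hστ x u) hu,
      hσ.isConcentratingRestriction_eigenbundle hA hεε hτ hτ' hστ (isConcentratingPair_iff.1 hpair)⟩
  · intro m W _ _ _ S τ τ' hn hψ hτs hτs' hτ hτ'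
    have iτ := isMetricInvolution_of_conj_pairParity hn hτs hτ
    have iτ' := isMetricInvolution_of_conj_pairParity hn hτs' hτ'
    have hστ := S.symbol_parity hn hτ hτ'
    exact ⟨iτ, iτ', fun x u e => (hστ x u e).trans (neg_one_smul ℝ _),
      fun x _ he => S.perturbation_mem_eigenbundle hn hψ hτ hτ' x he,
      hσ.isConcentratingRestriction_eigenbundle hA (by norm_num) iτ iτ' hστ
        S.inner_symbol_perturbation_symm⟩
  · intro m W _ _ _ S τ T τ' T' hn hψ hτs hτs' hTs hTs' hτ hτ' hT hT'
    have hn' : n = 2 * (2 * m) := by omega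
    have hm := even_two_mul m
    have iT := isMetricInvolution_of_conj_pairSelfDuality hn' hm hTs hT
    have iT' := isMetricInvolution_of_conj_pairSelfDuality hn' hm hTs' hT'
    exact ⟨iT, iT', hσ.isConcentratingRestriction_inf_eigenbundle hA (by norm_num)
      (isMetricInvolution_of_conj_pairParity hn' hτs hτ)
      (isMetricInvolution_of_conj_pairParity hn' hτs' hτ') iT iT'
      (comm_of_conj_pairParity_pairSelfDuality hn' hτ hT)
      (comm_of_conj_pairParity_pairSelfDuality hn' hτ' hT') (S.symbol_parity hn' hτ hτ')
      (fun x _ he => S.perturbation_mem_eigenbundle hn' hψ hτ hτ' x he)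
      S.inner_symbol_perturbation_symm fun x u _ he _ he' =>
        S.inner_selfDuality_symbol_perturbation_symm hn' hm hψ hτ hT hT' x u he he'⟩
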